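/- For $\sigma\in\mathbb R$ and $1\le p\le\infty$ let $L^p_\sigma(\mathbb R^n)$ be the space of all measurable $f$ with $(1+|x|^2)^{\sigma/2}f\in L^p(\mathbb R^n)$, and let $H^1_\sigma(\mathbb R^n)$ be the Hilbert space of all complex-valued $f\in L^2_\sigma(\mathbb R^n)$ whose weak gradient $\nabla f$ also belongs to $L^2_\sigma(\mathbb R^n)$, with norm $\|f\|^2_{H^1_\sigma}=\|f\|^2_{L^2_\sigma}+\|\nabla f\|^2_{L^2_\sigma}$. Let $n=2$ and $2<p\le\infty$, or $n=3$ and $3\le p\le\infty$. Let $\delta>\frac{n+1}{2}-\frac np$ (with $\frac n\infty=0$) and $\mu>2$. Let $\vec W:\mathbb R^n\to\mathbb R^n$ and $V:\mathbb R^n\to\mathbb R$ be such that $\vec W\in L^\infty_\delta(\mathbb R^n)$, the weak Jacobian satisfies $\nabla\vec W\in L^p_\delta(\mathbb R^n)$, $V\in L^p_{loc}(\mathbb R^n)$, and for some constants $c,R$ $$|V(x)|,\ |\vec W(x)|,\ |\nabla\vec W(x)|\le \frac{c}{|x|^{\mu}}\qquad\text{for almost all } |x|\ge R .$$ For real $k\neq0$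 let $$G_k^+(r)=\frac i4\Big(\frac{|k|}{2\pi r}\Big)^{\frac{n-2}2}H^{(1)}_{\frac{n-2}2}(|k|r),\qquad r>0,$$ where $H^{(1)}_\nu$ is the Hankel function of the first kind, so that $G_k^+(|x-y|)$ is the kernel of $(-\Delta-k^2-i0)^{-1}$, and let $$L_kf(x)=\int_{\mathbb R^n}G_k^+(|x-y|)\Big(i\nabla\cdot(\vec Wf)(y)+i\vec W(y)\cdot\nabla f(y)-\big(|\vec W(y)|^2+V(y)\big)f(y)\Big)\,dy ,$$ where $\nabla\cdot(\vec Wf)$ is the weak divergence. Then there is $\delta_0>\frac12$ such that for every real $k\ne0$ the operator $L_k$ is well defined on $H^1_{-\delta_0}(\mathbb R^n)$ (for every $f\in H^1_{-\delta_0}(\mathbb R^n)$ the weak divergence of $\vec Wf$ is a locally integrable function, and the integral converges absolutely for almost every $x$), and $L_k$ is a compact linear operator from $H^1_{-\delta_0}(\mathbb R^n)$ to itself. -/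

import Mathlib

open MeasureTheory Complex
open scoped ContDiff ENNReal

/-! ### Weak derivatives on `ℝⁿ` -/

/-- `v` is the weak partial derivative `∂_j u` on `ℝⁿ`, tested against real-valued `C_c^∞`
functions. -/
def HasWeakPartial {n : ℕ} {𝕜 : Type} [RCLike 𝕜] (j : Fin n)
    (u v : EuclideanSpace ℝ (Fin n) → 𝕜) : Prop :=
  LocallyIntegrable u ∧ LocallyIntegrable v ∧
    ∀ φ : EuclideanSpace ℝ (Fin n) → ℝ, ContDiff ℝ ∞ φ → HasCompactSupport φ →
      ∫ x, fderiv ℝ φ x (EuclideanSpace.single j 1) • u x = -∫ x, φ x • v x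

/-- `h` is the weak divergence of the complex vector field `F` on `ℝⁿ`. -/
def HasWeakDivergence {n : ℕ} (F : EuclideanSpace ℝ (Fin n) → EuclideanSpace ℂ (Fin n))
    (h : EuclideanSpace ℝ (Fin n) → ℂ) : Prop :=
  LocallyIntegrable F ∧ LocallyIntegrable h ∧
    ∀ φ : EuclideanSpace ℝ (Fin n) → ℝ, ContDiff ℝ ∞ φ → HasCompactSupport φ →
      ∫ x, ∑ j, fderiv ℝ φ x (EuclideanSpace.single j 1) • F x j = -∫ x, φ x • h x

/-! ### Weighted Lebesgue and Sobolev spaces -/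

/-- `f ∈ L^p_σ(ℝⁿ)`: the function `(1 + |x|²)^{σ/2} f` belongs to `L^p(ℝⁿ)`. -/
def MemWeightedLp {n : ℕ} {F : Type} [NormedAddCommGroup F] [NormedSpace ℝ F]
    (f : EuclideanSpace ℝ (Fin n) → F) (p : ℝ≥0∞) (σ : ℝ) : Prop :=
  MemLp (fun x => ((1 + ‖x‖ ^ 2) ^ (σ / 2) : ℝ) • f x) p volume

/-- `f ∈ L^p_loc(ℝⁿ)`. -/
def MemLocalLp {n : ℕ} {F : Type} [NormedAddCommGroup F]
    (f : EuclideanSpace ℝ (Fin n) → F) (p : ℝ≥0∞) : Prop :=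
  ∀ K : Set (EuclideanSpace ℝ (Fin n)), IsCompact K → MemLp f p (volume.restrict K)

/-- The measure `(1 + |x|²)^σ dx`; its `L²` space is `L²_σ(ℝⁿ)`, with
`‖f‖² = ∫ (1 + |x|²)^σ |f|² dx`. -/
noncomputable def weightedVolume (n : ℕ) (σ : ℝ) : Measure (EuclideanSpace ℝ (Fin n)) :=
  volume.withDensity fun x => ENNReal.ofReal ((1 + ‖x‖ ^ 2) ^ σ)

/-- An auxiliary fact: test functions times locally integrable functions are integrable. -/
theorem integrable_test_smul {n : ℕ} {ψ : EuclideanSpace ℝ (Fin n) → ℝ}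
    {u : EuclideanSpace ℝ (Fin n) → ℂ} (hψ : Continuous ψ) (hc : HasCompactSupport ψ)
    (hu : LocallyIntegrable u) : Integrable fun x => ψ x • u x :=
  hu.integrable_smul_left_of_hasCompactSupport hψ hc

theorem HasWeakPartial.congr {n : ℕ} {j : Fin n} {u v u' v' : EuclideanSpace ℝ (Fin n) → ℂ}
    (h : HasWeakPartial j u v) (hu : u =ᵐ[volume] u') (hv : v =ᵐ[volume] v') :
    HasWeakPartial j u' v' := by
  refine ⟨h.1.congr hu, h.2.1.congr hv, fun φ h1 h2 => ?_⟩
  have e1 : ∫ x, fderiv ℝ φ x (EuclideanSpace.single j 1) • u' x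
      = ∫ x, fderiv ℝ φ x (EuclideanSpace.single j 1) • u x :=
    integral_congr_ae (hu.mono fun x hx => by simp only [hx])
  have e2 : ∫ x, φ x • v' x = ∫ x, φ x • v x :=
    integral_congr_ae (hv.mono fun x hx => by simp only [hx])
  rw [e1, e2]
  exact h.2.2 φ h1 h2

theorem HasWeakPartial.add {n : ℕ} {j : Fin n} {u v u' v' : EuclideanSpace ℝ (Fin n) → ℂ}
    (h : HasWeakPartial j u v) (h' : HasWeakPartial j u' v') :
    HasWeakPartial j (u + u') (v + v') := by
  refine ⟨h.1.add h'.1, h.2.1.add h'.2.1, fun φ h1 h2 => ?_⟩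
  have c1 : Continuous fun x => fderiv ℝ φ x (EuclideanSpace.single j 1) :=
    (h1.continuous_fderiv (by simp)).clm_apply continuous_const
  have c2 : HasCompactSupport fun x => fderiv ℝ φ x (EuclideanSpace.single j 1) :=
    h2.fderiv_apply ℝ _
  simp only [Pi.add_apply, smul_add]
  rw [integral_add (integrable_test_smul c1 c2 h.1) (integrable_test_smul c1 c2 h'.1),
    integral_add (integrable_test_smul h1.continuous h2 h.2.1)
      (integrable_test_smul h1.continuous h2 h'.2.1), h.2.2 φ h1 h2, h'.2.2 φ h1 h2]
  ring

theorem HasWeakPartial.const_smul {n : ℕ} {j : Fin n} {u v : EuclideanSpace ℝ (Fin n) → ℂ}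
    (c : ℂ) (h : HasWeakPartial j u v) : HasWeakPartial j (c • u) (c • v) := by
  refine ⟨h.1.smul c, h.2.1.smul c, fun φ h1 h2 => ?_⟩
  simp only [Pi.smul_apply]
  simp_rw [smul_comm _ c]
  rw [integral_smul, integral_smul, h.2.2 φ h1 h2, smul_neg]

theorem HasWeakPartial.zero {n : ℕ} {j : Fin n} :
    HasWeakPartial j (0 : EuclideanSpace ℝ (Fin n) → ℂ) 0 :=
  ⟨locallyIntegrable_zero, locallyIntegrable_zero, fun φ _ _ => by simp⟩

theorem volume_ac_weightedVolume (n : ℕ) (σ : ℝ) :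
    (volume : Measure (EuclideanSpace ℝ (Fin n))) ≪ weightedVolume n σ := by
  refine withDensity_absolutelyContinuous' ?_ ?_
  · refine (Continuous.measurable ?_).ennreal_ofReal.aemeasurable
    exact Continuous.rpow_const (by fun_prop) fun x => Or.inl (by positivity)
  · refine Filter.Eventually.of_forall fun x => ?_
    have : 0 < (1 + ‖x‖ ^ 2) ^ σ := by positivity
    simpa using this

/-- The weighted Sobolev space `H¹_σ(ℝⁿ)` of complex functions: all pairs `(f, ∇f)` with
`f` and its weak gradient in `L²_σ(ℝⁿ)`, normed by
`‖f‖² = ‖f‖²_{L²_σ} + ‖∇f‖²_{L²_σ}`. -/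
noncomputable def WeightedH1 (n : ℕ) (σ : ℝ) :
    Submodule ℂ (WithLp 2 (Lp ℂ 2 (weightedVolume n σ) ×
      Lp (EuclideanSpace ℂ (Fin n)) 2 (weightedVolume n σ))) where
  carrier := {f | ∀ j : Fin n, HasWeakPartial j (fun x => f.fst x) (fun x => f.snd x j)}
  zero_mem' := fun j => by
    have hac := volume_ac_weightedVolume n σ
    refine HasWeakPartial.zero.congr ?_ ?_
    · filter_upwards [hac.ae_le (Lp.coeFn_zero ℂ 2 (weightedVolume n σ))] with x hx
      exact hx.symm
    · filter_upwards [hac.ae_le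
        (Lp.coeFn_zero (EuclideanSpace ℂ (Fin n)) 2 (weightedVolume n σ))] with x hx
      exact (congrArg (fun v : EuclideanSpace ℂ (Fin n) => v j) hx).symm
  add_mem' := fun {f g} hf hg j => by
    have hac := volume_ac_weightedVolume n σ
    refine ((hf j).add (hg j)).congr ?_ ?_
    · filter_upwards [hac.ae_le (Lp.coeFn_add f.fst g.fst)] with x hx
      exact hx.symm
    · filter_upwards [hac.ae_le (Lp.coeFn_add f.snd g.snd)] with x hx
      exact (congrArg (fun v : EuclideanSpace ℂ (Fin n) => v j) hx).symm
  smul_mem' := fun c f hf j => by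
    have hac := volume_ac_weightedVolume n σ
    refine ((hf j).const_smul c).congr ?_ ?_
    · filter_upwards [hac.ae_le (Lp.coeFn_smul c f.fst)] with x hx
      exact hx.symm
    · filter_upwards [hac.ae_le (Lp.coeFn_smul c f.snd)] with x hx
      exact (congrArg (fun v : EuclideanSpace ℂ (Fin n) => v j) hx).symm

/-- The underlying function of an element of `H¹_σ(ℝⁿ)`. -/
noncomputable def h1Fun {n : ℕ} {σ : ℝ} (f : WeightedH1 n σ) :
    EuclideanSpace ℝ (Fin n) → ℂ :=
  fun x => f.1.fst x

/-- The weak gradient of an element of `H¹_σ(ℝⁿ)`. -/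
noncomputable def h1Grad {n : ℕ} {σ : ℝ} (f : WeightedH1 n σ) :
    EuclideanSpace ℝ (Fin n) → EuclideanSpace ℂ (Fin n) :=
  fun x => f.1.snd x

/-! ### The outgoing fundamental solution -/

/-- The Bessel function `J_ν(z)` for `z > 0`, by its power series. -/
noncomputable def besselJ (ν z : ℝ) : ℝ :=
  ∑' m : ℕ, (-1) ^ m / ((m.factorial : ℝ) * Real.Gamma (m + ν + 1)) * (z / 2) ^ (2 * m + ν)

/-- The Bessel function of the second kind `Y_ν(z)` for `z > 0`, for `ν = 0` (Neumann's series)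
and for `ν ∉ ℤ`. -/
noncomputable def besselY (ν z : ℝ) : ℝ :=
  if ν = 0 then
    2 / Real.pi * (Real.log (z / 2) + Real.eulerMascheroniConstant) * besselJ 0 z
      + 2 / Real.pi * ∑' m : ℕ,
          (-1) ^ (m + 1) * (harmonic m : ℝ) / (m.factorial : ℝ) ^ 2 * (z ^ 2 / 4) ^ m
  else
    (besselJ ν z * Real.cos (ν * Real.pi) - besselJ (-ν) z) / Real.sin (ν * Real.pi)

/-- The Hankel function of the first kind `H^{(1)}_ν(z) = J_ν(z) + i Y_ν(z)` for `z > 0`. -/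
noncomputable def hankelOne (ν z : ℝ) : ℂ :=
  (besselJ ν z : ℂ) + I * (besselY ν z : ℂ)

/-- `G_k^+(r)`, the kernel of `(-Δ - k² - i0)⁻¹` in dimension `n = 2, 3`. It depends on `k`
through `k²` only, which is why `|k|` appears. -/
noncomputable def outgoingGreen (n : ℕ) (k r : ℝ) : ℂ :=
  I / 4 * (((|k| / (2 * Real.pi * r)) ^ (((n : ℝ) - 2) / 2) : ℝ) : ℂ)
    * hankelOne (((n : ℝ) - 2) / 2) (|k| * r)

/-! ### The Lippmann–Schwinger operator -/

/-- The vector field `W f` for a real vector field `W` and a complex function `f`. -/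
noncomputable def vectorTimes {n : ℕ} (W : EuclideanSpace ℝ (Fin n) → EuclideanSpace ℝ (Fin n))
    (f : EuclideanSpace ℝ (Fin n) → ℂ) :
    EuclideanSpace ℝ (Fin n) → EuclideanSpace ℂ (Fin n) :=
  fun x => WithLp.toLp 2 fun j => (W x j : ℂ) * f x

/-- `u = L_k f`, where
`L_k f(x) = ∫ G_k^+(|x-y|) (i ∇·(W f) + i W·∇f - (|W|² + V) f)(y) dy`.
Here `h` is the weak divergence `∇·(W f)`, which is unique up to null sets, and the integral
converges absolutely for almost every `x`. -/
def IsLippmannSchwingerImage {n : ℕ} {σ : ℝ} (k : ℝ)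
    (W : EuclideanSpace ℝ (Fin n) → EuclideanSpace ℝ (Fin n))
    (V : EuclideanSpace ℝ (Fin n) → ℝ) (f u : WeightedH1 n σ) : Prop :=
  ∃ h : EuclideanSpace ℝ (Fin n) → ℂ, HasWeakDivergence (vectorTimes W (h1Fun f)) h ∧
    ∀ᵐ x : EuclideanSpace ℝ (Fin n),
      Integrable (fun y => outgoingGreen n k ‖x - y‖ *
        (I * h y + I * ∑ j, (W y j : ℂ) * h1Grad f y j
          - ((‖W y‖ ^ 2 + V y : ℝ) : ℂ) * h1Fun f y)) ∧
      h1Fun u x = ∫ y, outgoingGreen n k ‖x - y‖ *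
        (I * h y + I * ∑ j, (W y j : ℂ) * h1Grad f y j
          - ((‖W y‖ ^ 2 + V y : ℝ) : ℂ) * h1Fun f y)

/-! Write ⟨x⟩ = (1+|x|²)^{1/2} and take δ₀ = μ/2 > 1. By the Leibniz rule `HasWeakPartial.mul`, the
weak divergence of W f is Σ_j (∂_j W_j f + W_j ∂_j f), so the source term of L_k f is 2i W·∇f + (i
div W - |W|² - V) f. The operator L_k is then a bounded map followed by a compact one.

Bounded map (`exists_firstOrderOperator`): the source term lies in L²_{δ₀} whenever f lies in
H¹_{-δ₀}. At infinity every coefficient is O(⟨x⟩^{-2δ₀}), which is exactly the gap between the two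
weights. On a ball W is bounded, while the zeroth order coefficient is only in L^p; there Hölder and
Sobolev's inequality apply, and the admissible range of p is the one that makes the exponents match
(`exists_sobolev_exponents`).

Compact map (`exists_greenOperator`): convolution with the outgoing fundamental solution G sends
L²_{δ₀} to H¹_{-δ₀}. Both G and its gradient are O(|z|^{-(n-1)} + |z|^{-(n-1)/2}) by
`exists_deriv_outgoingGreen`: an energy argument for Bessel's equation when n = 2, an explicit
exponential when n = 3. Away from the diagonal such a kernel is Hilbert–Schmidt between the weighted
spaces, because ⟨x⟩^{-2δ}|x-y|^{-(n-1)}⟨y⟩^{-2δ} is integrable on ℝⁿ × ℝⁿ for δ > 1 and n ≤ 3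
(`lintegral_lintegral_weighted_lt_top`). The gradient is too singular on the diagonal for that, but
its part in |x-y| ≤ ε has norm O(ε) by Schur's test. The whole operator is thus a norm limit of
compact ones (`exists_isCompactOperator_weightedKernel`). Since δ₀ > 1, absolute bounds on the
kernel suffice and its oscillation plays no role.

That the convolution with ∇G is the weak gradient of the convolution with G follows from Fubini
(`HasWeakPartial.convolution`). Compactness passes from the ambient L² product to the Sobolev space
because the latter is closed (`isClosed_weightedH1`). -/

/-! ### Integral operators on L²: Schur's test and Hilbert–Schmidt compactness. -/

section KernelOperators

open scoped NNReal

variable {X Y : Type*} [MeasurableSpace X] [MeasurableSpace Y] {μ : Measure X} {ν : Measure Y}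

/-- `k` is the kernel of an absolutely convergent integral operator `L²(ν) → L²(μ)` of norm at
most `C`. -/
structure IsL2Kernel (μ : Measure X) (ν : Measure Y) (k : X → Y → ℂ) (C : ℝ≥0) : Prop where
  measurable : Measurable (Function.uncurry k)
  lintegral_sq_le : ∀ g : Y → ℝ≥0∞, Measurable g →
    ∫⁻ x, (∫⁻ y, ‖k x y‖ₑ * g y ∂ν) ^ 2 ∂μ ≤ (C : ℝ≥0∞) ^ 2 * ∫⁻ y, g y ^ 2 ∂ν

theorem eLpNorm_two_sq {E : Type*} [NormedAddCommGroup E] (f : X → E) :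
    eLpNorm f 2 μ ^ 2 = ∫⁻ x, ‖f x‖ₑ ^ 2 ∂μ := by
  have := eLpNorm_nnreal_pow_eq_lintegral (μ := μ) (f := f) (p := 2) (by norm_num)
  simpa using this

theorem lintegral_mul_sq_le (f g : Y → ℝ≥0∞) (hf : AEMeasurable f ν) (hg : AEMeasurable g ν) :
    (∫⁻ y, f y * g y ∂ν) ^ 2 ≤ (∫⁻ y, f y ^ 2 ∂ν) * ∫⁻ y, g y ^ 2 ∂ν := by
  have h := ENNReal.lintegral_mul_le_Lp_mul_Lq ν (p := 2) (q := 2)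
    (by constructor <;> norm_num) hf hg
  have h2 := pow_le_pow_left' h 2
  refine h2.trans (le_of_eq ?_)
  rw [mul_pow, ← ENNReal.rpow_natCast, ← ENNReal.rpow_mul, ← ENNReal.rpow_natCast,
    ← ENNReal.rpow_mul]
  norm_num

namespace IsL2Kernel

variable {k : X → Y → ℂ} {C : ℝ≥0}

/-- The constant comes from the crude (a + b)² ≤ 4a² + 4b². It is not sharp, and it need not be:
only its finiteness is used later. -/
theorem add {k' : X → Y → ℂ} {C' : ℝ≥0} (h : IsL2Kernel μ ν k C) (h' : IsL2Kernel μ ν k' C')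
    [SFinite ν] : IsL2Kernel μ ν (fun x y => k x y + k' x y) (2 * (C + C')) := by
  refine ⟨h.measurable.add h'.measurable, fun g hg => ?_⟩
  have m1 : Measurable fun x => ∫⁻ y, ‖k x y‖ₑ * g y ∂ν :=
    Measurable.lintegral_prod_right' (f := fun p : X × Y => ‖k p.1 p.2‖ₑ * g p.2)
      (h.measurable.enorm.mul (hg.comp measurable_snd))
  calc ∫⁻ x, (∫⁻ y, ‖k x y + k' x y‖ₑ * g y ∂ν) ^ 2 ∂μ
      ≤ ∫⁻ x, (4 * (∫⁻ y, ‖k x y‖ₑ * g y ∂ν) ^ 2 + 4 * (∫⁻ y, ‖k' x y‖ₑ * g y ∂ν) ^ 2) ∂μ := by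
        refine lintegral_mono fun x => ?_
        have e : ∫⁻ y, ‖k x y + k' x y‖ₑ * g y ∂ν
            ≤ (∫⁻ y, ‖k x y‖ₑ * g y ∂ν) + ∫⁻ y, ‖k' x y‖ₑ * g y ∂ν := by
          have mx : Measurable fun y => ‖k x y‖ₑ * g y :=
            (h.measurable.comp measurable_prodMk_left).enorm.mul hg
          rw [← lintegral_add_left mx]
          refine lintegral_mono fun y => ?_
          simp only [← add_mul]
          gcongr
          exact enorm_add_le _ _
        refine (pow_le_pow_left' e 2).trans ?_
        rcases le_total (∫⁻ y, ‖k x y‖ₑ * g y ∂ν) (∫⁻ y, ‖k' x y‖ₑ * g y ∂ν) with hle | hle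
        · refine le_trans (pow_le_pow_left' (add_le_add_left hle _) 2) ?_
          rw [← two_mul, mul_pow]
          norm_num
        · refine le_trans (pow_le_pow_left' (add_le_add_right hle _) 2) ?_
          rw [← two_mul, mul_pow]
          norm_num
    _ = 4 * ∫⁻ x, (∫⁻ y, ‖k x y‖ₑ * g y ∂ν) ^ 2 ∂μ
        + 4 * ∫⁻ x, (∫⁻ y, ‖k' x y‖ₑ * g y ∂ν) ^ 2 ∂μ := by
        rw [lintegral_add_left ((m1.pow_const 2).const_mul 4), lintegral_const_mul' _ _ (by simp),
          lintegral_const_mul' _ _ (by simp)]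
    _ ≤ 4 * ((C : ℝ≥0∞) ^ 2 * ∫⁻ y, g y ^ 2 ∂ν) + 4 * ((C' : ℝ≥0∞) ^ 2 * ∫⁻ y, g y ^ 2 ∂ν) := by
        gcongr
        · exact h.lintegral_sq_le g hg
        · exact h'.lintegral_sq_le g hg
    _ = (4 * ((C : ℝ≥0∞) ^ 2 + (C' : ℝ≥0∞) ^ 2)) * ∫⁻ y, g y ^ 2 ∂ν := by ring
    _ ≤ _ := by
        gcongr
        have : 4 * (C ^ 2 + C' ^ 2) ≤ (2 * (C + C')) ^ 2 := by
          have : 0 ≤ C * C' := zero_le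
          calc 4 * (C ^ 2 + C' ^ 2) ≤ 4 * (C ^ 2 + C' ^ 2) + 8 * (C * C') := le_self_add
            _ = _ := by ring
        exact_mod_cast this

/-- The defining bound concerns |k| applied to |g|, a function whose square is therefore integrable
and which is finite almost everywhere. -/
theorem ae_integrable (h : IsL2Kernel μ ν k C) [SFinite ν] (g : Lp ℂ 2 ν) :
    ∀ᵐ x ∂μ, Integrable (fun y => k x y * g y) ν := by
  have hg : Measurable (g : Y → ℂ) := (Lp.stronglyMeasurable g).measurable
  have h1 := h.lintegral_sq_le (fun y => ‖g y‖ₑ) hg.enorm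
  have h2 : ∫⁻ y, ‖g y‖ₑ ^ 2 ∂ν < ⊤ := by
    rw [← eLpNorm_two_sq]
    exact ENNReal.pow_lt_top (Lp.eLpNorm_lt_top g)
  have h3 := h1.trans_lt (ENNReal.mul_lt_top (by simp) h2)
  have m1 : Measurable fun x => ∫⁻ y, ‖k x y‖ₑ * ‖g y‖ₑ ∂ν :=
    Measurable.lintegral_prod_right' (f := fun p : X × Y => ‖k p.1 p.2‖ₑ * ‖g p.2‖ₑ)
      (h.measurable.enorm.mul (hg.enorm.comp measurable_snd))
  filter_upwards [ae_lt_top (m1.pow_const 2) h3.ne] with x hx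
  refine ⟨((h.measurable.comp measurable_prodMk_left).mul hg).aestronglyMeasurable, ?_⟩
  have : ∫⁻ y, ‖k x y‖ₑ * ‖g y‖ₑ ∂ν < ⊤ := by
    by_contra hc
    rw [not_lt, top_le_iff] at hc
    simp [hc] at hx
  simpa [HasFiniteIntegral, enorm_mul] using this

theorem eLpNorm_integral_le (h : IsL2Kernel μ ν k C) (g : Lp ℂ 2 ν) :
    eLpNorm (fun x => ∫ y, k x y * g y ∂ν) 2 μ ≤ C * eLpNorm g 2 ν := by
  have hg : Measurable (g : Y → ℂ) := (Lp.stronglyMeasurable g).measurable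
  rw [← ENNReal.pow_le_pow_left_iff two_ne_zero, mul_pow, eLpNorm_two_sq, eLpNorm_two_sq]
  refine le_trans (lintegral_mono fun x => ?_) (h.lintegral_sq_le (fun y => ‖g y‖ₑ) hg.enorm)
  refine pow_le_pow_left' ?_ 2
  simpa [enorm_mul] using enorm_integral_le_lintegral_enorm (μ := ν) (fun y => k x y * g y)

theorem memLp_integral (h : IsL2Kernel μ ν k C) [SFinite ν] (g : Lp ℂ 2 ν) :
    MemLp (fun x => ∫ y, k x y * g y ∂ν) 2 μ := by
  have hg : Measurable (g : Y → ℂ) := (Lp.stronglyMeasurable g).measurable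
  refine ⟨?_, (h.eLpNorm_integral_le g).trans_lt
    (ENNReal.mul_lt_top (by simp) (Lp.eLpNorm_lt_top g))⟩
  exact (StronglyMeasurable.integral_prod_right' (f := fun p : X × Y => k p.1 p.2 * g p.2)
    (h.measurable.mul (hg.comp measurable_snd)).stronglyMeasurable).aestronglyMeasurable

/-- The integral operator `g ↦ ∫ k(·, y) g(y) dν(y)`. -/
noncomputable def toCLM (h : IsL2Kernel μ ν k C) [SFinite ν] : Lp ℂ 2 ν →L[ℂ] Lp ℂ 2 μ :=
  LinearMap.mkContinuous
    { toFun := fun g => (h.memLp_integral g).toLp _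
      map_add' := fun g g' => by
        rw [← MemLp.toLp_add]
        refine MemLp.toLp_congr _ _ ?_
        filter_upwards [h.ae_integrable g, h.ae_integrable g'] with x hx hx'
        simp only [Pi.add_apply]
        rw [← integral_add hx hx']
        refine integral_congr_ae ?_
        filter_upwards [Lp.coeFn_add g g'] with y hy
        rw [hy, Pi.add_apply, mul_add]
      map_smul' := fun c g => by
        simp only [RingHom.id_apply]
        rw [← MemLp.toLp_const_smul]
        refine MemLp.toLp_congr _ _ (Filter.Eventually.of_forall fun x => ?_)
        simp only [Pi.smul_apply]
        rw [← integral_smul]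
        refine integral_congr_ae ?_
        filter_upwards [Lp.coeFn_smul c g] with y hy
        simp only [hy, Pi.smul_apply, smul_eq_mul]
        ring }
    C fun g => by
      simp only [LinearMap.coe_mk, AddHom.coe_mk, Lp.norm_toLp]
      rw [Lp.norm_def]
      have := ENNReal.toReal_mono (ENNReal.mul_ne_top (by simp) (Lp.eLpNorm_ne_top g))
        (h.eLpNorm_integral_le g)
      simpa using this

theorem coeFn_toCLM (h : IsL2Kernel μ ν k C) [SFinite ν] (g : Lp ℂ 2 ν) :
    h.toCLM g =ᵐ[μ] fun x => ∫ y, k x y * g y ∂ν :=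
  MemLp.coeFn_toLp (h.memLp_integral g)

theorem norm_toCLM_le (h : IsL2Kernel μ ν k C) [SFinite ν] : ‖h.toCLM‖ ≤ C :=
  LinearMap.mkContinuous_norm_le _ C.2 _

/-- The bound `D` is arbitrary because the operator depends on the kernel alone. This lets one fixed
operator be split differently for every cutoff radius. -/
theorem toCLM_add {k' : X → Y → ℂ} {C' D : ℝ≥0} [SFinite ν] (h : IsL2Kernel μ ν k C)
    (h' : IsL2Kernel μ ν k' C') (hs : IsL2Kernel μ ν (fun x y => k x y + k' x y) D) :
    hs.toCLM = h.toCLM + h'.toCLM := by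
  ext1 g
  refine Lp.ext ?_
  refine (hs.coeFn_toCLM g).trans (Filter.EventuallyEq.trans ?_ (Lp.coeFn_add _ _).symm)
  filter_upwards [h.coeFn_toCLM g, h'.coeFn_toCLM g, h.ae_integrable g, h'.ae_integrable g]
    with x e e' i i'
  refine Eq.trans ?_ (congrArg₂ (· + ·) e e').symm
  simp only [add_mul]
  exact integral_add i i'

/-- **Schur test** with equal row and column bounds. -/
theorem of_schur [SFinite ν] [SFinite μ] (hm : Measurable (Function.uncurry k))
    (h1 : ∀ x, ∫⁻ y, ‖k x y‖ₑ ∂ν ≤ C) (h2 : ∀ y, ∫⁻ x, ‖k x y‖ₑ ∂μ ≤ C) :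
    IsL2Kernel μ ν k C := by
  refine ⟨hm, fun g hg => ?_⟩
  have hmx : ∀ x, Measurable fun y => ‖k x y‖ₑ := fun x =>
    (hm.comp measurable_prodMk_left).enorm
  calc ∫⁻ x, (∫⁻ y, ‖k x y‖ₑ * g y ∂ν) ^ 2 ∂μ
      ≤ ∫⁻ x, C * ∫⁻ y, ‖k x y‖ₑ * g y ^ 2 ∂ν ∂μ := by
        refine lintegral_mono fun x => ?_
        -- Cauchy–Schwarz for the splitting |k| g = |k|^{1/2} · (|k|^{1/2} g): the first factor
        -- gives the row bound, the second is integrated by Tonelli with the column bound.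
        have := lintegral_mul_sq_le (ν := ν) (fun y => ‖k x y‖ₑ ^ (1 / 2 : ℝ))
          (fun y => ‖k x y‖ₑ ^ (1 / 2 : ℝ) * g y) ((hmx x).pow_const _).aemeasurable
          (((hmx x).pow_const _).mul hg).aemeasurable
        have e : ∀ a : ℝ≥0∞, (a ^ (1 / 2 : ℝ)) ^ 2 = a := fun a => by
          rw [← ENNReal.rpow_natCast, ← ENNReal.rpow_mul]; norm_num
        have e' : ∀ a b : ℝ≥0∞, a ^ (1 / 2 : ℝ) * (a ^ (1 / 2 : ℝ) * b) = a * b := fun a b => by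
          rw [← mul_assoc, ← sq, e]
        simp only [mul_pow, e, e'] at this
        exact this.trans (mul_le_mul_left (h1 x) _)
    _ = C * ∫⁻ y, ∫⁻ x, ‖k x y‖ₑ * g y ^ 2 ∂μ ∂ν := by
        rw [lintegral_const_mul' _ _ (by simp), lintegral_lintegral_swap]
        exact (hm.enorm.mul ((hg.comp measurable_snd).pow_const 2)).aemeasurable
    _ ≤ C * ∫⁻ y, C * g y ^ 2 ∂ν := by
        gcongr with y
        have my : Measurable fun x => ‖k x y‖ₑ := (hm.comp measurable_prodMk_right).enorm
        rw [lintegral_mul_const _ my]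
        exact mul_le_mul_left (h2 y) _
    _ = _ := by
        rw [lintegral_const_mul' _ _ (by simp)]
        ring

/-- Square integrable kernels define bounded operators. -/
theorem of_lintegral_sq [SFinite ν] (hm : Measurable (Function.uncurry k))
    (h1 : ∫⁻ x, ∫⁻ y, ‖k x y‖ₑ ^ 2 ∂ν ∂μ ≤ (C : ℝ≥0∞) ^ 2) : IsL2Kernel μ ν k C := by
  refine ⟨hm, fun g hg => ?_⟩
  calc ∫⁻ x, (∫⁻ y, ‖k x y‖ₑ * g y ∂ν) ^ 2 ∂μ
      ≤ ∫⁻ x, (∫⁻ y, ‖k x y‖ₑ ^ 2 ∂ν) * ∫⁻ y, g y ^ 2 ∂ν ∂μ :=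
        lintegral_mono fun x => lintegral_mul_sq_le _ _
          (hm.comp measurable_prodMk_left).enorm.aemeasurable hg.aemeasurable
    _ = (∫⁻ x, ∫⁻ y, ‖k x y‖ₑ ^ 2 ∂ν ∂μ) * ∫⁻ y, g y ^ 2 ∂ν :=
        lintegral_mul_const _ (Measurable.lintegral_prod_right'
          (f := fun p : X × Y => ‖k p.1 p.2‖ₑ ^ 2) (hm.enorm.pow_const 2))
    _ ≤ _ := mul_le_mul_left h1 _

end IsL2Kernel

/-- In a separable metric space, a map is measurable if its distances to points are. -/
theorem measurable_of_edist {M : Type*} [PseudoEMetricSpace M] [SecondCountableTopology M]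
    [MeasurableSpace M] [BorelSpace M] {f : X → M} (h : ∀ c, Measurable fun x => edist (f x) c) :
    Measurable f := by
  refine measurable_of_isOpen fun U hU => ?_
  choose! r hr0 hr using fun c (hc : c ∈ U) => EMetric.isOpen_iff.1 hU c hc
  -- Lindelöf: countably many balls exhaust `U`, and the preimage of each ball is a sublevel set of
  -- a measurable distance.
  obtain ⟨T, hTc, hT⟩ := TopologicalSpace.isOpen_iUnion_countable
    (fun c : U => Metric.eball (c : M) (r c)) fun c => Metric.isOpen_eball
  have hU' : U = ⋃ c ∈ T, Metric.eball (c : M) (r c) := by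
    rw [hT]
    ext z
    simp only [Set.mem_iUnion]
    exact ⟨fun hz => ⟨⟨z, hz⟩, Metric.mem_eball_self (hr0 z hz)⟩, fun ⟨c, hc⟩ => hr c c.2 hc⟩
  rw [hU', Set.preimage_iUnion₂]
  exact MeasurableSet.biUnion hTc fun c _ => measurableSet_lt (h c) measurable_const

section HilbertSchmidt

variable {H : Type*} [NormedAddCommGroup H] [NormedSpace ℂ H]

/-- The operator `g ↦ (x ↦ Φ x g)` attached to a square integrable family of functionals. -/
noncomputable def lpFunctionals (μ : Measure X) :
    Lp (H →L[ℂ] ℂ) 2 μ →L[ℂ] H →L[ℂ] Lp ℂ 2 μ :=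
  LinearMap.mkContinuous₂
    (LinearMap.mk₂ ℂ (fun (Φ : Lp (H →L[ℂ] ℂ) 2 μ) (g : H) =>
        (ContinuousLinearMap.apply ℂ ℂ g).compLp Φ)
      (fun Φ Ψ g => ((ContinuousLinearMap.apply ℂ ℂ g).compLpL 2 μ).map_add Φ Ψ)
      (fun c Φ g => ((ContinuousLinearMap.apply ℂ ℂ g).compLpL 2 μ).map_smul c Φ)
      (fun Φ g g' => by rw [map_add, ContinuousLinearMap.add_compLp])
      (fun c Φ g => by rw [map_smul, ContinuousLinearMap.smul_compLp]))
    1 fun Φ g => by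
      rw [one_mul]
      refine (ContinuousLinearMap.norm_compLp_le _ _).trans ?_
      rw [mul_comm]
      gcongr
      refine ContinuousLinearMap.opNorm_le_bound _ (norm_nonneg _) fun φ => ?_
      rw [ContinuousLinearMap.apply_apply, mul_comm]
      exact φ.le_opNorm g

theorem coeFn_lpFunctionals (Φ : Lp (H →L[ℂ] ℂ) 2 μ) (g : H) :
    lpFunctionals μ Φ g =ᵐ[μ] fun x => Φ x g := by
  have := ContinuousLinearMap.coeFn_compLp (ContinuousLinearMap.apply ℂ ℂ g) Φ
  filter_upwards [this] with x hx
  exact hx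

/-- For an indicator times a fixed functional the operator has rank at most one. Sums of these are
dense, the operator depends continuously on `Φ`, and compact operators form a closed set. -/
theorem isCompactOperator_lpFunctionals (Φ : Lp (H →L[ℂ] ℂ) 2 μ) :
    IsCompactOperator (lpFunctionals μ Φ) := by
  refine Lp.induction (by simp) (motive := fun Φ => IsCompactOperator (lpFunctionals μ Φ))
    ?_ ?_ ?_ Φ
  · intro c s hs hμs
    have e : lpFunctionals μ (Lp.simpleFunc.indicatorConst 2 hs hμs.ne c : Lp (H →L[ℂ] ℂ) 2 μ)
        = (ContinuousLinearMap.toSpanSingleton ℂ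
            (indicatorConstLp 2 hs hμs.ne (1 : ℂ))).comp c := by
      ext1 g
      refine Lp.ext ?_
      rw [Lp.simpleFunc.coe_indicatorConst]
      refine (coeFn_lpFunctionals _ g).trans ?_
      simp only [ContinuousLinearMap.comp_apply, ContinuousLinearMap.toSpanSingleton_apply]
      refine Filter.EventuallyEq.trans ?_ (Lp.coeFn_smul _ _).symm
      filter_upwards [indicatorConstLp_coeFn (p := 2) (hs := hs) (hμs := hμs.ne) (c := c),
        indicatorConstLp_coeFn (p := 2) (hs := hs) (hμs := hμs.ne) (c := (1 : ℂ))] with x h1 h2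
      rw [h1, Pi.smul_apply, h2]
      by_cases hx : x ∈ s <;> simp [hx]
    rw [e]
    have hc : IsCompactOperator c := isCompactOperator_of_locallyCompactSpace_dom c
    exact hc.clm_comp (ContinuousLinearMap.toSpanSingleton ℂ
      (indicatorConstLp 2 hs hμs.ne (1 : ℂ)))
  · intro f g hf hg _ h1 h2
    rw [map_add]
    exact h1.add h2
  · exact isClosed_setOfPred_isCompactOperator.preimage (lpFunctionals μ).continuous

end HilbertSchmidt

/-- **Hilbert–Schmidt**: square integrable kernels define compact operators. -/
theorem IsL2Kernel.isCompactOperator {k : X → Y → ℂ} {C : ℝ≥0} [SigmaFinite ν]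
    [MeasurableSpace.CountablyGenerated Y]
    (h : IsL2Kernel μ ν k C) (hk : ∫⁻ x, ∫⁻ y, ‖k x y‖ₑ ^ 2 ∂ν ∂μ < ⊤) :
    IsCompactOperator h.toCLM := by
  classical
  have : Fact ((2 : ℝ≥0∞) ≠ ⊤) := ⟨by simp⟩
  have hm := h.measurable
  -- Conjugated because the inner product is antilinear in its first argument: row x acts on g as
  -- ⟪kc x, g⟫.
  let kc : X → Y → ℂ := fun x y => starRingEnd ℂ (k x y)
  have hkc : Measurable (Function.uncurry kc) := continuous_conj.measurable.comp hm
  have mN : Measurable fun x => ∫⁻ y, ‖k x y‖ₑ ^ 2 ∂ν :=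
    Measurable.lintegral_prod_right' (f := fun p : X × Y => ‖k p.1 p.2‖ₑ ^ 2)
      (hm.enorm.pow_const 2)
  have hmem : ∀ x, MemLp (kc x) 2 ν ↔ ∫⁻ y, ‖k x y‖ₑ ^ 2 ∂ν < ⊤ := fun x => by
    have : eLpNorm (kc x) 2 ν ^ 2 = ∫⁻ y, ‖k x y‖ₑ ^ 2 ∂ν := by
      rw [eLpNorm_two_sq]; simp [kc]
    rw [← this]
    constructor
    · intro hx; exact ENNReal.pow_lt_top hx.2
    · intro hx
      refine ⟨(hkc.comp measurable_prodMk_left).aestronglyMeasurable, ?_⟩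
      by_contra hc
      rw [not_lt, top_le_iff] at hc
      simp [hc] at hx
  -- The rows as elements of L²(ν). The default value zero is taken only on a null set of x, by
  -- `hk`.
  let κ : X → Lp ℂ 2 ν := fun x => if hx : MemLp (kc x) 2 ν then hx.toLp _ else 0
  have hS : MeasurableSet {x | MemLp (kc x) 2 ν} := by
    simp only [hmem]
    exact measurableSet_lt mN measurable_const
  borelize ↥(Lp ℂ 2 ν)
  -- L²(ν) is separable here, so it is enough that the distance of `κ x` to each fixed `c` is
  -- measurable in x, which is Tonelli.
  have hκ : Measurable κ := by
    refine measurable_of_edist fun c => ?_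
    have hc : Measurable (c : Y → ℂ) := (Lp.stronglyMeasurable c).measurable
    have e : (fun x => edist (κ x) c) = fun x => if MemLp (kc x) 2 ν then
        (∫⁻ y, ‖kc x y - c y‖ₑ ^ 2 ∂ν) ^ (1 / 2 : ℝ) else edist 0 c := by
      funext x
      by_cases hx : MemLp (kc x) 2 ν
      · simp only [κ, hx, dite_true, if_true]
        rw [Lp.edist_def, ← eLpNorm_two_sq, ← ENNReal.rpow_natCast, ← ENNReal.rpow_mul]
        norm_num
        refine eLpNorm_congr_ae ?_
        filter_upwards [hx.coeFn_toLp] with y hy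
        simp [hy]
      · simp [κ, hx]
    rw [e]
    refine Measurable.ite hS (Measurable.pow_const ?_ _) measurable_const
    exact Measurable.lintegral_prod_right' (f := fun p : X × Y => ‖kc p.1 p.2 - c p.2‖ₑ ^ 2)
      ((hkc.sub (hc.comp measurable_snd)).enorm.pow_const 2)
  have hκn : ∀ x, ‖κ x‖ₑ ^ 2 ≤ ∫⁻ y, ‖k x y‖ₑ ^ 2 ∂ν := fun x => by
    by_cases hx : MemLp (kc x) 2 ν
    · simp only [κ, hx, dite_true]
      rw [Lp.enorm_toLp, eLpNorm_two_sq]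
      simp [kc]
    · simp [κ, hx]
  have hΦ : MemLp (fun x => innerSL ℂ (κ x)) 2 μ := by
    refine ⟨(innerSL ℂ (E := Lp ℂ 2 ν)).continuous.comp_aestronglyMeasurable
      hκ.stronglyMeasurable.aestronglyMeasurable, ?_⟩
    by_contra hc
    rw [not_lt, top_le_iff] at hc
    have h1 := eLpNorm_two_sq (μ := μ) (fun x => innerSL ℂ (κ x))
    rw [hc] at h1
    have h2 : ∫⁻ x, ‖innerSL ℂ (κ x)‖ₑ ^ 2 ∂μ < ⊤ := by
      refine lt_of_le_of_lt (lintegral_mono fun x => ?_) hk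
      refine le_trans (le_of_eq ?_) (hκn x)
      congr 1
      rw [← ofReal_norm, innerSL_apply_norm, ofReal_norm]
    rw [← h1] at h2
    simp at h2
  have hT : h.toCLM = lpFunctionals μ (hΦ.toLp _) := by
    ext1 g
    refine Lp.ext ?_
    refine (h.coeFn_toCLM g).trans (Filter.EventuallyEq.trans ?_ (coeFn_lpFunctionals _ g).symm)
    filter_upwards [hΦ.coeFn_toLp, ae_lt_top mN hk.ne] with x hx hx'
    have hx2 := (hmem x).2 hx'
    rw [hx, innerSL_apply_apply, L2.inner_def]
    simp only [κ, hx2, dite_true]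
    refine integral_congr_ae ?_
    filter_upwards [hx2.coeFn_toLp] with y hy
    rw [hy]
    simp [kc, mul_comm]
  rw [hT]
  exact isCompactOperator_lpFunctionals _

end KernelOperators

/-! ### Bessel functions and the size of the outgoing fundamental solution. -/

section Bessel

open Real Set

theorem summable_of_abs_le_inv_factorial {a : ℕ → ℝ} (ha : ∀ m, |a m| ≤ 1 / m.factorial) (t : ℝ) :
    Summable fun m => a m * t ^ m := by
  refine Summable.of_norm_bounded (g := fun m : ℕ => |t| ^ m / m.factorial)
    (Real.summable_pow_div_factorial |t|) fun m => ?_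
  rw [norm_mul, norm_pow, Real.norm_eq_abs, Real.norm_eq_abs, div_eq_inv_mul, ← one_div]
  exact mul_le_mul_of_nonneg_right (ha m) (by positivity)

/-- The bound 1/m! survives termwise differentiation of the power series, so the same lemmas yield
first and second derivatives. -/
theorem abs_succ_mul_le_inv_factorial {a : ℕ → ℝ} (ha : ∀ m, |a m| ≤ 1 / m.factorial) (m : ℕ) :
    |((m : ℝ) + 1) * a (m + 1)| ≤ 1 / m.factorial := by
  have h := ha (m + 1)
  rw [abs_mul, abs_of_nonneg (by positivity : (0 : ℝ) ≤ m + 1)]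
  calc ((m : ℝ) + 1) * |a (m + 1)| ≤ (m + 1) * (1 / (m + 1).factorial) := by gcongr
    _ = 1 / m.factorial := by
      rw [Nat.factorial_succ]; push_cast; field_simp

theorem hasDerivAt_tsum_pow {a : ℕ → ℝ} (ha : ∀ m, |a m| ≤ 1 / m.factorial) (t : ℝ) :
    HasDerivAt (fun t => ∑' m, a m * t ^ m) (∑' m : ℕ, ((m : ℝ) + 1) * a (m + 1) * t ^ m) t := by
  set R : ℝ := |t| + 1
  have hR : 0 ≤ R := by positivity
  have hu : Summable fun m : ℕ => (m : ℝ) * (1 / m.factorial) * R ^ (m - 1) := by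
    rw [← summable_nat_add_iff 1]
    refine (Real.summable_pow_div_factorial R).congr fun m => ?_
    rw [Nat.factorial_succ]
    push_cast
    field_simp
  have h := hasDerivAt_tsum_of_isPreconnected (𝕜 := ℝ) (g := fun m t => a m * t ^ m)
    (g' := fun m t => a m * (m * t ^ (m - 1))) (t := Metric.ball 0 R) (y₀ := 0) (y := t)
    hu Metric.isOpen_ball (convex_ball _ _).isPreconnected
    (fun m y _ => (hasDerivAt_pow m y).const_mul (a m)) ?_ ?_
    (summable_of_abs_le_inv_factorial ha 0) ?_
  · convert! h using 1
    have hs : Summable fun m : ℕ => a m * (m * t ^ (m - 1)) := by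
      rw [← summable_nat_add_iff 1]
      refine (summable_of_abs_le_inv_factorial (abs_succ_mul_le_inv_factorial ha) t).congr
        fun m => ?_
      push_cast
      ring
    rw [hs.tsum_eq_zero_add]
    simp only [CharP.cast_eq_zero, zero_mul, mul_zero, zero_add, add_tsub_cancel_right]
    refine tsum_congr fun m => ?_
    push_cast
    ring
  · intro m y hy
    rw [mem_ball_zero_iff, Real.norm_eq_abs] at hy
    rw [norm_mul, norm_mul, norm_pow, Real.norm_eq_abs, Real.norm_eq_abs, Real.norm_eq_abs,
      Nat.abs_cast, ← mul_assoc, mul_comm (|a m|)]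
    gcongr
    exact ha m
  · exact Metric.mem_ball_self (by positivity)
  · rw [mem_ball_zero_iff, Real.norm_eq_abs]
    exact lt_add_one _

/-- Solutions of Bessel's equation of order zero decay like `z ^ (-1/2)`, as do their
derivatives: the energy of `√z w(z)` is decreasing. -/
theorem exists_bound_of_besselEquation {w w' : ℝ → ℝ} (h : ∀ z, 0 < z → HasDerivAt w (w' z) z)
    (h' : ∀ z, 0 < z → HasDerivAt w' (-(w' z) / z - w z) z) :
    ∃ C, ∀ z, 1 ≤ z → |w z| ≤ C * z ^ (-(1 / 2 : ℝ)) ∧ |w' z| ≤ C * z ^ (-(1 / 2 : ℝ)) := by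
  -- For u = √z w Bessel's equation reads u'' + (1 + 1/(4z²)) u = 0. This is u'² + (1 + 1/(4z²)) u²,
  -- whose derivative keeps only the negative term from the decreasing potential.
  let E : ℝ → ℝ := fun z => z * (w' z + w z / (2 * z)) ^ 2 + (1 + 1 / (4 * z ^ 2)) * (z * w z ^ 2)
  have hE : ∀ z, 0 < z → HasDerivAt E (-(w z ^ 2 / (2 * z ^ 2))) z := fun z hz => by
    have hz0 : z ≠ 0 := hz.ne'
    have d1 : HasDerivAt (fun z => w' z + w z / (2 * z))
        (-(w' z) / z - w z + (w' z * (2 * z) - w z * (2 * 1)) / (2 * z) ^ 2) z :=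
      (h' z hz).add ((h z hz).div ((hasDerivAt_id z).const_mul 2) (by positivity))
    have d2 : HasDerivAt (fun z : ℝ => 1 + 1 / (4 * z ^ 2))
        ((0 * (4 * z ^ 2) - 1 * (4 * (2 * z))) / (4 * z ^ 2) ^ 2) z := by
      have := ((hasDerivAt_const z (1 : ℝ)).div (((hasDerivAt_pow 2 z)).const_mul 4)
        (by positivity)).const_add (1 : ℝ)
      simpa using this
    have d3 := ((hasDerivAt_id z).mul (d1.pow 2)).add
      (d2.mul ((hasDerivAt_id z).mul ((h z hz).pow 2)))
    convert! d3 using 1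
    simp only [id, Nat.cast_ofNat, Pi.pow_apply, Pi.mul_apply, Nat.add_one_sub_one, pow_one]
    field_simp
    ring
  have hanti : AntitoneOn E (Ici 1) := by
    refine antitoneOn_of_deriv_nonpos (convex_Ici 1)
      (fun z hz => (hE z (lt_of_lt_of_le one_pos hz)).continuousAt.continuousWithinAt)
      (fun z hz => ?_) fun z hz => ?_
    · rw [interior_Ici] at hz
      exact (hE z (one_pos.trans hz)).differentiableAt.differentiableWithinAt
    · rw [interior_Ici] at hz
      rw [(hE z (one_pos.trans hz)).deriv]
      have : 0 ≤ w z ^ 2 / (2 * z ^ 2) := by positivity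
      linarith
  -- One √(E 1) bounds √z |w|, as well as √z |w' + w/(2z)|; the second pays for removing w/(2z) from
  -- the latter.
  refine ⟨2 * √(E 1), fun z hz => ?_⟩
  have hz0 : 0 < z := one_pos.trans_le hz
  have hle : E z ≤ E 1 := hanti (mem_Ici.2 le_rfl) hz hz
  have key : ∀ u : ℝ, z * u ^ 2 ≤ E 1 → |u| ≤ √(E 1) * z ^ (-(1 / 2 : ℝ)) := fun u hu => by
    rw [Real.rpow_neg hz0.le, ← Real.sqrt_eq_rpow, ← div_eq_mul_inv,
      le_div_iff₀ (Real.sqrt_pos.2 hz0)]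
    refine Real.le_sqrt_of_sq_le ?_
    rw [mul_pow, Real.sq_sqrt hz0.le, sq_abs]
    linarith
  have p1 : 0 ≤ z * (w' z + w z / (2 * z)) ^ 2 := by positivity
  have p2 : 0 ≤ z * w z ^ 2 := by positivity
  have p3 : 0 ≤ 1 / (4 * z ^ 2) * (z * w z ^ 2) := by positivity
  have hEz : E z = z * (w' z + w z / (2 * z)) ^ 2 + z * w z ^ 2
      + 1 / (4 * z ^ 2) * (z * w z ^ 2) := by simp only [E]; ring
  have k1 := key (w z) (by linarith)
  have k2 := key (w' z + w z / (2 * z)) (by linarith)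
  have k3 : 0 ≤ √(E 1) * z ^ (-(1 / 2 : ℝ)) := by positivity
  refine ⟨by linarith, ?_⟩
  have k4 : |w z / (2 * z)| ≤ |w z| := by
    rw [abs_div]
    refine div_le_self (abs_nonneg _) ?_
    rw [abs_of_pos (by positivity)]
    linarith
  have k5 : |w' z| ≤ |w' z + w z / (2 * z)| + |w z / (2 * z)| := by
    have := abs_sub (w' z + w z / (2 * z)) (w z / (2 * z))
    simpa using this
  linarith

/-- The coefficients of `J₀` in powers of `z² / 4`. -/
noncomputable def besselCoeff (m : ℕ) : ℝ := (-1) ^ m / (m.factorial : ℝ) ^ 2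

/-- The coefficients of the power series in Neumann's formula for `Y₀`, in powers of `z² / 4`. -/
noncomputable def neumannCoeff (m : ℕ) : ℝ :=
  (-1) ^ (m + 1) * (harmonic m : ℝ) / (m.factorial : ℝ) ^ 2

theorem abs_besselCoeff_le (m : ℕ) : |besselCoeff m| ≤ 1 / m.factorial := by
  rw [besselCoeff, abs_div, abs_pow, abs_neg, abs_one, one_pow, abs_of_nonneg (by positivity)]
  have : (1 : ℝ) ≤ m.factorial := by exact_mod_cast m.factorial_pos
  gcongr
  nlinarith

theorem harmonic_le_self (m : ℕ) : (harmonic m : ℝ) ≤ m := by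
  induction m with
  | zero => simp
  | succ m ih =>
    rw [harmonic_succ]
    push_cast
    have : ((m : ℝ) + 1)⁻¹ ≤ 1 := inv_le_one_of_one_le₀ (by linarith [(Nat.cast_nonneg m : (0 : ℝ) ≤ m)])
    linarith

theorem abs_neumannCoeff_le (m : ℕ) : |neumannCoeff m| ≤ 1 / m.factorial := by
  have h0 : (0 : ℝ) ≤ harmonic m := by
    exact_mod_cast Finset.sum_nonneg fun i _ => by positivity
  rw [neumannCoeff, abs_div, abs_mul, abs_pow, abs_neg, abs_one, one_pow, one_mul, abs_of_nonneg h0,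
    abs_of_nonneg (by positivity), div_le_div_iff₀ (by positivity) (by positivity)]
  have h1 : (harmonic m : ℝ) ≤ m.factorial :=
    (harmonic_le_self m).trans (by exact_mod_cast m.self_le_factorial)
  have : (0 : ℝ) ≤ m.factorial := by positivity
  nlinarith

/-- In the variable t = z²/4 Bessel's equation of order zero becomes t F'' + F' + F = 0; this is its
coefficient form. -/
theorem besselCoeff_rec (m : ℕ) : ((m : ℝ) + 1) ^ 2 * besselCoeff (m + 1) + besselCoeff m = 0 := by
  simp only [besselCoeff, Nat.factorial_succ]
  push_cast
  field_simp
  ring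

/-- With P the series of J₀, the cross terms from differentiating log(z/2) · P leave the
inhomogeneous equation t Q'' + Q' + Q = -P' for the remaining series Q of Y₀. -/
theorem neumannCoeff_rec (m : ℕ) : ((m : ℝ) + 1) ^ 2 * neumannCoeff (m + 1) + neumannCoeff m
    + ((m : ℝ) + 1) * besselCoeff (m + 1) = 0 := by
  simp only [neumannCoeff, besselCoeff, Nat.factorial_succ, harmonic_succ]
  push_cast
  field_simp
  ring

theorem tsum_pow_ode {a : ℕ → ℝ} (ha : ∀ m, |a m| ≤ 1 / m.factorial) (t : ℝ) :
    t * (∑' m : ℕ, ((m : ℝ) + 1) * (((m + 1 : ℕ) : ℝ) + 1) * a (m + 2) * t ^ m)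
      + (∑' m : ℕ, ((m : ℝ) + 1) * a (m + 1) * t ^ m) + ∑' m, a m * t ^ m
      = ∑' m : ℕ, (((m : ℝ) + 1) ^ 2 * a (m + 1) + a m) * t ^ m := by
  have s0 := summable_of_abs_le_inv_factorial ha t
  have ha1 := abs_succ_mul_le_inv_factorial ha
  have s1 := summable_of_abs_le_inv_factorial ha1 t
  have s2 := summable_of_abs_le_inv_factorial (abs_succ_mul_le_inv_factorial ha1) t
  have s3 : HasSum (fun m : ℕ => (m : ℝ) * ((m : ℝ) + 1) * a (m + 1) * t ^ m)
      (t * ∑' m : ℕ, ((m : ℝ) + 1) * (((m + 1 : ℕ) : ℝ) + 1) * a (m + 2) * t ^ m) := by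
    rw [hasSum_nat_add_iff' 1 |>.symm]
    simp only [Finset.range_one, Finset.sum_singleton, CharP.cast_eq_zero, zero_mul, sub_zero]
    have := s2.hasSum.mul_left t
    convert! this using 1
    · funext m
      push_cast
      ring
    · congr 1
      refine tsum_congr fun m => ?_
      ring
  have := (s3.add s1.hasSum).add s0.hasSum
  rw [← this.tsum_eq]
  refine tsum_congr fun m => ?_
  ring

theorem hasDerivAt_comp_sq_div_four {F : ℝ → ℝ} {F' z : ℝ} (h : HasDerivAt F F' (z ^ 2 / 4)) :
    HasDerivAt (fun z => F (z ^ 2 / 4)) (F' * (z / 2)) z := by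
  have h2 : HasDerivAt (fun z : ℝ => z ^ 2 / 4) (z / 2) z := by
    have := (hasDerivAt_pow 2 z).div_const 4
    convert! this using 1
    simp
    ring
  exact h.comp z h2

theorem besselJ_zero_eq (z : ℝ) :
    besselJ 0 z = ∑' m, besselCoeff m * (z ^ 2 / 4) ^ m := by
  refine tsum_congr fun m => ?_
  rw [add_zero, add_zero, Real.Gamma_nat_eq_factorial, besselCoeff,
    show (2 * (m : ℝ)) = ((2 * m : ℕ) : ℝ) by push_cast; ring, Real.rpow_natCast, pow_mul, ← sq,
    show (z / 2) ^ 2 = z ^ 2 / 4 by ring]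

theorem besselY_zero_eq (z : ℝ) :
    besselY 0 z = 2 / π * (Real.log (z / 2) + eulerMascheroniConstant) * besselJ 0 z
      + 2 / π * ∑' m, neumannCoeff m * (z ^ 2 / 4) ^ m := by
  rw [besselY, if_pos rfl]
  rfl

/-- `w` extends to a solution of Bessel's equation of order zero on `(0, ∞)` with the behaviour of
a logarithm at zero, so `w` and its derivative satisfy global bounds. -/
def IsBesselLike (w : ℝ → ℝ) : Prop :=
  ∃ (w' : ℝ → ℝ) (C : ℝ), (∀ z, 0 < z → HasDerivAt w (w' z) z) ∧ ContinuousOn w' (Ioi 0) ∧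
    ∀ z, 0 < z → |w z| ≤ C * z ^ (-(1 / 2 : ℝ)) ∧ |w' z| ≤ C * (z ^ (-1 : ℝ) + z ^ (-(1 / 2 : ℝ)))

/-- The energy bound covers z ≥ 1, so a particular solution only has to be examined on (0, 1], where
z^{-1/2} leaves room for a logarithm and z^{-1} for its derivative. -/
theorem isBesselLike_of_ode {w w' : ℝ → ℝ} {C : ℝ} (h : ∀ z, 0 < z → HasDerivAt w (w' z) z)
    (h' : ∀ z, 0 < z → HasDerivAt w' (-(w' z) / z - w z) z)
    (h0 : ∀ z, 0 < z → z ≤ 1 → |w z| ≤ C * z ^ (-(1 / 2 : ℝ)) ∧ |w' z| ≤ C * z ^ (-1 : ℝ)) :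
    IsBesselLike w := by
  obtain ⟨D, hD⟩ := exists_bound_of_besselEquation h h'
  refine ⟨w', max (max C D) 0, h, fun z hz => (h' z hz).continuousAt.continuousWithinAt,
    fun z hz => ?_⟩
  have e1 : 0 ≤ z ^ (-(1 / 2 : ℝ)) := by positivity
  have e2 : 0 ≤ z ^ (-1 : ℝ) := by positivity
  have hC : C ≤ max (max C D) 0 := (le_max_left _ _).trans (le_max_left _ _)
  have hD' : D ≤ max (max C D) 0 := (le_max_right _ _).trans (le_max_left _ _)
  have h00 : 0 ≤ max (max C D) 0 := le_max_right _ _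
  rcases le_total z 1 with hz1 | hz1
  · obtain ⟨a, b⟩ := h0 z hz hz1
    refine ⟨a.trans (by gcongr), b.trans ?_⟩
    calc C * z ^ (-1 : ℝ) ≤ max (max C D) 0 * z ^ (-1 : ℝ) := by gcongr
      _ ≤ _ := by gcongr; linarith
  · obtain ⟨a, b⟩ := hD z hz1
    refine ⟨a.trans (by gcongr), b.trans ?_⟩
    calc D * z ^ (-(1 / 2) : ℝ) ≤ max (max C D) 0 * z ^ (-(1 / 2) : ℝ) := by gcongr
      _ ≤ _ := by gcongr; linarith

theorem exists_bound_unit {F : ℝ → ℝ} (h : Continuous F) :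
    ∃ C, 0 ≤ C ∧ ∀ z, 0 < z → z ≤ 1 → |F (z ^ 2 / 4)| ≤ C := by
  obtain ⟨C, hC⟩ := isCompact_Icc.exists_bound_of_continuousOn (s := Icc (0 : ℝ) 1) h.continuousOn
  refine ⟨max C 0, le_max_right _ _, fun z h0 h1 => (hC _ ⟨by positivity, ?_⟩).trans
    (le_max_left _ _)⟩
  nlinarith

/-- Here z^{1/2} |log z| < 2 and |γ - log 2| ≤ 1, so the constant 5 is generous. -/
theorem abs_log_half_add_le {z : ℝ} (h0 : 0 < z) (h1 : z ≤ 1) :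
    |Real.log (z / 2) + eulerMascheroniConstant| ≤ 5 * z ^ (-(1 / 2 : ℝ)) := by
  have a1 := Real.abs_log_mul_self_rpow_lt z (1 / 2) h0 h1 (by norm_num)
  have hp : 0 < z ^ (1 / 2 : ℝ) := by positivity
  have hp1 : z ^ (1 / 2 : ℝ) ≤ 1 := Real.rpow_le_one h0.le h1 (by norm_num)
  rw [abs_mul, abs_of_pos hp] at a1
  have l2 : 0 < Real.log 2 := Real.log_pos (by norm_num)
  have l3 : Real.log 2 < 1 := by linarith [Real.log_two_lt_d9]
  have g1 := Real.one_half_lt_eulerMascheroniConstant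
  have g2 := Real.eulerMascheroniConstant_lt_two_thirds
  rw [Real.rpow_neg h0.le, ← div_eq_mul_inv, le_div_iff₀ hp, Real.log_div h0.ne' (by norm_num)]
  have : |Real.log z - Real.log 2 + eulerMascheroniConstant| ≤ |Real.log z| + 1 := by
    rw [sub_add, ]
    refine (abs_sub _ _).trans ?_
    gcongr
    rw [abs_le]
    constructor <;> linarith
  nlinarith [abs_nonneg (Real.log z)]

/-- With J₀ = P(z²/4) and Y₀ = (2/π)((log(z/2) + γ) P(z²/4) + Q(z²/4)), the differential equations
for P and Q give Bessel's equation, and continuity of the series gives the bounds near zero. -/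
theorem isBesselLike_besselJ_besselY : IsBesselLike (besselJ 0) ∧ IsBesselLike (besselY 0) := by
  have hP := hasDerivAt_tsum_pow abs_besselCoeff_le
  have hP1 := hasDerivAt_tsum_pow (abs_succ_mul_le_inv_factorial abs_besselCoeff_le)
  have oP := fun t => tsum_pow_ode abs_besselCoeff_le t
  have hQ := hasDerivAt_tsum_pow abs_neumannCoeff_le
  have hQ1 := hasDerivAt_tsum_pow (abs_succ_mul_le_inv_factorial abs_neumannCoeff_le)
  have oQ := fun t => tsum_pow_ode abs_neumannCoeff_le t
  simp only [besselCoeff_rec, zero_mul, tsum_zero] at oP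
  simp only [fun m => eq_neg_of_add_eq_zero_left (neumannCoeff_rec m), neg_mul, tsum_neg] at oQ
  simp only [← mul_assoc] at hP1 hQ1
  have eJ : ∀ z, 0 < z → besselJ 0 z = ∑' m, besselCoeff m * (z ^ 2 / 4) ^ m :=
    fun z _ => besselJ_zero_eq z
  set P : ℝ → ℝ := fun t => ∑' m, besselCoeff m * t ^ m with hPdef
  set P1 : ℝ → ℝ := fun t => ∑' m : ℕ, ((m : ℝ) + 1) * besselCoeff (m + 1) * t ^ m with hP1def
  set P2 : ℝ → ℝ := fun t => ∑' m : ℕ, ((m : ℝ) + 1) * (((m + 1 : ℕ) : ℝ) + 1)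
    * besselCoeff (m + 2) * t ^ m with hP2def
  set Q : ℝ → ℝ := fun t => ∑' m, neumannCoeff m * t ^ m with hQdef
  set Q1 : ℝ → ℝ := fun t => ∑' m : ℕ, ((m : ℝ) + 1) * neumannCoeff (m + 1) * t ^ m with hQ1def
  set Q2 : ℝ → ℝ := fun t => ∑' m : ℕ, ((m : ℝ) + 1) * (((m + 1 : ℕ) : ℝ) + 1)
    * neumannCoeff (m + 2) * t ^ m with hQ2def
  replace hP : ∀ t, HasDerivAt P (P1 t) t := hP
  replace hP1 : ∀ t, HasDerivAt P1 (P2 t) t := hP1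
  replace hQ : ∀ t, HasDerivAt Q (Q1 t) t := hQ
  replace hQ1 : ∀ t, HasDerivAt Q1 (Q2 t) t := hQ1
  replace oP : ∀ t, t * P2 t + P1 t + P t = 0 := oP
  replace oQ : ∀ t, t * Q2 t + Q1 t + Q t = -P1 t := oQ
  replace eJ : ∀ z, 0 < z → besselJ 0 z = P (z ^ 2 / 4) := eJ
  have eY : ∀ z, 0 < z → besselY 0 z = 2 / π * ((Real.log (z / 2) + eulerMascheroniConstant)
      * P (z ^ 2 / 4) + Q (z ^ 2 / 4)) := fun z hz => by
    rw [besselY_zero_eq, eJ z hz]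
    ring
  -- From here on the series are forgotten: only the derivative relations and the equations `oP`,
  -- `oQ` matter.
  clear_value P P1 P2 Q Q1 Q2
  have cont : ∀ {F F' : ℝ → ℝ}, (∀ t, HasDerivAt F (F' t) t) → Continuous F := fun h =>
    continuous_iff_continuousAt.2 fun t => (h t).continuousAt
  obtain ⟨cP, cP0, bP⟩ := exists_bound_unit (cont hP)
  obtain ⟨cP1, cP10, bP1⟩ := exists_bound_unit (cont hP1)
  obtain ⟨cQ, cQ0, bQ⟩ := exists_bound_unit (cont hQ)
  obtain ⟨cQ1, cQ10, bQ1⟩ := exists_bound_unit (cont hQ1)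
  have one_le : ∀ z : ℝ, 0 < z → z ≤ 1 → ∀ s : ℝ, s ≤ 0 → 1 ≤ z ^ s :=
    fun z h0 h1 s hs => Real.one_le_rpow_of_pos_of_le_one_of_nonpos h0 h1 hs
  have dJ : ∀ z, HasDerivAt (fun z => P1 (z ^ 2 / 4) * (z / 2))
      (P2 (z ^ 2 / 4) * (z / 2) * (z / 2) + P1 (z ^ 2 / 4) * (1 / 2)) z := fun z =>
    (hasDerivAt_comp_sq_div_four (hP1 _)).mul ((hasDerivAt_id z).div_const 2)
  have dQ : ∀ z, HasDerivAt (fun z => Q1 (z ^ 2 / 4) * (z / 2))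
      (Q2 (z ^ 2 / 4) * (z / 2) * (z / 2) + Q1 (z ^ 2 / 4) * (1 / 2)) z := fun z =>
    (hasDerivAt_comp_sq_div_four (hQ1 _)).mul ((hasDerivAt_id z).div_const 2)
  have dl : ∀ z : ℝ, 0 < z → HasDerivAt (fun z => Real.log (z / 2) + eulerMascheroniConstant)
      z⁻¹ z := fun z hz => by
    have := (((hasDerivAt_id z).div_const 2).log (by simp [hz.ne'])).add_const
      eulerMascheroniConstant
    convert! this using 1
    simp
    field_simp
  constructor
  · refine isBesselLike_of_ode (w' := fun z => P1 (z ^ 2 / 4) * (z / 2)) (C := max cP cP1)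
      (fun z hz => ?_) (fun z hz => ?_) fun z h0 h1 => ⟨?_, ?_⟩
    · refine (hasDerivAt_comp_sq_div_four (hP _)).congr_of_eventuallyEq ?_
      filter_upwards [lt_mem_nhds hz] with y hy using eJ y hy
    · convert! dJ z using 1
      rw [eJ z hz]
      have := oP (z ^ 2 / 4)
      field_simp at this ⊢
      linear_combination -this
    · rw [eJ z h0]
      calc |P (z ^ 2 / 4)| ≤ max cP cP1 * 1 := by
            rw [mul_one]; exact (bP z h0 h1).trans (le_max_left _ _)
        _ ≤ _ := by gcongr; exact one_le z h0 h1 _ (by norm_num)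
    · rw [abs_mul, abs_of_pos (by positivity : 0 < z / 2)]
      calc |P1 (z ^ 2 / 4)| * (z / 2) ≤ max cP cP1 * 1 := by
            gcongr
            · exact (bP1 z h0 h1).trans (le_max_right _ _)
            · linarith
        _ ≤ _ := by gcongr; exact one_le z h0 h1 _ (by norm_num)
  · have hpi : 0 < 2 / π := by positivity
    refine isBesselLike_of_ode (w' := fun z => 2 / π * (z⁻¹ * P (z ^ 2 / 4)
        + (Real.log (z / 2) + eulerMascheroniConstant) * (P1 (z ^ 2 / 4) * (z / 2))
        + Q1 (z ^ 2 / 4) * (z / 2))) (C := 2 / π * (5 * cP + cQ + cP + 5 * cP1 + cQ1))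
      (fun z hz => ?_) (fun z hz => ?_) fun z h0 h1 => ⟨?_, ?_⟩
    · have := (((dl z hz).mul (hasDerivAt_comp_sq_div_four (hP (z ^ 2 / 4)))).add
        (hasDerivAt_comp_sq_div_four (hQ (z ^ 2 / 4)))).const_mul (2 / π)
      refine this.congr_of_eventuallyEq ?_
      filter_upwards [lt_mem_nhds hz] with y hy using eY y hy
    · have := ((((hasDerivAt_inv hz.ne').mul (hasDerivAt_comp_sq_div_four (hP (z ^ 2 / 4)))).add
        ((dl z hz).mul (dJ z))).add (dQ z)).const_mul (2 / π)
      convert! this using 1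
      rw [eY z hz]
      have o1 := oP (z ^ 2 / 4)
      have o2 := oQ (z ^ 2 / 4)
      field_simp at o1 o2 ⊢
      -- The terms with a logarithm cancel by the equation for P, the others by the inhomogeneous
      -- equation for Q.
      linear_combination (-(Real.log (z / 2) + eulerMascheroniConstant)) * o1 * z ^ 2 - o2 * z ^ 2
    · rw [eY z h0, abs_mul, abs_of_pos hpi, mul_assoc]
      gcongr
      have l := abs_log_half_add_le h0 h1
      have o := one_le z h0 h1 (-(1 / 2)) (by norm_num)
      have t1 : |(Real.log (z / 2) + eulerMascheroniConstant) * P (z ^ 2 / 4)|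
          ≤ 5 * z ^ (-(1 / 2) : ℝ) * cP := by
        rw [abs_mul]; gcongr; exact bP z h0 h1
      have t2 : |Q (z ^ 2 / 4)| ≤ cQ * z ^ (-(1 / 2) : ℝ) :=
        (bQ z h0 h1).trans (le_mul_of_one_le_right cQ0 o)
      refine (abs_add_le _ _).trans ?_
      have : 0 ≤ (cP + 5 * cP1 + cQ1) * z ^ (-(1 / 2) : ℝ) := by positivity
      linarith
    · rw [abs_mul, abs_of_pos hpi, mul_assoc]
      gcongr
      have l := abs_log_half_add_le h0 h1
      have o := one_le z h0 h1 (-1) (by norm_num)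
      have o' : z ^ (-(1 / 2) : ℝ) ≤ z ^ (-1 : ℝ) :=
        Real.rpow_le_rpow_of_exponent_ge h0 h1 (by norm_num)
      have t0 : |z⁻¹ * P (z ^ 2 / 4)| ≤ z ^ (-1 : ℝ) * cP := by
        rw [abs_mul, abs_of_pos (inv_pos.2 h0), Real.rpow_neg_one]; gcongr; exact bP z h0 h1
      have t1 : |(Real.log (z / 2) + eulerMascheroniConstant) * (P1 (z ^ 2 / 4) * (z / 2))|
          ≤ 5 * z ^ (-1 : ℝ) * (cP1 * 1) := by
        rw [abs_mul, abs_mul, abs_of_pos (by positivity : 0 < z / 2)]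
        gcongr
        · exact l.trans (by gcongr)
        · exact bP1 z h0 h1
        · linarith
      have t2 : |Q1 (z ^ 2 / 4) * (z / 2)| ≤ cQ1 * z ^ (-1 : ℝ) := by
        rw [abs_mul, abs_of_pos (by positivity : 0 < z / 2)]
        gcongr
        · exact bQ1 z h0 h1
        · linarith
      refine (abs_add_three _ _ _).trans ?_
      have : 0 ≤ (5 * cP + cQ) * z ^ (-1 : ℝ) := by positivity
      linarith

/-- Legendre duplication at half-integers. It turns the Bessel series of orders ±1/2 into the Taylor
series of sine and cosine. -/
theorem factorial_mul_Gamma_add_half (m : ℕ) :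
    (m.factorial : ℝ) * Real.Gamma (m + 1 / 2) * 2 ^ (2 * m) = (2 * m).factorial * √π := by
  induction m with
  | zero => simpa using Real.Gamma_one_half_eq
  | succ m ih =>
    have e : Real.Gamma ((m + 1 : ℕ) + 1 / 2) = (m + 1 / 2) * Real.Gamma (m + 1 / 2) := by
      rw [← Real.Gamma_add_one (by positivity)]
      congr 1
      push_cast
      ring
    rw [e, show 2 * (m + 1) = 2 * m + 1 + 1 by ring, Nat.factorial_succ, Nat.factorial_succ,
      Nat.factorial_succ]
    push_cast
    linear_combination (4 * (m + 1) * (m + 1 / 2)) * ih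

theorem besselJ_neg_half {z : ℝ} (hz : 0 < z) :
    besselJ (-(1 / 2)) z = (z / 2) ^ (-(1 / 2) : ℝ) / √π * Real.cos z := by
  rw [besselJ, Real.cos_eq_tsum, ← tsum_mul_left]
  refine tsum_congr fun m => ?_
  have hG : (0 : ℝ) < Real.Gamma (m + 1 / 2) := Real.Gamma_pos_of_pos (by positivity)
  have h := factorial_mul_Gamma_add_half m
  have hpi : 0 < √π := by positivity
  rw [show (m : ℝ) + -(1 / 2) + 1 = m + 1 / 2 by ring, Real.rpow_add (by positivity),
    show (2 * (m : ℝ)) = ((2 * m : ℕ) : ℝ) by push_cast; ring, Real.rpow_natCast, div_pow]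
  have hf : (0 : ℝ) < (2 * m).factorial := by positivity
  have hm : (0 : ℝ) < m.factorial := by positivity
  generalize Real.Gamma (m + 1 / 2) = Γ at hG h ⊢
  field_simp
  linear_combination -h

theorem besselJ_half {z : ℝ} (hz : 0 < z) :
    besselJ (1 / 2) z = (z / 2) ^ (-(1 / 2) : ℝ) / √π * Real.sin z := by
  rw [besselJ, Real.sin_eq_tsum, ← tsum_mul_left]
  refine tsum_congr fun m => ?_
  have hG : (0 : ℝ) < Real.Gamma (m + 1 / 2) := Real.Gamma_pos_of_pos (by positivity)
  have h := factorial_mul_Gamma_add_half m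
  have hpi : 0 < √π := by positivity
  rw [show (m : ℝ) + 1 / 2 + 1 = (m + 1 / 2) + 1 by ring, Real.Gamma_add_one (by positivity),
    show (2 * (m : ℝ)) + 1 / 2 = ((2 * m + 1 : ℕ) : ℝ) + -(1 / 2) by push_cast; ring,
    Real.rpow_add (by positivity), Real.rpow_natCast, div_pow, Nat.factorial_succ]
  have hf : (0 : ℝ) < (2 * m).factorial := by positivity
  have hm : (0 : ℝ) < m.factorial := by positivity
  push_cast
  generalize Real.Gamma (m + 1 / 2) = Γ at hG h ⊢
  field_simp
  rw [pow_succ]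
  linear_combination -2 * h

/-- Since Y_{1/2} = -J_{-1/2}, the Hankel function is a multiple of sin - i cos. The powers of |k|
in the two prefactors cancel, and i/4 turns the bracket into an exponential. -/
theorem outgoingGreen_three {k r : ℝ} (hk : k ≠ 0) (hr : 0 < r) :
    outgoingGreen 3 k r = exp (I * (|k| * r : ℝ)) / (4 * π * r : ℝ) := by
  have hk' : 0 < |k| := abs_pos.2 hk
  have hz : 0 < |k| * r := by positivity
  have hν : (((3 : ℕ) : ℝ) - 2) / 2 = 1 / 2 := by norm_num
  have hY : besselY (1 / 2) (|k| * r) = -besselJ (-(1 / 2)) (|k| * r) := by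
    rw [besselY, if_neg (by norm_num), show (1 / 2 : ℝ) * π = π / 2 by ring, Real.cos_pi_div_two,
      Real.sin_pi_div_two]
    simp
  rw [outgoingGreen, hankelOne, hν, hY, besselJ_half hz, besselJ_neg_half hz]
  have hc : (|k| / (2 * π * r)) ^ (1 / 2 : ℝ) * ((|k| * r / 2) ^ (-(1 / 2) : ℝ) / √π)
      = 1 / (π * r) := by
    have hA : |k| / (2 * π * r) = |k| * r / 2 * π / (π * r) ^ 2 := by field_simp
    have hB : 0 < √(|k| * r / 2) := by positivity
    have hC : 0 < √π := by positivity
    rw [Real.rpow_neg (by positivity), ← Real.sqrt_eq_rpow, ← Real.sqrt_eq_rpow, hA,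
      Real.sqrt_div' _ (by positivity), Real.sqrt_sq (by positivity),
      Real.sqrt_mul (by positivity)]
    field_simp
  have hc' := congrArg (fun t : ℝ => (t : ℂ)) hc
  have he : exp (I * (|k| * r : ℝ)) = Complex.cos (|k| * r : ℝ) + Complex.sin (|k| * r : ℝ) * I := by
    rw [mul_comm, Complex.exp_mul_I]
  rw [he]
  generalize (|k| / (2 * π * r)) ^ (1 / 2 : ℝ) = A at hc' ⊢
  generalize (|k| * r / 2) ^ (-(1 / 2) : ℝ) / √π = B at hc' ⊢
  have hpr : ((π * r : ℝ) : ℂ) ≠ 0 := by exact_mod_cast (by positivity : 0 < π * r).ne'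
  have hAB : (A : ℂ) * B = 1 / (π * r : ℝ) := by
    rw [← Complex.ofReal_mul, hc']
    push_cast
    rfl
  have h4 : ((4 * π * r : ℝ) : ℂ) = 4 * (π * r : ℝ) := by push_cast; ring
  rw [h4]
  simp only [Complex.ofReal_mul B, Complex.ofReal_neg, Complex.ofReal_sin, Complex.ofReal_cos]
  generalize ((π * r : ℝ) : ℂ) = D at hpr hAB ⊢
  generalize Complex.cos _ = c
  generalize Complex.sin _ = s
  have hD : (4 * D)⁻¹ = A * B / 4 := by
    rw [hAB]
    field_simp
  rw [div_eq_mul_inv _ (4 * D), hD]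
  linear_combination (-(A : ℂ) * B * c / 4) * I_sq

/-- The outgoing fundamental solution is `C¹` away from zero, with the bounds that the kernel and
its gradient satisfy in dimensions two and three. -/
theorem exists_deriv_outgoingGreen {n : ℕ} (hn : n = 2 ∨ n = 3) {k : ℝ} (hk : k ≠ 0) :
    ∃ (g' : ℝ → ℂ) (C : ℝ), 0 ≤ C ∧ (∀ r, 0 < r → HasDerivAt (outgoingGreen n k) (g' r) r) ∧
      ContinuousOn g' (Ioi 0) ∧
      (∀ r, 0 < r → ‖outgoingGreen n k r‖ ≤ C * r ^ (-(((n : ℝ) - 1) / 2))) ∧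
      ∀ r, 0 < r → ‖g' r‖ ≤ C * (r ^ (-((n : ℝ) - 1)) + r ^ (-(((n : ℝ) - 1) / 2))) := by
  have hk' : 0 < |k| := abs_pos.2 hk
  rcases hn with rfl | rfl
  · obtain ⟨⟨J', CJ, dJ, cJ, bJ⟩, ⟨Y', CY, dY, cY, bY⟩⟩ := isBesselLike_besselJ_besselY
    have hG : ∀ r, outgoingGreen 2 k r
        = I / 4 * ((besselJ 0 (|k| * r) : ℂ) + I * (besselY 0 (|k| * r) : ℂ)) := fun r => by
      have hν : (((2 : ℕ) : ℝ) - 2) / 2 = 0 := by norm_num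
      rw [outgoingGreen, hν, hankelOne]
      simp
    have nI : ∀ a b : ℝ, ‖I / 4 * ((a : ℂ) + I * (b : ℂ))‖ ≤ |a| + |b| := fun a b => by
      rw [norm_mul]
      have h1 : ‖I / 4‖ ≤ 1 := by simp; norm_num
      have h2 : ‖(a : ℂ) + I * (b : ℂ)‖ ≤ |a| + |b| := by
        refine (norm_add_le _ _).trans ?_
        simp
      calc _ ≤ 1 * (|a| + |b|) := by gcongr
        _ = _ := one_mul _
    have hC0 : 0 ≤ CJ + CY := by
      have a := (bJ 1 one_pos).1
      have b := (bY 1 one_pos).1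
      rw [Real.one_rpow, mul_one] at a b
      exact add_nonneg ((abs_nonneg _).trans a) ((abs_nonneg _).trans b)
    -- One constant for both estimates: the last factor comes from rescaling by |k| in the bounds of
    -- the Bessel functions, and 1 + |k| absorbs the chain rule.
    set c := (CJ + CY) * (1 + |k|) * (|k| ^ (-(1 / 2) : ℝ) + |k| ^ (-1 : ℝ)) with hc
    have hc1 : (CJ + CY) * |k| ^ (-(1 / 2) : ℝ) ≤ c := by
      rw [hc, mul_assoc]
      gcongr
      have : 0 ≤ |k| ^ (-(1 / 2) : ℝ) := by positivity
      have : 0 ≤ |k| ^ (-1 : ℝ) := by positivity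
      nlinarith
    refine ⟨fun r => I / 4 * (((J' (|k| * r) * |k| : ℝ) : ℂ) + I * ((Y' (|k| * r) * |k| : ℝ) : ℂ)),
      c, by positivity, fun r hr => ?_, ?_, fun r hr => ?_, fun r hr => ?_⟩
    · have hz : 0 < |k| * r := by positivity
      have hl : HasDerivAt (fun r => |k| * r) |k| r := by
        simpa using (hasDerivAt_id r).const_mul |k|
      have h1 := ((dJ _ hz).comp r hl).ofReal_comp
      have h2 := (((dY _ hz).comp r hl).ofReal_comp).const_mul I
      have h3 := (h1.add h2).const_mul (I / 4)
      refine h3.congr_of_eventuallyEq (Filter.Eventually.of_forall fun r => ?_)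
      simp [hG]
    · have hm : MapsTo (fun r => |k| * r) (Ioi 0) (Ioi (0 : ℝ)) := fun r hr => by
        simp only [mem_Ioi] at hr ⊢; positivity
      have cl : ContinuousOn (fun r => |k| * r) (Ioi 0) := by fun_prop
      have h1 : ContinuousOn (fun r => J' (|k| * r)) (Ioi 0) := cJ.comp cl hm
      have h2 : ContinuousOn (fun r => Y' (|k| * r)) (Ioi 0) := cY.comp cl hm
      fun_prop
    · have hz : 0 < |k| * r := by positivity
      rw [hG]
      refine (nI _ _).trans ?_
      have e : (-((((2 : ℕ) : ℝ) - 1) / 2)) = -(1 / 2) := by norm_num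
      rw [e]
      calc _ ≤ CJ * (|k| * r) ^ (-(1 / 2) : ℝ) + CY * (|k| * r) ^ (-(1 / 2) : ℝ) :=
            add_le_add (bJ _ hz).1 (bY _ hz).1
        _ = (CJ + CY) * |k| ^ (-(1 / 2) : ℝ) * r ^ (-(1 / 2) : ℝ) := by
            rw [Real.mul_rpow hk'.le hr.le]; ring
        _ ≤ _ := by gcongr
    · have hz : 0 < |k| * r := by positivity
      refine (nI _ _).trans ?_
      have e : (-((((2 : ℕ) : ℝ) - 1) / 2)) = -(1 / 2) := by norm_num
      have e' : (-((((2 : ℕ) : ℝ) - 1))) = -1 := by norm_num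
      rw [e, e', abs_mul, abs_mul, abs_abs]
      have h1 : 0 ≤ r ^ (-(1 / 2) : ℝ) := by positivity
      have h2 : 0 ≤ r ^ (-1 : ℝ) := by positivity
      have h3 : 0 ≤ |k| ^ (-(1 / 2) : ℝ) := by positivity
      have h4 : 0 ≤ |k| ^ (-1 : ℝ) := by positivity
      calc _ ≤ CJ * ((|k| * r) ^ (-1 : ℝ) + (|k| * r) ^ (-(1 / 2) : ℝ)) * |k|
            + CY * ((|k| * r) ^ (-1 : ℝ) + (|k| * r) ^ (-(1 / 2) : ℝ)) * |k| := by
            gcongr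
            exacts [(bJ _ hz).2, (bY _ hz).2]
        _ = (CJ + CY) * (|k| * (|k| ^ (-1 : ℝ) * r ^ (-1 : ℝ)
              + |k| ^ (-(1 / 2) : ℝ) * r ^ (-(1 / 2) : ℝ))) := by
            rw [Real.mul_rpow hk'.le hr.le, Real.mul_rpow hk'.le hr.le]; ring
        _ ≤ (CJ + CY) * ((1 + |k|) * ((|k| ^ (-(1 / 2) : ℝ) + |k| ^ (-1 : ℝ))
              * (r ^ (-1 : ℝ) + r ^ (-(1 / 2) : ℝ)))) := by
            gcongr
            · linarith
            · nlinarith [mul_nonneg h3 h2, mul_nonneg h4 h1]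
        _ = _ := by rw [hc]; ring
  -- The derivative is i|k| G - G/r; with 4π > 1 each term is controlled by a power of r, whence 1 +
  -- |k|.
  · refine ⟨fun r => (I * |k|) * (exp (I * (|k| * r : ℝ)) / (4 * π * r : ℝ))
      - exp (I * (|k| * r : ℝ)) / (4 * π * r ^ 2 : ℝ), 1 + |k|, by positivity, fun r hr => ?_, ?_,
      fun r hr => ?_, fun r hr => ?_⟩
    · have hr' : (r : ℂ) ≠ 0 := by exact_mod_cast hr.ne'
      have hpi : (π : ℂ) ≠ 0 := by exact_mod_cast Real.pi_ne_zero
      have h0 : HasDerivAt (fun r : ℝ => (r : ℂ)) 1 r := by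
        simpa using (hasDerivAt_id r).ofReal_comp
      have h1 := ((h0.const_mul ((|k| : ℝ) : ℂ)).const_mul I).cexp
      have h2 := h1.div (h0.const_mul (4 * π : ℂ)) (by simp [hr', hpi])
      have h3 : HasDerivAt (outgoingGreen 3 k) _ r := h2.congr_of_eventuallyEq (by
        filter_upwards [lt_mem_nhds hr] with y hy
        rw [outgoingGreen_three hk hy]
        simp)
      convert! h3 using 1
      push_cast
      field_simp
    · have hne : ∀ r ∈ Ioi (0 : ℝ), ((4 * π * r : ℝ) : ℂ) ≠ 0 := fun r hr => by
        rw [mem_Ioi] at hr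
        exact_mod_cast (by positivity : 0 < 4 * π * r).ne'
      have hne2 : ∀ r ∈ Ioi (0 : ℝ), ((4 * π * r ^ 2 : ℝ) : ℂ) ≠ 0 := fun r hr => by
        rw [mem_Ioi] at hr
        exact_mod_cast (by positivity : 0 < 4 * π * r ^ 2).ne'
      refine ContinuousOn.sub (continuousOn_const.mul (ContinuousOn.div (by fun_prop)
        (by fun_prop) hne)) (ContinuousOn.div (by fun_prop) (by fun_prop) hne2)
    · have e : (-((((3 : ℕ) : ℝ) - 1) / 2)) = -1 := by norm_num
      rw [outgoingGreen_three hk hr, e, norm_div, mul_comm I, Complex.norm_exp_ofReal_mul_I,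
        Complex.norm_real, Real.norm_of_nonneg (by positivity), Real.rpow_neg_one]
      rw [div_le_iff₀ (by positivity)]
      have : (1 + |k|) * r⁻¹ * (4 * π * r) = (1 + |k|) * (4 * π) := by field_simp
      rw [this]
      nlinarith [Real.pi_gt_three]
    · have e : (-((((3 : ℕ) : ℝ) - 1) / 2)) = -1 := by norm_num
      have e' : (-((((3 : ℕ) : ℝ) - 1))) = -(2 : ℕ) := by norm_num
      rw [e, e', Real.rpow_neg_one, Real.rpow_neg hr.le, Real.rpow_natCast]
      refine (norm_sub_le _ _).trans ?_
      rw [norm_mul, norm_mul, norm_div, norm_div, mul_comm I ((|k| * r : ℝ) : ℂ),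
        Complex.norm_exp_ofReal_mul_I,
        Complex.norm_real, Complex.norm_real, Complex.norm_real, Complex.norm_I, one_mul,
        Real.norm_of_nonneg (by positivity), Real.norm_of_nonneg (by positivity),
        Real.norm_of_nonneg (by positivity)]
      have t1 : 1 / (4 * π * r) ≤ r⁻¹ := by
        rw [← one_div]
        gcongr
        nlinarith [Real.pi_gt_three]
      have t2 : 1 / (4 * π * r ^ 2) ≤ (r ^ 2)⁻¹ := by
        rw [← one_div]
        gcongr
        nlinarith [Real.pi_gt_three, sq_nonneg r]
      have p1 : 0 < r⁻¹ := by positivity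
      have p2 : 0 < (r ^ 2)⁻¹ := by positivity
      nlinarith

end Bessel

/-! ### Compactness of convolutions between weighted L² spaces. -/

section WeightedKernels

open scoped NNReal
open Filter Set

theorem lintegral_lintegral_mul_sub {E : Type*} [NormedAddCommGroup E]
    [MeasurableSpace E] [BorelSpace E] [SecondCountableTopology E] {μ : Measure E}
    [μ.IsAddLeftInvariant] [μ.IsNegInvariant] {A B : E → ℝ≥0∞} (hA : Measurable A)
    (hB : Measurable B) :
    ∫⁻ x, ∫⁻ y, A x * B (x - y) ∂μ ∂μ = (∫⁻ x, A x ∂μ) * ∫⁻ y, B y ∂μ := by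
  have h : ∀ x, ∫⁻ y, A x * B (x - y) ∂μ = A x * ∫⁻ y, B y ∂μ := fun x => by
    rw [lintegral_const_mul _ (by fun_prop), lintegral_sub_left_eq_self (fun y => B y) x]
  simp_rw [h]
  exact lintegral_mul_const _ hA

theorem lintegral_lintegral_mul_sub' {E : Type*} [NormedAddCommGroup E]
    [MeasurableSpace E] [BorelSpace E] [SecondCountableTopology E] {μ : Measure E} [SFinite μ]
    [μ.IsAddRightInvariant] {A B : E → ℝ≥0∞} (hA : Measurable A) (hB : Measurable B) :
    ∫⁻ x, ∫⁻ y, A y * B (x - y) ∂μ ∂μ = (∫⁻ x, A x ∂μ) * ∫⁻ y, B y ∂μ := by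
  rw [lintegral_lintegral_swap (by fun_prop)]
  have h : ∀ y, ∫⁻ x, A y * B (x - y) ∂μ = A y * ∫⁻ y, B y ∂μ := fun y => by
    rw [lintegral_const_mul _ (by fun_prop), lintegral_sub_right_eq_self (fun y => B y) y]
  simp_rw [h]
  exact lintegral_mul_const _ hA

theorem lintegral_lintegral_add_lt_top {X Y : Type*} [MeasurableSpace X] [MeasurableSpace Y]
    {μ : Measure X} {ν : Measure Y} [SFinite ν] {F G : X → Y → ℝ≥0∞}
    (hF : Measurable (Function.uncurry F)) (iF : ∫⁻ x, ∫⁻ y, F x y ∂ν ∂μ < ⊤)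
    (iG : ∫⁻ x, ∫⁻ y, G x y ∂ν ∂μ < ⊤) : ∫⁻ x, ∫⁻ y, (F x y + G x y) ∂ν ∂μ < ⊤ := by
  have h : ∀ x, ∫⁻ y, (F x y + G x y) ∂ν = (∫⁻ y, F x y ∂ν) + ∫⁻ y, G x y ∂ν := fun x =>
    lintegral_add_left (hF.comp measurable_prodMk_left) _
  simp_rw [h]
  rw [lintegral_add_left (Measurable.lintegral_prod_right hF)]
  exact ENNReal.add_lt_top.2 ⟨iF, iG⟩

/-- Weighted AM–GM for three quantities that enter through the products of pairs. -/
theorem rpow_mul_rpow_mul_rpow_le {X Y Z δ m : ℝ} (hX : 0 < X) (hY : 0 < Y) (hZ : 0 < Z)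
    (hm : 0 ≤ m) (hδ : 0 < δ) (hmδ : m ≤ 4 * δ) :
    X ^ (-δ) * Z ^ (-(m / 2)) * Y ^ (-δ) ≤ X ^ (-(δ + m / 4)) * Y ^ (-(δ + m / 4))
      + X ^ (-(δ + m / 4)) * Z ^ (-(δ + m / 4)) + Y ^ (-(δ + m / 4)) * Z ^ (-(δ + m / 4)) := by
  -- Weights 1 - 2e, e, e on the three pairs give X and Y the exponent β(1 - e) and Z the exponent
  -- 2βe. Matching these with δ and m/2 forces β = δ + m/4 and e = m/(4β); then 1 - 2e ≥ 0 is the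
  -- condition m ≤ 4δ.
  set β := δ + m / 4 with hβ
  have hβ0 : 0 < β := by positivity
  set e := m / (4 * β) with he
  have he0 : 0 ≤ e := by positivity
  have he1 : 0 ≤ 1 - 2 * e := by
    rw [he, sub_nonneg, ← mul_div_assoc, div_le_one (by positivity), hβ]
    linarith
  have heβ : β * e = m / 4 := by rw [he]; field_simp
  have h := Real.geom_mean_le_arith_mean3_weighted he1 he0 he0
    (by positivity : 0 ≤ X ^ (-β) * Y ^ (-β)) (by positivity : 0 ≤ X ^ (-β) * Z ^ (-β))
    (by positivity : 0 ≤ Y ^ (-β) * Z ^ (-β)) (by ring)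
  have e1 : (X ^ (-β) * Y ^ (-β)) ^ (1 - 2 * e) * (X ^ (-β) * Z ^ (-β)) ^ e
      * (Y ^ (-β) * Z ^ (-β)) ^ e = X ^ (-δ) * Z ^ (-(m / 2)) * Y ^ (-δ) := by
    rw [Real.mul_rpow (by positivity) (by positivity), Real.mul_rpow (by positivity) (by positivity),
      Real.mul_rpow (by positivity) (by positivity)]
    simp only [← Real.rpow_mul hX.le, ← Real.rpow_mul hY.le, ← Real.rpow_mul hZ.le]
    have eX : X ^ (-δ) = X ^ (-β * (1 - 2 * e)) * X ^ (-β * e) := by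
      rw [← Real.rpow_add hX]; congr 1; linear_combination -heβ - hβ
    have eY : Y ^ (-δ) = Y ^ (-β * (1 - 2 * e)) * Y ^ (-β * e) := by
      rw [← Real.rpow_add hY]; congr 1; linear_combination -heβ - hβ
    have eZ : Z ^ (-(m / 2)) = Z ^ (-β * e) * Z ^ (-β * e) := by
      rw [← Real.rpow_add hZ]; congr 1; linear_combination 2 * heβ
    rw [eX, eY, eZ]
    ring
  rw [e1] at h
  refine h.trans ?_
  have t : ∀ c p : ℝ, c ≤ 1 → 0 ≤ p → c * p ≤ p := fun c p hc hp =>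
    mul_le_of_le_one_left hp hc
  have he2 : e ≤ 1 := by linarith
  exact add_le_add (add_le_add (t _ _ (by linarith) (by positivity))
    (t _ _ he2 (by positivity))) (t _ _ he2 (by positivity))

variable {n : ℕ}

theorem measurable_bracket (s : ℝ) :
    Measurable fun x : EuclideanSpace ℝ (Fin n) => (1 + ‖x‖ ^ 2) ^ s := by
  fun_prop

theorem bracket_rpow_le_one {E : Type*} [NormedAddCommGroup E] (x : E) {s : ℝ} (hs : s ≤ 0) :
    (1 + ‖x‖ ^ 2) ^ s ≤ 1 :=
  Real.rpow_le_one_of_one_le_of_nonpos (by linarith [sq_nonneg ‖x‖]) hs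

theorem lintegral_bracket_lt_top {s : ℝ} (hs : (n : ℝ) < 2 * s) :
    ∫⁻ x : EuclideanSpace ℝ (Fin n), ENNReal.ofReal ((1 + ‖x‖ ^ 2) ^ (-s)) < ⊤ := by
  have h := integrable_rpow_neg_one_add_norm_sq (E := EuclideanSpace ℝ (Fin n)) (μ := volume)
    (r := 2 * s) (by simpa using hs)
  have e : -(2 * s) / 2 = -s := by ring
  rw [e] at h
  exact h.lintegral_lt_top

theorem integrable_indicator_rpow_norm (hn : 0 < n) (ε : ℝ) :
    Integrable fun x : EuclideanSpace ℝ (Fin n) =>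
      (Iic ε).indicator (fun r : ℝ => r ^ (-((n : ℝ) - 1))) ‖x‖ := by
  have : Nonempty (Fin n) := ⟨⟨0, hn⟩⟩
  rw [integrable_fun_norm_addHaar volume (f := (Iic ε).indicator (fun r : ℝ => r ^ (-((n : ℝ) - 1))))]
  have : IntegrableOn ((Iic ε).indicator fun _ => (1 : ℝ)) (Ioi 0) := by
    rw [integrableOn_indicator_iff measurableSet_Iic, Iic_inter_Ioi]
    simp
  refine this.congr_fun (fun r hr => ?_) measurableSet_Ioi
  rw [mem_Ioi] at hr
  by_cases hε : r ≤ ε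
  · simp only [indicator, mem_Iic, hε, if_true, smul_eq_mul, finrank_euclideanSpace, Fintype.card_fin]
    rw [← Real.rpow_natCast, ← Real.rpow_add hr, Nat.cast_sub hn]
    simp
  · simp [indicator, hε]

/-- In polar coordinates the Jacobian cancels the singularity, so the mass is linear in ε. This
makes the part of a gradient kernel near the diagonal small. -/
theorem lintegral_indicator_rpow_norm (hn : 0 < n) {ε : ℝ} (hε : 0 ≤ ε) :
    ∫⁻ x : EuclideanSpace ℝ (Fin n),
      ENNReal.ofReal ((Iic ε).indicator (fun r : ℝ => r ^ (-((n : ℝ) - 1))) ‖x‖)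
      = ENNReal.ofReal (n * (volume.real (Metric.ball (0 : EuclideanSpace ℝ (Fin n)) 1) * ε)) := by
  have : Nonempty (Fin n) := ⟨⟨0, hn⟩⟩
  rw [← ofReal_integral_eq_lintegral_ofReal (integrable_indicator_rpow_norm hn ε)
    (Eventually.of_forall fun x => indicator_apply_nonneg fun _ => by positivity)]
  · rw [integral_fun_norm_addHaar volume ((Iic ε).indicator (fun r : ℝ => r ^ (-((n : ℝ) - 1))))]
    have : ∫ y in Ioi (0 : ℝ), y ^ (Module.finrank ℝ (EuclideanSpace ℝ (Fin n)) - 1) •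
        (Iic ε).indicator (fun r : ℝ => r ^ (-((n : ℝ) - 1))) y
        = ∫ y in Ioi (0 : ℝ), (Iic ε).indicator (fun _ => (1 : ℝ)) y := by
      refine setIntegral_congr_fun measurableSet_Ioi fun r hr => ?_
      rw [mem_Ioi] at hr
      by_cases hε : r ≤ ε
      · simp only [indicator, mem_Iic, hε, if_true, smul_eq_mul, finrank_euclideanSpace,
          Fintype.card_fin]
        rw [← Real.rpow_natCast, ← Real.rpow_add hr, Nat.cast_sub hn]
        simp
      · simp [indicator, hε]
    rw [this, setIntegral_indicator measurableSet_Iic, Ioi_inter_Iic]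
    simp [hε]

/-- The weighted kernel `⟨x⟩^{-2δ} |x-y|^{-(n-1)} ⟨y⟩^{-2δ}` is integrable on `ℝⁿ × ℝⁿ`. -/
theorem lintegral_lintegral_weighted_lt_top (hn : n = 2 ∨ n = 3) {δ : ℝ} (hδ : 1 < δ) :
    ∫⁻ x : EuclideanSpace ℝ (Fin n), ∫⁻ y : EuclideanSpace ℝ (Fin n),
      ENNReal.ofReal ((1 + ‖x‖ ^ 2) ^ (-δ) * ‖x - y‖ ^ (-((n : ℝ) - 1)) * (1 + ‖y‖ ^ 2) ^ (-δ))
      < ⊤ := by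
  have hn0 : 0 < n := by rcases hn with rfl | rfl <;> norm_num
  have hn1 : (2 : ℝ) ≤ n := by rcases hn with rfl | rfl <;> norm_num
  have hn3 : (n : ℝ) ≤ 3 := by rcases hn with rfl | rfl <;> norm_num
  set m : ℝ := (n : ℝ) - 1 with hm
  have hm1 : 1 ≤ m := by rw [hm]; linarith
  have hm2 : m ≤ 2 := by rw [hm]; linarith
  set β := δ + m / 4 with hβ
  have hmδ : m ≤ 4 * δ := by linarith
  let A : EuclideanSpace ℝ (Fin n) → ℝ≥0∞ := fun x => ENNReal.ofReal ((1 + ‖x‖ ^ 2) ^ (-(2 * δ)))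
  let B : EuclideanSpace ℝ (Fin n) → ℝ≥0∞ := fun x => ENNReal.ofReal ((1 + ‖x‖ ^ 2) ^ (-β))
  let S : EuclideanSpace ℝ (Fin n) → ℝ≥0∞ := fun x =>
    ENNReal.ofReal ((Iic 1).indicator (fun r : ℝ => r ^ (-m)) ‖x‖)
  have mA : Measurable A := (measurable_bracket _).ennreal_ofReal
  have mB : Measurable B := (measurable_bracket _).ennreal_ofReal
  have mS : Measurable S := by
    refine Measurable.ennreal_ofReal (Measurable.comp (g := (Iic 1).indicator
      (fun r : ℝ => r ^ (-m))) ?_ measurable_norm)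
    exact Measurable.indicator (by fun_prop) measurableSet_Iic
  have iA : ∫⁻ x, A x < ⊤ := lintegral_bracket_lt_top (by linarith)
  -- Integrability needs 2β = 2δ + (n-1)/2 > n. As 2 + (n-1)/2 ≥ n exactly when n ≤ 3, this is where
  -- δ > 1 and the dimension enter.
  have iB : ∫⁻ x, B x < ⊤ := lintegral_bracket_lt_top (by rw [hβ, hm]; linarith)
  have iS : ∫⁻ x, S x < ⊤ := by
    simp only [S, hm]
    rw [lintegral_indicator_rpow_norm hn0 zero_le_one]
    exact ENNReal.ofReal_lt_top
  let c : ℝ≥0∞ := ENNReal.ofReal (2 ^ (m / 2))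
  -- For |x-y| ≤ 1 the two weights are merged by ab ≤ a² + b², against the integrable singularity.
  -- For |x-y| > 1 the distance is comparable to ⟨x-y⟩, with loss `c`, and three-term AM–GM leaves
  -- products of two integrable factors.
  have key : ∀ x y : EuclideanSpace ℝ (Fin n),
      ENNReal.ofReal ((1 + ‖x‖ ^ 2) ^ (-δ) * ‖x - y‖ ^ (-m) * (1 + ‖y‖ ^ 2) ^ (-δ))
      ≤ (A x * S (x - y) + A y * S (x - y))
        + c * (B x * B y + B x * B (x - y) + B y * B (x - y)) := fun x y => by
    have hX : (0 : ℝ) < 1 + ‖x‖ ^ 2 := by positivity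
    have hY : (0 : ℝ) < 1 + ‖y‖ ^ 2 := by positivity
    have hZ : (0 : ℝ) < 1 + ‖x - y‖ ^ 2 := by positivity
    rcases le_or_gt ‖x - y‖ 1 with h1 | h1
    · refine le_trans ?_ le_self_add
      have hS : S (x - y) = ENNReal.ofReal (‖x - y‖ ^ (-m)) := by
        simp only [S, indicator, mem_Iic, h1, if_true]
      rw [← add_mul, hS, ← ENNReal.ofReal_add (by positivity) (by positivity),
        ← ENNReal.ofReal_mul (by positivity)]
      refine ENNReal.ofReal_le_ofReal ?_
      have e : ∀ t : ℝ, 0 < t → t ^ (-(2 * δ)) = t ^ (-δ) * t ^ (-δ) := fun t ht => by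
        rw [← Real.rpow_add ht]; congr 1; ring
      rw [e _ hX, e _ hY, mul_right_comm]
      gcongr
      nlinarith [sq_nonneg ((1 + ‖x‖ ^ 2) ^ (-δ) - (1 + ‖y‖ ^ 2) ^ (-δ)),
        (by positivity : 0 < (1 + ‖x‖ ^ 2) ^ (-δ)), (by positivity : 0 < (1 + ‖y‖ ^ 2) ^ (-δ))]
    · refine le_trans ?_ le_add_self
      have h := rpow_mul_rpow_mul_rpow_le hX hY hZ (by linarith : 0 ≤ m) (by linarith) hmδ
      simp only [B, c]
      rw [← ENNReal.ofReal_mul (by positivity), ← ENNReal.ofReal_mul (by positivity),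
        ← ENNReal.ofReal_mul (by positivity), ← ENNReal.ofReal_add (by positivity) (by positivity),
        ← ENNReal.ofReal_add (by positivity) (by positivity), ← ENNReal.ofReal_mul (by positivity)]
      refine ENNReal.ofReal_le_ofReal ?_
      refine le_trans ?_ (mul_le_mul_of_nonneg_left h (by positivity))
      have hz : ‖x - y‖ ^ (-m) ≤ 2 ^ (m / 2) * (1 + ‖x - y‖ ^ 2) ^ (-(m / 2)) := by
        have hr : 0 < ‖x - y‖ := by linarith
        have e : ‖x - y‖ ^ (-m) = (‖x - y‖ ^ 2) ^ (-(m / 2)) := by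
          rw [← Real.rpow_natCast, ← Real.rpow_mul hr.le]; congr 1; push_cast; ring
        rw [e, Real.rpow_neg (by positivity), Real.rpow_neg (by positivity), ← div_eq_mul_inv,
          ← Real.div_rpow (by positivity) (by positivity), ← Real.inv_rpow (by positivity)]
        refine Real.rpow_le_rpow (by positivity) ?_ (by positivity)
        rw [inv_eq_one_div, div_le_div_iff₀ (by positivity) (by positivity)]
        nlinarith
      calc _ ≤ (1 + ‖x‖ ^ 2) ^ (-δ) * (2 ^ (m / 2) * (1 + ‖x - y‖ ^ 2) ^ (-(m / 2)))
            * (1 + ‖y‖ ^ 2) ^ (-δ) := by gcongr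
        _ = _ := by ring
  refine lt_of_le_of_lt (lintegral_mono fun x => lintegral_mono fun y => key x y) ?_
  have i1 : ∫⁻ x, ∫⁻ y, A x * S (x - y) < ⊤ := by
    rw [lintegral_lintegral_mul_sub mA mS]; finiteness
  have i2 : ∫⁻ x, ∫⁻ y, A y * S (x - y) < ⊤ := by
    rw [lintegral_lintegral_mul_sub' mA mS]; finiteness
  have i3 : ∫⁻ x, ∫⁻ y, B x * B y < ⊤ := by
    rw [lintegral_lintegral_mul mB.aemeasurable mB.aemeasurable]; finiteness
  have i4 : ∫⁻ x, ∫⁻ y, B x * B (x - y) < ⊤ := by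
    rw [lintegral_lintegral_mul_sub mB mB]; finiteness
  have i5 : ∫⁻ x, ∫⁻ y, B y * B (x - y) < ⊤ := by
    rw [lintegral_lintegral_mul_sub' mB mB]; finiteness
  refine lintegral_lintegral_add_lt_top (by fun_prop)
    (lintegral_lintegral_add_lt_top (by fun_prop) i1 i2) ?_
  have e : ∀ x, ∫⁻ y, c * (B x * B y + B x * B (x - y) + B y * B (x - y))
      = c * ∫⁻ y, (B x * B y + B x * B (x - y) + B y * B (x - y)) := fun x =>
    lintegral_const_mul' _ _ (by simp [c])
  simp_rw [e]
  rw [lintegral_const_mul' _ _ (by simp [c])]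
  exact ENNReal.mul_lt_top (by simp [c]) (lintegral_lintegral_add_lt_top (by fun_prop)
    (lintegral_lintegral_add_lt_top (by fun_prop) i3 i4) i5)

/-- The kernel `K(x - y) ⟨y⟩^{-δ}`. -/
noncomputable def weightedKernel (K : EuclideanSpace ℝ (Fin n) → ℂ) (δ : ℝ)
    (x y : EuclideanSpace ℝ (Fin n)) : ℂ :=
  K (x - y) * (((1 + ‖y‖ ^ 2) ^ (-(δ / 2)) : ℝ) : ℂ)

theorem measurable_weightedKernel {K : EuclideanSpace ℝ (Fin n) → ℂ} (hK : Measurable K) (δ : ℝ) :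
    Measurable (Function.uncurry (weightedKernel K δ)) := by
  refine (hK.comp (measurable_fst.sub measurable_snd)).mul ?_
  exact measurable_ofReal.comp ((measurable_bracket _).comp measurable_snd)

theorem lintegral_weightedVolume (σ : ℝ) {g : EuclideanSpace ℝ (Fin n) → ℝ≥0∞}
    (hg : Measurable g) :
    ∫⁻ x, g x ∂weightedVolume n σ = ∫⁻ x, ENNReal.ofReal ((1 + ‖x‖ ^ 2) ^ σ) * g x := by
  rw [weightedVolume, lintegral_withDensity_eq_lintegral_mul _
    (measurable_bracket σ).ennreal_ofReal hg]
  rfl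

instance sFinite_weightedVolume (σ : ℝ) : SFinite (weightedVolume n σ) := by
  rw [weightedVolume]
  infer_instance

theorem weightedVolume_le {σ : ℝ} (hσ : σ ≤ 0) : weightedVolume n σ ≤ volume := by
  refine Measure.le_iff.2 fun s hs => ?_
  rw [weightedVolume, withDensity_apply _ hs]
  refine (lintegral_mono (g := fun _ => 1) fun x => ?_).trans (by simp)
  exact ENNReal.ofReal_le_one.2 (bracket_rpow_le_one x hσ)

/-- The decay rate (n-1)/2 of an outgoing wave doubles to n-1 on squaring, and the weight in x is
supplied by the measure; this reduces to `lintegral_lintegral_weighted_lt_top`. -/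
theorem lintegral_sq_weightedKernel_lt_top (hn : n = 2 ∨ n = 3) {δ : ℝ} (hδ : 1 < δ)
    {K : EuclideanSpace ℝ (Fin n) → ℂ} (hK : Measurable K) {C : ℝ}
    (hKC : ∀ z, ‖K z‖ ≤ C * ‖z‖ ^ (-(((n : ℝ) - 1) / 2))) :
    ∫⁻ x, ∫⁻ y, ‖weightedKernel K δ x y‖ₑ ^ 2 ∂volume ∂weightedVolume n (-δ) < ⊤ := by
  have hm := measurable_weightedKernel hK δ
  rw [lintegral_weightedVolume _ (Measurable.lintegral_prod_right (hm.enorm.pow_const 2))]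
  refine lt_of_le_of_lt ?_ (ENNReal.mul_lt_top (ENNReal.ofReal_lt_top (r := C ^ 2))
    (lintegral_lintegral_weighted_lt_top hn hδ))
  rw [← lintegral_const_mul' _ _ ENNReal.ofReal_ne_top]
  refine lintegral_mono fun x => ?_
  rw [← lintegral_const_mul' _ _ ENNReal.ofReal_ne_top,
    ← lintegral_const_mul' _ _ ENNReal.ofReal_ne_top]
  refine lintegral_mono fun y => ?_
  rw [← ofReal_norm, ← ENNReal.ofReal_pow (norm_nonneg _), ← ENNReal.ofReal_mul (by positivity),
    ← ENNReal.ofReal_mul (by positivity)]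
  refine ENNReal.ofReal_le_ofReal ?_
  rw [weightedKernel, norm_mul, Complex.norm_real, Real.norm_of_nonneg (by positivity), mul_pow]
  have h1 : ‖K (x - y)‖ ^ 2 ≤ C ^ 2 * ‖x - y‖ ^ (-((n : ℝ) - 1)) := by
    refine (pow_le_pow_left₀ (norm_nonneg _) (hKC _) 2).trans (le_of_eq ?_)
    rw [mul_pow, ← Real.rpow_natCast (‖x - y‖ ^ _), ← Real.rpow_mul (norm_nonneg _)]
    congr 2
    push_cast
    ring
  have h2 : ((1 + ‖y‖ ^ 2) ^ (-(δ / 2))) ^ 2 = (1 + ‖y‖ ^ 2) ^ (-δ) := by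
    rw [← Real.rpow_natCast ((1 + ‖y‖ ^ 2) ^ _), ← Real.rpow_mul (by positivity)]
    congr 1
    push_cast
    ring
  rw [h2]
  calc _ ≤ (1 + ‖x‖ ^ 2) ^ (-δ) * (C ^ 2 * ‖x - y‖ ^ (-((n : ℝ) - 1)) * (1 + ‖y‖ ^ 2) ^ (-δ)) := by
        gcongr
    _ = _ := by ring

/-- Both weights are at most one and may be dropped; Schur's test then sees only the L¹ norm of the
truncated singularity, which is linear in ε. -/
theorem isL2Kernel_weightedKernel_near (hn : 0 < n) {δ : ℝ} (hδ : 0 ≤ δ)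
    {K : EuclideanSpace ℝ (Fin n) → ℂ} (hK : Measurable K) {C ε : ℝ} (hε : 0 ≤ ε) (hC : 0 ≤ C)
    (hKC : ∀ z, ‖K z‖ ≤ C * (Iic ε).indicator (fun r : ℝ => r ^ (-((n : ℝ) - 1))) ‖z‖) :
    IsL2Kernel (weightedVolume n (-δ)) volume (weightedKernel K δ)
      (C * (n * (volume.real (Metric.ball (0 : EuclideanSpace ℝ (Fin n)) 1) * ε))).toNNReal := by
  have hle : ∀ x y, ‖weightedKernel K δ x y‖ₑ ≤ ENNReal.ofReal C * ENNReal.ofReal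
      ((Iic ε).indicator (fun r : ℝ => r ^ (-((n : ℝ) - 1))) ‖x - y‖) := fun x y => by
    rw [← ENNReal.ofReal_mul hC, ← ofReal_norm]
    refine ENNReal.ofReal_le_ofReal ?_
    rw [weightedKernel, norm_mul, Complex.norm_real, Real.norm_of_nonneg (by positivity)]
    refine (mul_le_of_le_one_right (norm_nonneg _) ?_).trans (hKC _)
    exact bracket_rpow_le_one y (by linarith)
  have mS : Measurable fun x : EuclideanSpace ℝ (Fin n) => ENNReal.ofReal
      ((Iic ε).indicator (fun r : ℝ => r ^ (-((n : ℝ) - 1))) ‖x‖) := by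
    refine Measurable.ennreal_ofReal (Measurable.comp (g := (Iic ε).indicator
      (fun r : ℝ => r ^ (-((n : ℝ) - 1)))) ?_ measurable_norm)
    exact Measurable.indicator (by fun_prop) measurableSet_Iic
  have e : ENNReal.ofReal C * ∫⁻ x : EuclideanSpace ℝ (Fin n), ENNReal.ofReal
      ((Iic ε).indicator (fun r : ℝ => r ^ (-((n : ℝ) - 1))) ‖x‖) = ((C * (n * (volume.real
      (Metric.ball (0 : EuclideanSpace ℝ (Fin n)) 1) * ε))).toNNReal : ℝ≥0∞) := by
    rw [lintegral_indicator_rpow_norm hn hε, ← ENNReal.ofReal_mul hC]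
    rfl
  refine IsL2Kernel.of_schur (measurable_weightedKernel hK δ) (fun x => ?_) fun y => ?_
  · refine (lintegral_mono fun y => hle x y).trans ?_
    rw [lintegral_const_mul' _ _ (by simp), lintegral_sub_left_eq_self (fun z =>
      ENNReal.ofReal ((Iic ε).indicator (fun r : ℝ => r ^ (-((n : ℝ) - 1))) ‖z‖)) x, e]
  · refine (lintegral_mono' (weightedVolume_le (by linarith)) fun x => hle x y).trans ?_
    rw [lintegral_const_mul' _ _ (by simp), lintegral_sub_right_eq_self (fun z =>
      ENNReal.ofReal ((Iic ε).indicator (fun r : ℝ => r ^ (-((n : ℝ) - 1))) ‖z‖)) y, e]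

/-- Convolution with a kernel that has the singularity and the decay of the gradient of the
fundamental solution is compact from `L²_δ` to `L²_{-δ}` if `δ > 1`. -/
theorem exists_isCompactOperator_weightedKernel (hn : n = 2 ∨ n = 3) {δ : ℝ} (hδ : 1 < δ)
    {K : EuclideanSpace ℝ (Fin n) → ℂ} (hK : Measurable K) {C : ℝ} (hC : 0 ≤ C)
    (hKC : ∀ z, ‖K z‖ ≤ C * (‖z‖ ^ (-((n : ℝ) - 1)) + ‖z‖ ^ (-(((n : ℝ) - 1) / 2)))) :
    ∃ (D : ℝ≥0) (h : IsL2Kernel (weightedVolume n (-δ)) volume (weightedKernel K δ) D),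
      IsCompactOperator h.toCLM := by
  have hn0 : 0 < n := by rcases hn with rfl | rfl <;> norm_num
  have hn1 : (2 : ℝ) ≤ n := by rcases hn with rfl | rfl <;> norm_num
  -- |z|^{-2(n-1)} is not integrable at the origin, so the Hilbert–Schmidt bound is available only
  -- for the part `K1` outside a ball; the part `K0` inside is treated as a small error.
  let K0 : ℝ → EuclideanSpace ℝ (Fin n) → ℂ := fun ε => (Metric.closedBall 0 ε).indicator K
  let K1 : ℝ → EuclideanSpace ℝ (Fin n) → ℂ := fun ε => (Metric.closedBall 0 ε)ᶜ.indicator K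
  have mK0 : ∀ ε, Measurable (K0 ε) := fun ε => hK.indicator measurableSet_closedBall
  have mK1 : ∀ ε, Measurable (K1 ε) := fun ε => hK.indicator measurableSet_closedBall.compl
  have hsum : ∀ ε, weightedKernel K δ
      = fun x y => weightedKernel (K0 ε) δ x y + weightedKernel (K1 ε) δ x y := fun ε => by
    funext x y
    simp only [weightedKernel, ← add_mul, K0, K1]
    rw [indicator_self_add_compl_apply]
  -- The factor 2 appears because for |z| ≤ 1 the slower power is dominated by the singular one.
  have b0 : ∀ ε, 0 ≤ ε → ε ≤ 1 → IsL2Kernel (weightedVolume n (-δ)) volume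
      (weightedKernel (K0 ε) δ) (2 * C * (n * (volume.real
        (Metric.ball (0 : EuclideanSpace ℝ (Fin n)) 1) * ε))).toNNReal := fun ε h0 h1 => by
    refine isL2Kernel_weightedKernel_near hn0 (by linarith) (mK0 ε) h0 (by positivity) fun z => ?_
    by_cases hz : ‖z‖ ≤ ε
    · have hz' : z ∈ Metric.closedBall (0 : EuclideanSpace ℝ (Fin n)) ε := by simpa using hz
      simp only [K0, indicator_of_mem hz', indicator_of_mem (mem_Iic.2 hz)]
      refine (hKC z).trans ?_
      rw [mul_comm 2 C, mul_assoc]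
      gcongr
      rcases eq_or_ne z 0 with rfl | hz0
      · rw [norm_zero, Real.zero_rpow (by linarith), Real.zero_rpow (by linarith)]
        simp
      · have hp : 0 < ‖z‖ := norm_pos_iff.2 hz0
        rw [two_mul]
        exact add_le_add le_rfl
          (Real.rpow_le_rpow_of_exponent_ge hp (hz.trans h1) (by linarith))
    · have hz' : z ∉ Metric.closedBall (0 : EuclideanSpace ℝ (Fin n)) ε := by simpa using hz
      have hz2 : ‖z‖ ∉ Iic ε := hz
      simp only [K0, indicator_of_notMem hz', indicator_of_notMem hz2]
      simp
  have b1 : ∀ ε, 0 < ε → ∃ (D : ℝ≥0) (h : IsL2Kernel (weightedVolume n (-δ)) volume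
      (weightedKernel (K1 ε) δ) D), IsCompactOperator h.toCLM := fun ε h0 => by
    have hfin := lintegral_sq_weightedKernel_lt_top hn hδ (mK1 ε)
      (C := C * (ε ^ (-(((n : ℝ) - 1) / 2)) + 1)) fun z => by
        by_cases hz : ‖z‖ ≤ ε
        · have hz' : z ∉ (Metric.closedBall (0 : EuclideanSpace ℝ (Fin n)) ε)ᶜ := by simpa using hz
          simp only [K1, indicator_of_notMem hz', norm_zero]
          positivity
        · have hz' : z ∈ (Metric.closedBall (0 : EuclideanSpace ℝ (Fin n)) ε)ᶜ := by simpa using hz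
          simp only [K1, indicator_of_mem hz']
          refine (hKC z).trans ?_
          rw [mul_assoc]
          gcongr
          rw [add_mul, one_mul]
          refine add_le_add ?_ le_rfl
          have hz0 : 0 < ‖z‖ := by linarith
          have e : ‖z‖ ^ (-((n : ℝ) - 1))
              = ‖z‖ ^ (-(((n : ℝ) - 1) / 2)) * ‖z‖ ^ (-(((n : ℝ) - 1) / 2)) := by
            rw [← Real.rpow_add hz0]; congr 1; ring
          rw [e]
          exact mul_le_mul_of_nonneg_right
            (Real.rpow_le_rpow_of_nonpos h0 (not_le.1 hz).le (by linarith)) (by positivity)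
    -- The bound a + 1 spares a square root, since a ≤ (a + 1)².
    have hk : IsL2Kernel (weightedVolume n (-δ)) volume (weightedKernel (K1 ε) δ)
        ((∫⁻ x, ∫⁻ y, ‖weightedKernel (K1 ε) δ x y‖ₑ ^ 2 ∂volume ∂weightedVolume n (-δ)).toNNReal + 1) := by
      refine IsL2Kernel.of_lintegral_sq (measurable_weightedKernel (mK1 ε) δ) ?_
      rw [ENNReal.coe_add, ENNReal.coe_toNNReal hfin.ne, ENNReal.coe_one]
      generalize (∫⁻ x, ∫⁻ y, ‖weightedKernel (K1 ε) δ x y‖ₑ ^ 2 ∂volume ∂weightedVolume n (-δ)) = a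
      calc a ≤ a + 1 := le_self_add
        _ ≤ (a + 1) ^ 2 := le_self_pow (by simp) (by simp)
    exact ⟨_, hk, hk.isCompactOperator hfin⟩
  choose! D1 hD1 cD1 using b1
  obtain ⟨D, hT⟩ : ∃ D, IsL2Kernel (weightedVolume n (-δ)) volume (weightedKernel K δ) D := by
    rw [hsum 1]
    exact ⟨_, (b0 1 zero_le_one le_rfl).add (hD1 1 one_pos)⟩
  refine ⟨_, hT, ?_⟩
  have hε : ∀ m : ℕ, (0 : ℝ) < 1 / ((m : ℝ) + 1) := fun m => by positivity
  have hε1 : ∀ m : ℕ, 1 / ((m : ℝ) + 1) ≤ 1 := fun m => by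
    rw [div_le_one (by positivity)]; linarith [(Nat.cast_nonneg m : (0 : ℝ) ≤ m)]
  refine isCompactOperator_of_tendsto (l := atTop)
    (F := fun m : ℕ => (hD1 _ (hε m)).toCLM) (f := hT.toCLM) ?_
    (Eventually.of_forall fun m => cD1 _ (hε m))
  rw [tendsto_iff_norm_sub_tendsto_zero]
  refine squeeze_zero (fun _ => norm_nonneg _) (g := fun m : ℕ => 2 * C * (n * (volume.real
        (Metric.ball (0 : EuclideanSpace ℝ (Fin n)) 1) * (1 / ((m : ℝ) + 1))))) (fun m => ?_) ?_
  -- The same operator with its kernel written as a sum: its difference from the outer part is the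
  -- inner part, whose norm is O(1/(m+1)).
  · have hs := hT
    rw [hsum (1 / ((m : ℝ) + 1))] at hs
    have e := IsL2Kernel.toCLM_add (b0 _ (hε m).le (hε1 m)) (hD1 _ (hε m)) hs
    have e' : hT.toCLM = hs.toCLM := by congr 1; exact hsum _
    rw [e', e, sub_add_cancel_right, norm_neg]
    refine (IsL2Kernel.norm_toCLM_le _).trans (le_of_eq (Real.coe_toNNReal _ ?_))
    have := (hε m).le
    positivity
  · have := tendsto_one_div_add_atTop_nhds_zero_nat (𝕜 := ℝ)
    have h2 := ((this.const_mul (volume.real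
        (Metric.ball (0 : EuclideanSpace ℝ (Fin n)) 1))).const_mul (n : ℝ)).const_mul (2 * C)
    simpa using h2

end WeightedKernels

/-! ### Mollification in L². -/

section Mollification

open scoped NNReal Topology
open Filter Set

/-- If `f i → g` almost everywhere and `‖f i‖₂ ≤ ‖g‖₂ < ∞`, then `f i → g` in `L²`. -/
theorem tendsto_eLpNorm_two_sub_of_ae {X F : Type*} [MeasurableSpace X] {μ : Measure X}
    [NormedAddCommGroup F] {f : ℕ → X → F} {g : X → F}
    (hf : ∀ i, AEStronglyMeasurable (f i) μ) (hg : MemLp g 2 μ)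
    (hle : ∀ i, eLpNorm (f i) 2 μ ≤ eLpNorm g 2 μ)
    (hlim : ∀ᵐ x ∂μ, Tendsto (fun i => f i x) atTop (𝓝 (g x))) :
    Tendsto (fun i => eLpNorm (f i - g) 2 μ) atTop (𝓝 0) := by
  set N : ℝ≥0∞ := ∫⁻ x, ‖g x‖ₑ ^ 2 ∂μ with hN
  have hNt : N ≠ ⊤ := by
    rw [hN, ← eLpNorm_two_sq]; exact ENNReal.pow_ne_top hg.2.ne
  have hle' : ∀ i, ∫⁻ x, ‖f i x‖ₑ ^ 2 ∂μ ≤ N := fun i => by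
    rw [hN, ← eLpNorm_two_sq, ← eLpNorm_two_sq]; exact pow_le_pow_left' (hle i) 2
  let d : ℕ → ℝ≥0∞ := fun i => ∫⁻ x, ‖f i x - g x‖ₑ ^ 2 ∂μ
  have mf : ∀ i, AEMeasurable (fun x => ‖f i x‖ₑ ^ 2) μ := fun i => (hf i).enorm.pow_const 2
  have mg : AEMeasurable (fun x => ‖g x‖ₑ ^ 2) μ := hg.1.enorm.pow_const 2
  have md : ∀ i, AEMeasurable (fun x => ‖f i x - g x‖ₑ ^ 2) μ := fun i =>
    ((hf i).sub hg.1).enorm.pow_const 2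
  -- Nonnegative by the parallelogram bound and pointwise convergent to 4|g|². Fatou gives liminf ∫Φ
  -- ≥ 4N, whereas the norm hypothesis gives ∫Φ + d ≤ 4N; hence d → 0.
  let Φ : ℕ → X → ℝ≥0∞ := fun i x => 2 * ‖g x‖ₑ ^ 2 + 2 * ‖f i x‖ₑ ^ 2 - ‖f i x - g x‖ₑ ^ 2
  have mΦ : ∀ i, AEMeasurable (Φ i) μ := fun i =>
    ((mg.const_mul 2).add ((mf i).const_mul 2)).sub (md i)
  have hpt : ∀ i x, ‖f i x - g x‖ₑ ^ 2 ≤ 2 * ‖g x‖ₑ ^ 2 + 2 * ‖f i x‖ₑ ^ 2 := fun i x => by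
    have h : ‖f i x - g x‖ ^ 2 ≤ 2 * ‖g x‖ ^ 2 + 2 * ‖f i x‖ ^ 2 := by
      have := pow_le_pow_left₀ (norm_nonneg _) (norm_sub_le (f i x) (g x)) 2
      nlinarith [sq_nonneg (‖f i x‖ - ‖g x‖)]
    simp only [← ofReal_norm, ← ENNReal.ofReal_pow (norm_nonneg _)]
    rw [← ENNReal.ofReal_ofNat 2, ← ENNReal.ofReal_mul (by norm_num),
      ← ENNReal.ofReal_mul (by norm_num), ← ENNReal.ofReal_add (by positivity) (by positivity)]
    exact ENNReal.ofReal_le_ofReal h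
  have hsum : ∀ i, (∫⁻ x, Φ i x ∂μ) + d i ≤ 4 * N := fun i => by
    rw [← lintegral_add_left' (mΦ i)]
    have : ∀ x, Φ i x + ‖f i x - g x‖ₑ ^ 2 = 2 * ‖g x‖ₑ ^ 2 + 2 * ‖f i x‖ₑ ^ 2 := fun x =>
      tsub_add_cancel_of_le (hpt i x)
    simp_rw [this]
    rw [lintegral_add_left' (mg.const_mul 2), lintegral_const_mul' _ _ (by simp),
      lintegral_const_mul' _ _ (by simp)]
    calc 2 * N + 2 * ∫⁻ x, ‖f i x‖ₑ ^ 2 ∂μ ≤ 2 * N + 2 * N := by gcongr; exact hle' i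
      _ = 4 * N := by ring
  have hliminf : 4 * N ≤ liminf (fun i => ∫⁻ x, Φ i x ∂μ) atTop := by
    refine le_trans (le_of_eq ?_) (lintegral_liminf_le' mΦ)
    rw [hN, ← lintegral_const_mul' _ _ (by simp)]
    refine lintegral_congr_ae ?_
    filter_upwards [hlim] with x hx
    have h1 : Tendsto (fun i => ‖f i x‖ₑ ^ 2) atTop (𝓝 (‖g x‖ₑ ^ 2)) :=
      (ENNReal.continuous_pow 2).continuousAt.tendsto.comp hx.enorm
    have h2 : Tendsto (fun i => ‖f i x - g x‖ₑ ^ 2) atTop (𝓝 0) := by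
      have := (ENNReal.continuous_pow 2).continuousAt.tendsto.comp (hx.sub_const (g x)).enorm
      simpa [Function.comp_def] using this
    have h3 : Tendsto (fun i => Φ i x) atTop
        (𝓝 (2 * ‖g x‖ₑ ^ 2 + 2 * ‖g x‖ₑ ^ 2 - 0)) := by
      refine ENNReal.Tendsto.sub (tendsto_const_nhds.add
        (ENNReal.Tendsto.const_mul h1 (Or.inr (by simp)))) h2 (Or.inr (by simp))
    rw [h3.liminf_eq, tsub_zero]
    ring
  have hd : Tendsto d atTop (𝓝 0) := by
    rw [ENNReal.tendsto_nhds_zero]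
    intro ε hε
    have h4 : 4 * N ≠ ⊤ := ENNReal.mul_ne_top (by simp) hNt
    by_cases h0 : 4 * N = 0
    · refine Eventually.of_forall fun i => ?_
      have := hsum i
      rw [h0] at this
      exact (le_add_self.trans this).trans zero_le
    · have hlt : 4 * N - ε < liminf (fun i => ∫⁻ x, Φ i x ∂μ) atTop :=
        lt_of_lt_of_le (ENNReal.sub_lt_self h4 h0 hε.ne') hliminf
      filter_upwards [eventually_lt_of_lt_liminf hlt] with i hi
      have hs := hsum i
      have hΦt : (∫⁻ x, Φ i x ∂μ) ≠ ⊤ := ne_top_of_le_ne_top h4 (le_self_add.trans hs)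
      have : 4 * N ≤ (∫⁻ x, Φ i x ∂μ) + ε := tsub_le_iff_right.1 hi.le
      exact (ENNReal.add_le_add_iff_left hΦt).1 (hs.trans this)
  have hd2 : Tendsto (fun i => d i ^ (1 / 2 : ℝ)) atTop (𝓝 0) := by
    have := (ENNReal.continuous_rpow_const (y := (1 / 2 : ℝ))).continuousAt.tendsto.comp hd
    simpa [Function.comp_def] using this
  refine hd2.congr fun i => ?_
  simp only [d]
  have := eLpNorm_two_sq (μ := μ) (f i - g)
  simp only [Pi.sub_apply] at this
  rw [← this, ← ENNReal.rpow_natCast, ← ENNReal.rpow_mul]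
  norm_num

variable {n : ℕ}

/-- A sequence of bump functions that shrinks to the origin. -/
noncomputable def shrinkingBump (n i : ℕ) : ContDiffBump (0 : EuclideanSpace ℝ (Fin n)) :=
  ⟨1 / ((i : ℝ) + 1), 2 / ((i : ℝ) + 1), by positivity, by gcongr; norm_num⟩

/-- Mollification of `u` at scale `2 / (i + 1)`. -/
noncomputable def mollify (i : ℕ) (u : EuclideanSpace ℝ (Fin n) → ℂ) :
    EuclideanSpace ℝ (Fin n) → ℂ :=
  convolution ((shrinkingBump n i).normed volume) u (ContinuousLinearMap.lsmul ℝ ℝ) volume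

theorem mollify_apply (i : ℕ) (u : EuclideanSpace ℝ (Fin n) → ℂ) (x : EuclideanSpace ℝ (Fin n)) :
    mollify i u x = ∫ y, (shrinkingBump n i).normed volume (x - y) • u y := by
  rw [mollify, convolution_eq_swap]
  rfl

theorem contDiff_mollify (i : ℕ) {u : EuclideanSpace ℝ (Fin n) → ℂ} (hu : LocallyIntegrable u) :
    ContDiff ℝ ∞ (mollify i u) :=
  ((shrinkingBump n i).hasCompactSupport_normed (μ := volume)).contDiff_convolution_left _
    ((shrinkingBump n i).contDiff_normed) hu

theorem ae_tendsto_mollify {u : EuclideanSpace ℝ (Fin n) → ℂ} (hu : LocallyIntegrable u) :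
    ∀ᵐ x, Tendsto (fun i => mollify i u x) atTop (𝓝 (u x)) := by
  refine ContDiffBump.ae_convolution_tendsto_right_of_locallyIntegrable (K := 2)
    (φ := fun i => shrinkingBump n i) ?_ (Eventually.of_forall fun i => ?_) hu
  · have := (tendsto_one_div_add_atTop_nhds_zero_nat (𝕜 := ℝ)).const_mul 2
    simp only [mul_zero] at this
    refine this.congr fun i => ?_
    simp [shrinkingBump, div_eq_mul_inv]
  · simp [shrinkingBump, div_eq_mul_inv]

/-- The mollifier is nonnegative with integral one, so both Schur constants equal one. -/
theorem eLpNorm_mollify_le (i : ℕ) {u : EuclideanSpace ℝ (Fin n) → ℂ} (hu : MemLp u 2) :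
    eLpNorm (mollify i u) 2 ≤ eLpNorm u 2 := by
  have hm : Measurable ((shrinkingBump n i).normed volume) :=
    (shrinkingBump n i).continuous_normed.measurable
  have hint : ∫⁻ z, ‖(((shrinkingBump n i).normed volume z : ℝ) : ℂ)‖ₑ = 1 := by
    have h1 := (shrinkingBump n i).integral_normed (μ := volume)
    have h2 := (shrinkingBump n i).integrable_normed (μ := volume)
    have h3 := ofReal_integral_eq_lintegral_ofReal h2
      (Eventually.of_forall (shrinkingBump n i).nonneg_normed)
    rw [h1, ENNReal.ofReal_one] at h3
    rw [h3]
    refine lintegral_congr fun z => ?_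
    rw [← ofReal_norm, Complex.norm_real, Real.norm_of_nonneg
      ((shrinkingBump n i).nonneg_normed z)]
  have hk : IsL2Kernel (volume : Measure (EuclideanSpace ℝ (Fin n))) volume
      (fun x y => (((shrinkingBump n i).normed volume (x - y) : ℝ) : ℂ)) 1 := by
    refine IsL2Kernel.of_schur (by fun_prop) (fun x => ?_) fun y => ?_
    · rw [lintegral_sub_left_eq_self (fun z =>
        ‖(((shrinkingBump n i).normed volume z : ℝ) : ℂ)‖ₑ) x, hint]
      simp
    · rw [lintegral_sub_right_eq_self (fun z =>
        ‖(((shrinkingBump n i).normed volume z : ℝ) : ℂ)‖ₑ) y, hint]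
      simp
  have h := hk.eLpNorm_integral_le (hu.toLp u)
  rw [ENNReal.coe_one, one_mul, eLpNorm_congr_ae hu.coeFn_toLp] at h
  refine le_trans (le_of_eq (congrArg (fun f => eLpNorm f 2 volume) (funext fun x => ?_))) h
  rw [mollify_apply]
  refine integral_congr_ae ?_
  filter_upwards [hu.coeFn_toLp] with y hy
  rw [hy, Complex.real_smul]

/-- Contractivity and almost everywhere convergence already force norm convergence; no density
argument is needed. -/
theorem tendsto_eLpNorm_mollify_sub {u : EuclideanSpace ℝ (Fin n) → ℂ} (hu : MemLp u 2) :
    Tendsto (fun i => eLpNorm (mollify i u - u) 2) atTop (𝓝 0) := by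
  have hl : LocallyIntegrable u := hu.locallyIntegrable (by norm_num)
  exact tendsto_eLpNorm_two_sub_of_ae
    (fun i => (contDiff_mollify i hl).continuous.aestronglyMeasurable) hu
    (fun i => eLpNorm_mollify_le i hu) (ae_tendsto_mollify hl)

/-- The derivative falls on the mollifier ρ, and y ↦ ρ(x - y) is a test function: the sign from the
reflection cancels the one from the weak derivative. -/
theorem fderiv_mollify {j : Fin n} {u v : EuclideanSpace ℝ (Fin n) → ℂ}
    (h : HasWeakPartial j u v) (i : ℕ) (x : EuclideanSpace ℝ (Fin n)) :
    fderiv ℝ (mollify i u) x (EuclideanSpace.single j 1) = mollify i v x := by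
  set ρ := (shrinkingBump n i).normed volume with hρ
  have hρc : HasCompactSupport ρ := (shrinkingBump n i).hasCompactSupport_normed
  have hρs : ContDiff ℝ ∞ ρ := (shrinkingBump n i).contDiff_normed
  have hd := hρc.hasFDerivAt_convolution_left (ContinuousLinearMap.lsmul ℝ ℝ : ℝ →L[ℝ] ℂ →L[ℝ] ℂ)
    (hρs.of_le (by simp)) h.1 x
  have hex : ConvolutionExistsAt (fderiv ℝ ρ) u x
      ((ContinuousLinearMap.lsmul ℝ ℝ : ℝ →L[ℝ] ℂ →L[ℝ] ℂ).precompL (EuclideanSpace ℝ (Fin n)))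
      volume := (hρc.fderiv ℝ).convolutionExists_left _ (hρs.continuous_fderiv (by simp)) h.1 x
  rw [show mollify i u = convolution ρ u (ContinuousLinearMap.lsmul ℝ ℝ) volume from rfl,
    hd.fderiv, convolution_eq_swap, ContinuousLinearMap.integral_apply
      (by simpa using hex.integrable_swap), mollify_apply]
  let φ : EuclideanSpace ℝ (Fin n) → ℝ := fun y => ρ (x - y)
  have hφs : ContDiff ℝ ∞ φ := hρs.comp (contDiff_const.sub contDiff_id)
  have hφc : HasCompactSupport φ := hρc.comp_homeomorph (Homeomorph.subLeft x)
  have key := h.2.2 φ hφs hφc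
  have hφd : ∀ y, fderiv ℝ φ y (EuclideanSpace.single j 1)
      = -fderiv ℝ ρ (x - y) (EuclideanSpace.single j 1) := fun y => by
    have h1 : HasFDerivAt ρ (fderiv ℝ ρ (x - y)) (x - y) :=
      (hρs.differentiable (by simp) _).hasFDerivAt
    have h2 := h1.comp y ((hasFDerivAt_id y).const_sub x)
    rw [show fderiv ℝ φ y = _ from h2.fderiv]
    simp
  simp only [hφd, neg_smul, integral_neg, neg_inj] at key
  exact key

theorem support_mollify_subset (i : ℕ) {u : EuclideanSpace ℝ (Fin n) → ℂ} {R : ℝ}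
    (hu : Function.support u ⊆ Metric.closedBall 0 R) :
    Function.support (mollify i u) ⊆ Metric.closedBall 0 (R + 2) := by
  refine (support_convolution_subset _).trans ?_
  rintro _ ⟨a, ha, b, hb, rfl⟩
  rw [(shrinkingBump n i).support_normed_eq] at ha
  have ha' : ‖a‖ ≤ 2 := by
    have h1 : ‖a‖ < 2 / ((i : ℝ) + 1) := by simpa [shrinkingBump] using ha
    refine h1.le.trans (div_le_self (by norm_num) ?_)
    linarith [(Nat.cast_nonneg i : (0 : ℝ) ≤ i)]
  have hb' : ‖b‖ ≤ R := by simpa using hu hb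
  simp only [mem_closedBall_zero_iff]
  linarith [norm_add_le a b]

end Mollification

/-! ### Leibniz rules for weak derivatives. -/

section WeakProducts

open scoped NNReal Topology
open Filter Set

variable {n : ℕ}

theorem MemLocalLp.mono_exponent {F : Type} [NormedAddCommGroup F]
    {f : EuclideanSpace ℝ (Fin n) → F} {p q : ℝ≥0∞} (h : MemLocalLp f q) (hpq : p ≤ q) :
    MemLocalLp f p := fun K hK => by
  have : IsFiniteMeasure (volume.restrict K) := ⟨by simpa using hK.measure_lt_top⟩
  exact (h K hK).mono_exponent hpq

theorem MemLocalLp.aestronglyMeasurable {F : Type} [NormedAddCommGroup F]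
    {f : EuclideanSpace ℝ (Fin n) → F} {p : ℝ≥0∞} (h : MemLocalLp f p) :
    AEStronglyMeasurable f := by
  have e : (⋃ m : ℕ, Metric.closedBall (0 : EuclideanSpace ℝ (Fin n)) m) = univ :=
    Metric.iUnion_closedBall_nat 0
  rw [← Measure.restrict_univ (μ := volume), ← e, aestronglyMeasurable_iUnion_iff]
  exact fun m => (h _ (isCompact_closedBall _ _)).1

theorem MemLocalLp.locallyIntegrable {F : Type} [NormedAddCommGroup F]
    {f : EuclideanSpace ℝ (Fin n) → F} {p : ℝ≥0∞} (h : MemLocalLp f p) (hp : 1 ≤ p) :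
    LocallyIntegrable f := by
  rw [locallyIntegrable_iff]
  exact fun K hK => memLp_one_iff_integrable.1 (h.mono_exponent hp K hK)

/-- Bounded functions of compact support times `L^p_loc` functions are in `L^p`. -/
theorem MemLocalLp.memLp_mul {𝕜 : Type} [RCLike 𝕜] {f χ : EuclideanSpace ℝ (Fin n) → 𝕜}
    {p : ℝ≥0∞} (h : MemLocalLp f p) {M : ℝ} (hχm : AEStronglyMeasurable χ)
    (hχb : ∀ᵐ x, ‖χ x‖ ≤ M) (hχ : HasCompactSupport χ) : MemLp (fun x => χ x * f x) p := by
  have hb : MemLp (fun x => χ x * f x) p (volume.restrict (tsupport χ)) := by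
    refine MemLp.of_le_mul (c := M) (h _ hχ) (hχm.restrict.mul (h _ hχ).1) ?_
    filter_upwards [ae_restrict_of_ae hχb] with x hx
    rw [norm_mul]
    gcongr
  rw [← memLp_indicator_iff_restrict (isClosed_tsupport χ).measurableSet] at hb
  refine hb.ae_eq (Eventually.of_forall fun x => ?_)
  by_cases hx : x ∈ tsupport χ
  · simp [hx]
  · simp [hx, image_eq_zero_of_notMem_tsupport hx]

theorem tendsto_integral_mul_of_tendsto_eLpNorm {X : Type*} [MeasurableSpace X] {μ : Measure X}
    {a b : X → ℂ} {c : ℕ → X → ℂ} (ha : MemLp a 2 μ) (hb : MemLp b 2 μ)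
    (hc : ∀ i, MemLp (c i) 2 μ) (h : Tendsto (fun i => eLpNorm (c i - b) 2 μ) atTop (𝓝 0)) :
    Tendsto (fun i => ∫ x, a x * c i x ∂μ) atTop (𝓝 (∫ x, a x * b x ∂μ)) := by
  refine tendsto_integral_of_L1 (fun x => a x * b x) (ha.integrable_mul hb).aestronglyMeasurable
    (Eventually.of_forall fun i => ha.integrable_mul (hc i)) ?_
  have hbound : ∀ i, ∫⁻ x, ‖a x * c i x - a x * b x‖ₑ ∂μ
      ≤ eLpNorm a 2 μ * eLpNorm (c i - b) 2 μ := fun i => by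
    have := eLpNorm_smul_le_mul_eLpNorm (p := 2) (q := 2) (r := 1) (μ := μ)
      ((hc i).1.sub hb.1) ha.1
    rw [eLpNorm_one_eq_lintegral_enorm] at this
    refine le_trans (le_of_eq (lintegral_congr fun x => ?_)) this
    simp [mul_sub]
  refine tendsto_of_tendsto_of_tendsto_of_le_of_le tendsto_const_nhds ?_ (fun _ => zero_le) hbound
  have := ENNReal.Tendsto.const_mul (a := eLpNorm a 2 μ) h (Or.inr ha.2.ne)
  simpa using this

/-- A real weak derivative may be tested against complex functions. -/
theorem HasWeakPartial.integral_complex {j : Fin n} {u v : EuclideanSpace ℝ (Fin n) → ℝ}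
    (h : HasWeakPartial j u v) {ψ : EuclideanSpace ℝ (Fin n) → ℂ} (hψ : ContDiff ℝ ∞ ψ)
    (hc : HasCompactSupport ψ) :
    ∫ x, fderiv ℝ ψ x (EuclideanSpace.single j 1) * (u x : ℂ) = -∫ x, ψ x * (v x : ℂ) := by
  have hdc : HasCompactSupport fun x => fderiv ℝ ψ x (EuclideanSpace.single j 1) :=
    hc.fderiv_apply ℝ _
  have hdC : Continuous fun x => fderiv ℝ ψ x (EuclideanSpace.single j 1) :=
    (hψ.continuous_fderiv (by simp)).clm_apply continuous_const
  have i1 : Integrable fun x => fderiv ℝ ψ x (EuclideanSpace.single j 1) * (u x : ℂ) :=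
    LocallyIntegrable.integrable_smul_left_of_hasCompactSupport (f := fun x => (u x : ℂ))
      (h.1.mono (continuous_ofReal.comp_aestronglyMeasurable h.1.aestronglyMeasurable)
        (Eventually.of_forall fun x => by simp)) hdC hdc
  have i2 : Integrable fun x => ψ x * (v x : ℂ) :=
    LocallyIntegrable.integrable_smul_left_of_hasCompactSupport (f := fun x => (v x : ℂ))
      (h.2.1.mono (continuous_ofReal.comp_aestronglyMeasurable h.2.1.aestronglyMeasurable)
        (Eventually.of_forall fun x => by simp)) hψ.continuous hc
  have hd : ∀ (L : ℂ →L[ℝ] ℝ) x, fderiv ℝ (fun x => L (ψ x)) x (EuclideanSpace.single j 1)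
      = L (fderiv ℝ ψ x (EuclideanSpace.single j 1)) := fun L x => by
    have := (L.hasFDerivAt (x := ψ x)).comp x (hψ.differentiable (by simp) x).hasFDerivAt
    rw [show fderiv ℝ (fun x => L (ψ x)) x = _ from this.fderiv]
    rfl
  have hre := h.2.2 (fun x => reCLM (ψ x)) (reCLM.contDiff.comp hψ)
    (hc.comp_left (g := reCLM) (map_zero _))
  have him := h.2.2 (fun x => imCLM (ψ x)) (imCLM.contDiff.comp hψ)
    (hc.comp_left (g := imCLM) (map_zero _))
  simp only [hd] at hre him
  have e1 := reCLM.integral_comp_comm i1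
  have e2 := reCLM.integral_comp_comm i2
  have e3 := imCLM.integral_comp_comm i1
  have e4 := imCLM.integral_comp_comm i2
  simp only [reCLM_apply, imCLM_apply, Complex.re_mul_ofReal, Complex.im_mul_ofReal,
    smul_eq_mul] at e1 e2 e3 e4 hre him
  apply Complex.ext
  · rw [Complex.neg_re, ← e1, ← e2, hre]
  · rw [Complex.neg_im, ← e3, ← e4, him]

/-- Leibniz rule for a weak derivative and a smooth function. -/
theorem HasWeakPartial.smul_smooth {j : Fin n} {u v : EuclideanSpace ℝ (Fin n) → ℂ}
    (h : HasWeakPartial j u v) {χ : EuclideanSpace ℝ (Fin n) → ℝ} (hχ : ContDiff ℝ ∞ χ) :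
    HasWeakPartial j (fun x => χ x • u x)
      (fun x => χ x • v x + fderiv ℝ χ x (EuclideanSpace.single j 1) • u x) := by
  have hdC : ∀ {φ : EuclideanSpace ℝ (Fin n) → ℝ}, ContDiff ℝ ∞ φ →
      Continuous fun x => fderiv ℝ φ x (EuclideanSpace.single j 1) := fun hφ =>
    (hφ.continuous_fderiv (by simp)).clm_apply continuous_const
  have l1 := h.1.continuous_smul hχ.continuous
  have l2 := h.2.1.continuous_smul hχ.continuous
  have l3 := h.1.continuous_smul (hdC hχ)
  refine ⟨l1, l2.add l3, fun φ hφ hc => ?_⟩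
  have key := h.2.2 (fun x => φ x * χ x) (hφ.mul hχ) hc.mul_right
  have hd : ∀ x, fderiv ℝ (fun x => φ x * χ x) x (EuclideanSpace.single j 1)
      = φ x * fderiv ℝ χ x (EuclideanSpace.single j 1)
        + χ x * fderiv ℝ φ x (EuclideanSpace.single j 1) := fun x => by
    have := (hφ.differentiable (by simp) x).hasFDerivAt.mul
      (hχ.differentiable (by simp) x).hasFDerivAt
    rw [show fderiv ℝ (fun x => φ x * χ x) x = _ from this.fderiv]
    simp
  simp only [hd] at key
  have i1 : Integrable fun x => φ x • (fderiv ℝ χ x (EuclideanSpace.single j 1) • u x) :=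
    integrable_test_smul hφ.continuous hc l3
  have i2 : Integrable fun x => fderiv ℝ φ x (EuclideanSpace.single j 1) • (χ x • u x) :=
    integrable_test_smul (hdC hφ) (hc.fderiv_apply ℝ _) l1
  have i3 : Integrable fun x => φ x • (χ x • v x) := integrable_test_smul hφ.continuous hc l2
  have e1 : ∫ x, (φ x * fderiv ℝ χ x (EuclideanSpace.single j 1)
        + χ x * fderiv ℝ φ x (EuclideanSpace.single j 1)) • u x
      = (∫ x, φ x • (fderiv ℝ χ x (EuclideanSpace.single j 1) • u x))
        + ∫ x, fderiv ℝ φ x (EuclideanSpace.single j 1) • (χ x • u x) := by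
    rw [← integral_add i1 i2]
    refine integral_congr_ae (Eventually.of_forall fun x => ?_)
    simp only [smul_smul, ← add_smul]
    congr 1
    ring
  rw [e1] at key
  have e2 : ∫ x, φ x • (χ x • v x + fderiv ℝ χ x (EuclideanSpace.single j 1) • u x)
      = (∫ x, φ x • (χ x • v x))
        + ∫ x, φ x • (fderiv ℝ χ x (EuclideanSpace.single j 1) • u x) := by
    simp only [smul_add]
    exact integral_add i3 i1
  rw [e2]
  simp only [smul_smul] at key ⊢
  linear_combination key

/-- A cutoff function that is one on a given ball. -/
noncomputable def ballCutoff (n : ℕ) (R : ℝ) : ContDiffBump (0 : EuclideanSpace ℝ (Fin n)) :=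
  ⟨|R| + 1, |R| + 2, by positivity, by linarith⟩

theorem ballCutoff_eq_one {R : ℝ} {x : EuclideanSpace ℝ (Fin n)} (hx : ‖x‖ ≤ R) :
    ballCutoff n R x = 1 :=
  (ballCutoff n R).one_of_mem_closedBall (by
    simp only [ballCutoff, mem_closedBall_zero_iff]; linarith [le_abs_self R])

theorem fderiv_ballCutoff {R : ℝ} {x : EuclideanSpace ℝ (Fin n)} (hx : ‖x‖ ≤ R) :
    fderiv ℝ (ballCutoff n R) x = 0 := by
  have : (ballCutoff n R : EuclideanSpace ℝ (Fin n) → ℝ) =ᶠ[𝓝 x] fun _ => 1 := by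
    have hx' : x ∈ Metric.ball (0 : EuclideanSpace ℝ (Fin n)) (|R| + 1) := by
      rw [mem_ball_zero_iff]; linarith [le_abs_self R]
    filter_upwards [Metric.isOpen_ball.mem_nhds hx'] with y hy
    exact (ballCutoff n R).one_of_mem_closedBall (Metric.ball_subset_closedBall hy)
  rw [this.fderiv_eq]
  simp

theorem memLp_cutoff {R : ℝ} {u v : EuclideanSpace ℝ (Fin n) → ℂ} {j : Fin n}
    (hu : MemLocalLp u 2) (hv : MemLocalLp v 2) :
    MemLp (fun x => ballCutoff n R x • u x) 2 ∧
    MemLp (fun x => ballCutoff n R x • v x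
      + fderiv ℝ (ballCutoff n R) x (EuclideanSpace.single j 1) • u x) 2 := by
  have hs : ContDiff ℝ ∞ (ballCutoff n R) := (ballCutoff n R).contDiff
  have hdC : Continuous fun x => fderiv ℝ (ballCutoff n R) x (EuclideanSpace.single j 1) :=
    (hs.continuous_fderiv (by simp)).clm_apply continuous_const
  have aux : ∀ {χ : EuclideanSpace ℝ (Fin n) → ℝ} {f : EuclideanSpace ℝ (Fin n) → ℂ},
      Continuous χ → HasCompactSupport χ → MemLocalLp f 2 → MemLp (fun x => χ x • f x) 2 := by
    intro χ f h1 h2 h3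
    obtain ⟨M, hM⟩ := h2.exists_bound_of_continuous h1
    have hcs : HasCompactSupport fun x => (χ x : ℂ) :=
      h2.comp_left (g := fun t : ℝ => (t : ℂ)) Complex.ofReal_zero
    have := h3.memLp_mul (χ := fun x => (χ x : ℂ)) (M := M)
      (continuous_ofReal.comp h1).aestronglyMeasurable
      (Eventually.of_forall fun x => by simpa using hM x) hcs
    simpa [Complex.real_smul] using this
  have hc := (ballCutoff n R).hasCompactSupport
  exact ⟨aux hs.continuous hc hu, (aux hs.continuous hc hv).add
    (aux hdC (hc.fderiv_apply ℝ _) hu)⟩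

/-- Leibniz rule for a bounded real function and a complex function of class `H¹_loc`. -/
theorem HasWeakPartial.mul {j : Fin n} {w dw : EuclideanSpace ℝ (Fin n) → ℝ}
    {f g : EuclideanSpace ℝ (Fin n) → ℂ} (hw : HasWeakPartial j w dw) {M : ℝ}
    (hM : ∀ᵐ x, |w x| ≤ M) (hdw : MemLocalLp dw 2) (hf : HasWeakPartial j f g)
    (hf2 : MemLocalLp f 2) (hg2 : MemLocalLp g 2) :
    HasWeakPartial j (fun x => (w x : ℂ) * f x)
      (fun x => (dw x : ℂ) * f x + (w x : ℂ) * g x) := by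
  have mw : AEStronglyMeasurable (fun x => (w x : ℂ)) :=
    continuous_ofReal.comp_aestronglyMeasurable hw.1.aestronglyMeasurable
  have hM' : ∀ᵐ x, ‖(w x : ℂ)‖ ≤ M := hM.mono fun x hx => by simpa using hx
  have hdwC : MemLocalLp (fun x => (dw x : ℂ)) 2 := fun K hK => (hdw K hK).ofReal
  have bdd : ∀ {u : EuclideanSpace ℝ (Fin n) → ℂ}, LocallyIntegrable u →
      LocallyIntegrable fun x => (w x : ℂ) * u x := fun hu => by
    rw [locallyIntegrable_iff] at hu ⊢
    exact fun K hK => (hu K hK).bdd_mul mw.restrict (ae_restrict_of_ae hM')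
  have l1 := bdd hf.1
  have l2 := bdd hf.2.1
  have l3 : LocallyIntegrable fun x => (dw x : ℂ) * f x := by
    rw [locallyIntegrable_iff]
    exact fun K hK => (hdwC K hK).integrable_mul (hf2 K hK)
  refine ⟨l1, l3.add l2, fun φ hφ hc => ?_⟩
  obtain ⟨R, hR⟩ := hc.isCompact.isBounded.subset_closedBall (0 : EuclideanSpace ℝ (Fin n))
  have hR' : ∀ x, x ∈ tsupport φ → ‖x‖ ≤ R := fun x hx => by simpa using hR hx
  -- Cutting off on a ball containing the support of `φ` changes nothing in the tested identity and
  -- puts the function and its weak derivative in L² globally.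
  set u : EuclideanSpace ℝ (Fin n) → ℂ := fun x => ballCutoff n R x • f x with hu
  set v : EuclideanSpace ℝ (Fin n) → ℂ := fun x => ballCutoff n R x • g x
      + fderiv ℝ (ballCutoff n R) x (EuclideanSpace.single j 1) • f x with hv
  have huv : HasWeakPartial j u v := hf.smul_smooth (ballCutoff n R).contDiff
  obtain ⟨mu, mv⟩ : MemLp u 2 ∧ MemLp v 2 := memLp_cutoff hf2 hg2
  have hdC : Continuous fun x => fderiv ℝ φ x (EuclideanSpace.single j 1) :=
    (hφ.continuous_fderiv (by simp)).clm_apply continuous_const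
  have hdc : HasCompactSupport fun x => fderiv ℝ φ x (EuclideanSpace.single j 1) :=
    hc.fderiv_apply ℝ _
  have mwL : MemLocalLp (fun x => (w x : ℂ)) 2 := fun K hK => by
    have : IsFiniteMeasure (volume.restrict K) := ⟨by simpa using hK.measure_lt_top⟩
    exact MemLp.of_bound mw.restrict M (ae_restrict_of_ae hM')
  have pair : ∀ {χ : EuclideanSpace ℝ (Fin n) → ℝ} {a : EuclideanSpace ℝ (Fin n) → ℂ},
      Continuous χ → HasCompactSupport χ → MemLocalLp a 2 →
      MemLp (fun x => (χ x : ℂ) * a x) 2 := by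
    intro χ a h1 h2 h3
    obtain ⟨B, hB⟩ := h2.exists_bound_of_continuous h1
    exact h3.memLp_mul (χ := fun x => (χ x : ℂ)) (M := B)
      (continuous_ofReal.comp h1).aestronglyMeasurable
      (Eventually.of_forall fun x => by simpa using hB x)
      (h2.comp_left (g := fun t : ℝ => (t : ℂ)) Complex.ofReal_zero)
  have a1 := pair hdC hdc mwL
  have a2 := pair hφ.continuous hc hdwC
  have a3 := pair hφ.continuous hc mwL
  have mmu : ∀ i, MemLp (mollify i u) 2 := fun i =>
    ⟨(contDiff_mollify i huv.1).continuous.aestronglyMeasurable,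
      (eLpNorm_mollify_le i mu).trans_lt mu.2⟩
  have mmv : ∀ i, MemLp (mollify i v) 2 := fun i =>
    ⟨(contDiff_mollify i huv.2.1).continuous.aestronglyMeasurable,
      (eLpNorm_mollify_le i mv).trans_lt mv.2⟩
  have t1 := tendsto_integral_mul_of_tendsto_eLpNorm a1 mu mmu (tendsto_eLpNorm_mollify_sub mu)
  have t2 := tendsto_integral_mul_of_tendsto_eLpNorm a2 mu mmu (tendsto_eLpNorm_mollify_sub mu)
  have t3 := tendsto_integral_mul_of_tendsto_eLpNorm a3 mv mmv (tendsto_eLpNorm_mollify_sub mv)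
  -- φ times a mollification of u is an admissible test function for w. Each integral pairs it, or
  -- its derivative, with a fixed L² function, so L² convergence passes to the limit.
  have hi : ∀ i, ∫ x, (fderiv ℝ φ x (EuclideanSpace.single j 1) : ℂ) * (w x : ℂ) * mollify i u x
      = -((∫ x, (φ x : ℂ) * (dw x : ℂ) * mollify i u x)
        + ∫ x, (φ x : ℂ) * (w x : ℂ) * mollify i v x) := fun i => by
    have hmi := contDiff_mollify i huv.1
    have hψ : ContDiff ℝ ∞ fun x => φ x • mollify i u x := hφ.smul hmi
    have key := hw.integral_complex hψ hc.smul_right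
    have hd : ∀ x, fderiv ℝ (fun x => φ x • mollify i u x) x (EuclideanSpace.single j 1)
        = φ x • mollify i v x
          + fderiv ℝ φ x (EuclideanSpace.single j 1) • mollify i u x := fun x => by
      have := (hφ.differentiable (by simp) x).hasFDerivAt.smul
        (hmi.differentiable (by simp) x).hasFDerivAt
      rw [show fderiv ℝ (fun x => φ x • mollify i u x) x = _ from this.fderiv]
      simp [fderiv_mollify huv]
    simp only [hd] at key
    have j1 := a1.integrable_mul (mmu i)
    have j3 := a3.integrable_mul (mmv i)
    have e : ∫ x, (φ x • mollify i v x
          + fderiv ℝ φ x (EuclideanSpace.single j 1) • mollify i u x) * (w x : ℂ)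
        = (∫ x, (φ x : ℂ) * (w x : ℂ) * mollify i v x)
          + ∫ x, (fderiv ℝ φ x (EuclideanSpace.single j 1) : ℂ) * (w x : ℂ) * mollify i u x := by
      refine Eq.trans ?_ (integral_add j3 j1)
      refine integral_congr_ae (Eventually.of_forall fun x => ?_)
      simp only [Complex.real_smul]
      ring
    have e' : ∫ x, φ x • mollify i u x * (dw x : ℂ)
        = ∫ x, (φ x : ℂ) * (dw x : ℂ) * mollify i u x := by
      refine integral_congr_ae (Eventually.of_forall fun x => ?_)
      simp only [Complex.real_smul]
      ring
    rw [e, e'] at key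
    linear_combination key
  have hlim := tendsto_nhds_unique t1 ((t2.add t3).neg.congr fun i => (hi i).symm)
  have eu : ∀ x, x ∈ tsupport φ → u x = f x := fun x hx => by
    simp [hu, ballCutoff_eq_one (hR' x hx)]
  have ev : ∀ x, x ∈ tsupport φ → v x = g x := fun x hx => by
    simp [hv, ballCutoff_eq_one (hR' x hx), fderiv_ballCutoff (hR' x hx)]
  have r1 : ∫ x, fderiv ℝ φ x (EuclideanSpace.single j 1) • ((w x : ℂ) * f x)
      = ∫ x, (fderiv ℝ φ x (EuclideanSpace.single j 1) : ℂ) * (w x : ℂ) * u x := by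
    refine integral_congr_ae (Eventually.of_forall fun x => ?_)
    by_cases hx : x ∈ tsupport φ
    · simp only [eu x hx, Complex.real_smul]
      ring
    · have : fderiv ℝ φ x = 0 := by
        by_contra h0
        exact hx (support_fderiv_subset ℝ h0)
      simp [this]
  have r2 : ∫ x, φ x • ((dw x : ℂ) * f x + (w x : ℂ) * g x)
      = (∫ x, (φ x : ℂ) * (dw x : ℂ) * u x) + ∫ x, (φ x : ℂ) * (w x : ℂ) * v x := by
    refine Eq.trans ?_ (integral_add (a2.integrable_mul mu) (a3.integrable_mul mv))
    refine integral_congr_ae (Eventually.of_forall fun x => ?_)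
    by_cases hx : x ∈ tsupport φ
    · simp only [eu x hx, ev x hx, Complex.real_smul]
      ring
    · simp [image_eq_zero_of_notMem_tsupport hx]
  rw [r1, r2, hlim]

end WeakProducts

/-! ### Sobolev's inequality and multiplication by L^p_loc functions. -/

section Sobolev

open scoped NNReal Topology
open Filter Set

variable {n : ℕ}

theorem norm_le_sum_norm_single {F : Type*} [NormedAddCommGroup F] [NormedSpace ℝ F]
    (L : EuclideanSpace ℝ (Fin n) →L[ℝ] F) : ‖L‖ ≤ ∑ j, ‖L (EuclideanSpace.single j 1)‖ := by
  refine L.opNorm_le_bound (Finset.sum_nonneg fun _ _ => norm_nonneg _) fun x => ?_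
  have hx : x = ∑ j, x j • EuclideanSpace.single j (1 : ℝ) := by
    ext i
    simp [Pi.single_apply]
  conv_lhs => rw [hx]
  rw [map_sum, Finset.sum_mul]
  refine (norm_sum_le _ _).trans (Finset.sum_le_sum fun j _ => ?_)
  rw [map_smul, norm_smul, mul_comm]
  gcongr
  exact PiLp.norm_apply_le x j

theorem eLpNorm_fun_sum_le {X ι F : Type*} [MeasurableSpace X] {μ : Measure X} {p : ℝ≥0∞}
    [NormedAddCommGroup F] (hp : 1 ≤ p) {f : ι → X → F} {s : Finset ι}
    (hf : ∀ j, AEStronglyMeasurable (f j) μ) :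
    eLpNorm (fun x => ∑ j ∈ s, f j x) p μ ≤ ∑ j ∈ s, eLpNorm (f j) p μ := by
  rw [← Finset.sum_fn]
  exact eLpNorm_sum_le (fun j _ => hf j) hp

theorem eLpNorm_fderiv_le_sum {w : EuclideanSpace ℝ (Fin n) → ℂ} (hw : ContDiff ℝ ∞ w) :
    eLpNorm (fderiv ℝ w) 2
      ≤ ∑ j, eLpNorm (fun x => fderiv ℝ w x (EuclideanSpace.single j 1)) 2 volume := by
  have hC : ∀ j : Fin n, Continuous fun x => fderiv ℝ w x (EuclideanSpace.single j 1) := fun j =>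
    (hw.continuous_fderiv (by simp)).clm_apply continuous_const
  have h1 : eLpNorm (fderiv ℝ w) 2
      ≤ eLpNorm (fun x => ∑ j, ‖fderiv ℝ w x (EuclideanSpace.single j 1)‖) 2 :=
    eLpNorm_mono_real fun x => norm_le_sum_norm_single _
  refine h1.trans ((eLpNorm_fun_sum_le one_le_two
    fun j => (hC j).norm.aestronglyMeasurable).trans (le_of_eq ?_))
  exact Finset.sum_congr rfl fun j _ => eLpNorm_norm _

/-- Hölder on a set of finite measure. It lets Sobolev's inequality be used with a gradient exponent
t below 2, as dimension two requires. -/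
theorem exists_eLpNorm_fderiv_le {t : ℝ≥0} (ht1 : 1 ≤ t) (ht2 : t ≤ 2)
    {s : Set (EuclideanSpace ℝ (Fin n))} (hsf : volume s < ⊤) :
    ∃ B : ℝ≥0, ∀ w : EuclideanSpace ℝ (Fin n) → ℂ, ContDiff ℝ ∞ w →
      Function.support (fderiv ℝ w) ⊆ s →
      eLpNorm (fderiv ℝ w) t ≤ eLpNorm (fderiv ℝ w) 2 volume * B := by
  obtain ⟨e, he⟩ : ∃ e : ℝ, e = 1 / (t : ℝ) - 1 / 2 := ⟨_, rfl⟩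
  have he0 : 0 ≤ e := by
    have h1 : (0 : ℝ) < t := lt_of_lt_of_le one_pos (by exact_mod_cast ht1)
    have h2 : (t : ℝ) ≤ 2 := by exact_mod_cast ht2
    rw [he, sub_nonneg]
    exact one_div_le_one_div_of_le h1 h2
  refine ⟨(volume s).toNNReal ^ e, fun w hw hsd => ?_⟩
  have hr : ∀ q : ℝ≥0∞, eLpNorm (fderiv ℝ w) q (volume.restrict s)
      = eLpNorm (fderiv ℝ w) q volume := fun q => by
    rw [← eLpNorm_norm, ← eLpNorm_norm (fderiv ℝ w)]
    refine eLpNorm_restrict_eq_of_support_subset fun x hx => hsd fun h0 => hx ?_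
    simp only [h0, norm_zero]
  rw [← hr, ← hr]
  refine (eLpNorm_le_eLpNorm_mul_rpow_measure_univ (q := 2) (by exact_mod_cast ht2)
    (hw.continuous_fderiv (by simp)).aestronglyMeasurable).trans (le_of_eq ?_)
  rw [ENNReal.coe_rpow_of_nonneg _ he0, ENNReal.coe_toNNReal hsf.ne, he]
  simp

/-- Gagliardo–Nirenberg–Sobolev on a bounded set, with a constant that does not depend on the
function. -/
theorem exists_eLpNorm_le_fderiv {r t : ℝ≥0} (ht1 : 1 ≤ t) (htn : t < n)
    (hrt : (t : ℝ)⁻¹ - (n : ℝ)⁻¹ ≤ (r : ℝ)⁻¹) {s : Set (EuclideanSpace ℝ (Fin n))}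
    (hs : Bornology.IsBounded s) :
    ∃ A : ℝ≥0, ∀ w : EuclideanSpace ℝ (Fin n) → ℂ, ContDiff ℝ ∞ w →
      Function.support w ⊆ s → eLpNorm w r ≤ A * eLpNorm (fderiv ℝ w) t volume := by
  have h2 : t < Module.finrank ℝ (EuclideanSpace ℝ (Fin n)) := by
    rw [finrank_euclideanSpace_fin]
    exact htn
  have h3 : (t : ℝ)⁻¹ - (Module.finrank ℝ (EuclideanSpace ℝ (Fin n)) : ℝ)⁻¹ ≤ (r : ℝ)⁻¹ := by
    rw [finrank_euclideanSpace_fin]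
    exact hrt
  refine ⟨eLpNormLESNormFDerivOfLeConst ℂ (volume : Measure (EuclideanSpace ℝ (Fin n))) s t r,
    fun w hw hsw => ?_⟩
  have hw1 : ContDiff ℝ 1 w := hw.of_le (by simp)
  exact eLpNorm_le_eLpNorm_fderiv_of_le (F := ℂ) (volume : Measure (EuclideanSpace ℝ (Fin n)))
    hw1 hsw ht1 h2 h3 hs

/-- Sobolev inequality for functions of bounded support with weak derivatives in `L²`. -/
theorem exists_sobolev_bound {r t : ℝ≥0} (ht1 : 1 ≤ t) (ht2 : t ≤ 2) (htn : t < n)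
    (hrt : (t : ℝ)⁻¹ - (n : ℝ)⁻¹ ≤ (r : ℝ)⁻¹) (R : ℝ) :
    ∃ C : ℝ≥0, ∀ (u : EuclideanSpace ℝ (Fin n) → ℂ) (v : Fin n → EuclideanSpace ℝ (Fin n) → ℂ),
      (∀ j, HasWeakPartial j u (v j)) → MemLp u 2 → (∀ j, MemLp (v j) 2) →
      Function.support u ⊆ Metric.closedBall 0 R →
      eLpNorm u r ≤ C * ∑ j, eLpNorm (v j) 2 volume := by
  have hsf : volume (Metric.closedBall (0 : EuclideanSpace ℝ (Fin n)) (R + 2)) < ⊤ :=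
    (isCompact_closedBall _ _).measure_lt_top
  have hsc : IsClosed (Metric.closedBall (0 : EuclideanSpace ℝ (Fin n)) (R + 2)) :=
    Metric.isClosed_closedBall
  have hsb : Bornology.IsBounded (Metric.closedBall (0 : EuclideanSpace ℝ (Fin n)) (R + 2)) :=
    Metric.isBounded_closedBall
  have hss : ∀ (i : ℕ) {u : EuclideanSpace ℝ (Fin n) → ℂ},
      Function.support u ⊆ Metric.closedBall 0 R → Function.support (mollify i u)
        ⊆ Metric.closedBall (0 : EuclideanSpace ℝ (Fin n)) (R + 2) :=
    fun i u h => support_mollify_subset i h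
  generalize Metric.closedBall (0 : EuclideanSpace ℝ (Fin n)) (R + 2) = s at hsf hsc hsb hss
  obtain ⟨A, hA⟩ := exists_eLpNorm_le_fderiv ht1 htn hrt hsb
  obtain ⟨B, hB⟩ := exists_eLpNorm_fderiv_le (n := n) ht1 ht2 hsf
  refine ⟨A * B, fun u v h hu hv hsupp => ?_⟩
  have hl : LocallyIntegrable u := hu.locallyIntegrable (by norm_num)
  -- Fatou: the L^r norm is lower semicontinuous under almost everywhere convergence, so a uniform
  -- bound for the mollifications, all supported in one ball, carries over to u.
  refine (Lp.eLpNorm_lim_le_liminf_eLpNorm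
    (fun i => (contDiff_mollify i hl).continuous.aestronglyMeasurable) u
    (ae_tendsto_mollify hl)).trans ?_
  refine liminf_le_of_frequently_le' (Frequently.of_forall fun i => ?_)
  have hw := contDiff_mollify i hl
  have hsw := hss i hsupp
  have hsd : Function.support (fderiv ℝ (mollify i u)) ⊆ s :=
    (support_fderiv_subset ℝ).trans (closure_minimal hsw hsc)
  have g4 : ∀ j, eLpNorm (fun x => fderiv ℝ (mollify i u) x (EuclideanSpace.single j 1)) 2 volume
      ≤ eLpNorm (v j) 2 volume := fun j => by
    simp only [fderiv_mollify (h j)]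
    exact eLpNorm_mollify_le i (hv j)
  have g5 := (eLpNorm_fderiv_le_sum hw).trans (Finset.sum_le_sum fun j _ => g4 j)
  have g6 := (hB _ hw hsd).trans (mul_le_mul_left g5 _)
  refine ((hA _ hw hsw).trans (mul_le_mul_right g6 _)).trans (le_of_eq ?_)
  push_cast
  ring

/-- For n = 3 the triple is q = 3, r = 6, t = 2, the endpoint. For n = 2 the value t = 2 is
excluded; a finite q with 2 < q ≤ p gives 1/r = 1/2 - 1/q and 1/t = 1 - 1/q, for which the Sobolev
relation is an equality. -/
theorem exists_sobolev_exponents {p : ℝ≥0∞} (hnp : (n = 2 ∧ 2 < p) ∨ (n = 3 ∧ 3 ≤ p)) :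
    ∃ q r t : ℝ≥0, (q : ℝ≥0∞) ≤ p ∧ ENNReal.HolderTriple q r 2 ∧ 1 ≤ t ∧ t ≤ 2 ∧ t < n ∧
      (t : ℝ)⁻¹ - (n : ℝ)⁻¹ ≤ (r : ℝ)⁻¹ := by
  have hold : ∀ q r : ℝ≥0, 0 < q → 0 < r → (q : ℝ)⁻¹ + (r : ℝ)⁻¹ = 2⁻¹ →
      ENNReal.HolderTriple q r 2 := fun q r hq hr h => ⟨by
    rw [← ENNReal.coe_inv hq.ne', ← ENNReal.coe_inv hr.ne', ← ENNReal.coe_ofNat,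
      ← ENNReal.coe_inv (by norm_num), ← ENNReal.coe_add, ENNReal.coe_inj]
    exact NNReal.eq (by push_cast; exact h)⟩
  rcases hnp with ⟨rfl, hp⟩ | ⟨rfl, hp⟩
  · obtain ⟨q, hq2, hqp⟩ : ∃ q : ℝ≥0, 2 < q ∧ (q : ℝ≥0∞) ≤ p := by
      obtain ⟨q, h1, h2⟩ := ENNReal.lt_iff_exists_nnreal_btwn.1 hp
      exact ⟨q, by exact_mod_cast h1, h2.le⟩
    have hq2' : (2 : ℝ) < q := by exact_mod_cast hq2
    have hr0 : (0 : ℝ) < 2 * q / (q - 2) := div_pos (by linarith) (by linarith)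
    have ht0 : (0 : ℝ) < q / (q - 1) := div_pos (by linarith) (by linarith)
    obtain ⟨r, hr⟩ : ∃ r : ℝ≥0, (r : ℝ) = 2 * q / (q - 2) := ⟨Real.toNNReal _, Real.coe_toNNReal _ hr0.le⟩
    obtain ⟨t, ht⟩ : ∃ t : ℝ≥0, (t : ℝ) = q / (q - 1) := ⟨Real.toNNReal _, Real.coe_toNNReal _ ht0.le⟩
    have q1 : (q : ℝ) - 2 ≠ 0 := by linarith
    have q2 : (q : ℝ) - 1 ≠ 0 := by linarith
    have q3 : (q : ℝ) ≠ 0 := by linarith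
    refine ⟨q, r, t, hqp, hold _ _ (lt_trans (by norm_num) hq2)
      (by rw [← NNReal.coe_pos, hr]; exact hr0) ?_, ?_, ?_, ?_, ?_⟩
    · rw [hr]
      field_simp
      ring
    · rw [← NNReal.coe_le_coe, ht, NNReal.coe_one, le_div_iff₀ (by linarith)]
      linarith
    · rw [← NNReal.coe_le_coe, ht, NNReal.coe_ofNat, div_le_iff₀ (by linarith)]
      linarith
    · rw [← NNReal.coe_lt_coe, ht, NNReal.coe_natCast, div_lt_iff₀ (by linarith)]
      push_cast
      linarith
    · rw [hr, ht]
      refine le_of_eq ?_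
      push_cast
      field_simp
      ring
  · refine ⟨3, 6, 2, by exact_mod_cast hp, hold _ _ (by norm_num) (by norm_num) (by norm_num),
      by norm_num, le_rfl, by norm_num, by norm_num⟩

/-- Multiplication by an `L^p_loc` function is bounded from `H¹` to `L²` on balls, in the range of
exponents that Sobolev's inequality permits. -/
theorem exists_eLpNorm_mul_le {p : ℝ≥0∞} (hnp : (n = 2 ∧ 2 < p) ∨ (n = 3 ∧ 3 ≤ p))
    {B : EuclideanSpace ℝ (Fin n) → ℂ} (hB : MemLocalLp B p) (R : ℝ) :
    ∃ C : ℝ≥0, ∀ (u : EuclideanSpace ℝ (Fin n) → ℂ) (v : Fin n → EuclideanSpace ℝ (Fin n) → ℂ),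
      (∀ j, HasWeakPartial j u (v j)) → MemLocalLp u 2 → (∀ j, MemLocalLp (v j) 2) →
      eLpNorm (fun x => B x * u x) 2 (volume.restrict (Metric.closedBall 0 R))
        ≤ C * (eLpNorm u 2 (volume.restrict (Metric.closedBall 0 (|R| + 2)))
          + ∑ j, eLpNorm (v j) 2 (volume.restrict (Metric.closedBall 0 (|R| + 2)))) := by
  obtain ⟨q, r, t, hqp, hH, ht1, ht2, htn, hrt⟩ := exists_sobolev_exponents hnp
  obtain ⟨C, hC⟩ := exists_sobolev_bound ht1 ht2 htn hrt (|R| + 2)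
  have hBq := hB.mono_exponent hqp
  set S : Set (EuclideanSpace ℝ (Fin n)) := Metric.closedBall 0 (|R| + 2) with hS
  set b : ℝ≥0 := (eLpNorm B q (volume.restrict (Metric.closedBall 0 R))).toNNReal with hb
  have hb' : eLpNorm B q (volume.restrict (Metric.closedBall 0 R)) = b :=
    (ENNReal.coe_toNNReal (hBq _ (isCompact_closedBall _ _)).2.ne).symm
  have hs : ContDiff ℝ ∞ (ballCutoff n R) := (ballCutoff n R).contDiff
  have hdC : ∀ j, Continuous fun x => fderiv ℝ (ballCutoff n R) x (EuclideanSpace.single j 1) :=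
    fun j => (hs.continuous_fderiv (by simp)).clm_apply continuous_const
  obtain ⟨M, hM⟩ : ∃ M : ℝ≥0, ∀ x, ‖fderiv ℝ (ballCutoff n R) x‖ ≤ M := by
    obtain ⟨M, hM⟩ := ((ballCutoff n R).hasCompactSupport.fderiv ℝ).exists_bound_of_continuous
      (hs.continuous_fderiv (by simp))
    exact ⟨M.toNNReal, fun x => (hM x).trans (Real.le_coe_toNNReal M)⟩
  have hsup : Function.support (ballCutoff n R) ⊆ S := by
    rw [(ballCutoff n R).support_eq]
    exact Metric.ball_subset_closedBall
  have hsupd : ∀ x, x ∉ S → fderiv ℝ (ballCutoff n R) x = 0 := fun x hx => by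
    by_contra h0
    exact hx (closure_minimal hsup Metric.isClosed_closedBall (support_fderiv_subset ℝ h0))
  -- `b` is the norm of B in Hölder's inequality, `C` the Sobolev constant, and `n * M` comes from
  -- the n derivatives that fall on the cutoff.
  refine ⟨b * C * (1 + n * M), fun u v h hu hv => ?_⟩
  have hw : ∀ j, HasWeakPartial j (fun x => ballCutoff n R x • u x)
      (fun x => ballCutoff n R x • v j x
        + fderiv ℝ (ballCutoff n R) x (EuclideanSpace.single j 1) • u x) := fun j =>
    (h j).smul_smooth hs
  have hmem := fun j => memLp_cutoff (R := R) (j := j) hu (hv j)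
  have hsob : eLpNorm (fun x => ballCutoff n R x • u x) r volume
      ≤ C * ∑ j, eLpNorm (fun x => ballCutoff n R x • v j x
        + fderiv ℝ (ballCutoff n R) x (EuclideanSpace.single j 1) • u x) 2 volume := by
    by_cases hn : Nonempty (Fin n)
    · exact hC _ _ hw (hmem (Classical.choice hn)).1 (fun j => (hmem j).2) fun x hx =>
        hsup (fun h0 => hx (by simp [h0]))
    · exfalso
      rcases hnp with ⟨rfl, _⟩ | ⟨rfl, _⟩ <;> exact hn ⟨0⟩
  have hvj : ∀ j, eLpNorm (fun x => ballCutoff n R x • v j x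
        + fderiv ℝ (ballCutoff n R) x (EuclideanSpace.single j 1) • u x) 2 volume
      ≤ eLpNorm (v j) 2 (volume.restrict S) + M * eLpNorm u 2 (volume.restrict S) := fun j => by
    have hsub : Function.support (fun x => ballCutoff n R x • v j x
        + fderiv ℝ (ballCutoff n R) x (EuclideanSpace.single j 1) • u x) ⊆ S := fun x hx => by
      by_contra hxS
      refine hx ?_
      have h1 : ballCutoff n R x = 0 := by
        by_contra h0
        exact hxS (hsup h0)
      simp [h1, hsupd x hxS]
    rw [← eLpNorm_restrict_eq_of_support_subset hsub]
    have m1 : AEStronglyMeasurable (fun x => ballCutoff n R x • v j x) (volume.restrict S) :=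
      hs.continuous.aestronglyMeasurable.smul (hv j).aestronglyMeasurable.restrict
    have m2 : AEStronglyMeasurable (fun x => fderiv ℝ (ballCutoff n R) x
        (EuclideanSpace.single j 1) • u x) (volume.restrict S) :=
      (hdC j).aestronglyMeasurable.smul hu.aestronglyMeasurable.restrict
    refine (eLpNorm_add_le m1 m2 (by norm_num)).trans (add_le_add ?_ ?_)
    · refine eLpNorm_mono fun x => ?_
      rw [norm_smul, Real.norm_of_nonneg (ballCutoff n R).nonneg]
      exact mul_le_of_le_one_left (norm_nonneg _) (ballCutoff n R).le_one
    · refine eLpNorm_le_nnreal_smul_eLpNorm_of_ae_le_mul (c := M) (Eventually.of_forall fun x => ?_) 2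
      rw [← NNReal.coe_le_coe]
      push_cast
      rw [norm_smul]
      gcongr
      refine ((fderiv ℝ (ballCutoff n R) x).le_opNorm _).trans ?_
      simpa using hM x
  have e1 : eLpNorm (fun x => B x * u x) 2 (volume.restrict (Metric.closedBall 0 R))
      = eLpNorm (B • fun x => ballCutoff n R x • u x) 2
        (volume.restrict (Metric.closedBall 0 R)) := by
    refine eLpNorm_congr_ae ?_
    filter_upwards [ae_restrict_mem measurableSet_closedBall] with x hx
    simp [ballCutoff_eq_one (mem_closedBall_zero_iff.1 hx)]
  rw [e1]
  have mu : AEStronglyMeasurable (fun x => ballCutoff n R x • u x)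
      (volume.restrict (Metric.closedBall 0 R)) :=
    hs.continuous.aestronglyMeasurable.smul hu.aestronglyMeasurable.restrict
  refine (eLpNorm_smul_le_mul_eLpNorm (p := q) (q := r) mu
    hBq.aestronglyMeasurable.restrict).trans ?_
  rw [hb']
  calc (b : ℝ≥0∞) * eLpNorm (fun x => ballCutoff n R x • u x) r
        (volume.restrict (Metric.closedBall 0 R))
      ≤ b * (C * ∑ j, (eLpNorm (v j) 2 (volume.restrict S)
          + M * eLpNorm u 2 (volume.restrict S))) := by
        gcongr
        refine (eLpNorm_mono_measure _ Measure.restrict_le_self).trans (hsob.trans ?_)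
        gcongr with j
        exact hvj j
    _ = b * C * ((∑ j, eLpNorm (v j) 2 (volume.restrict S))
          + n * M * eLpNorm u 2 (volume.restrict S)) := by
        rw [Finset.sum_add_distrib]
        simp only [Finset.sum_const, Finset.card_univ, Fintype.card_fin, nsmul_eq_mul]
        ring
    _ ≤ b * C * ((1 + n * M) * (eLpNorm u 2 (volume.restrict S)
          + ∑ j, eLpNorm (v j) 2 (volume.restrict S))) := by
        gcongr
        generalize eLpNorm u 2 (volume.restrict S) = U
        generalize ∑ j, eLpNorm (v j) 2 (volume.restrict S) = V
        calc V + n * M * U ≤ (V + n * M * U) + (U + n * M * V) := le_self_add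
          _ = _ := by ring
    _ = _ := by push_cast; ring

end Sobolev

/-! ### Weak gradients of radial kernels and of their convolutions. -/

section GreenGradient

open scoped NNReal Topology
open Filter Set

variable {n : ℕ}

/-- The function `x ↦ g(|x|)`, set to zero at the origin. -/
noncomputable def radialKernel (n : ℕ) (g : ℝ → ℂ) : EuclideanSpace ℝ (Fin n) → ℂ :=
  ({0}ᶜ : Set (EuclideanSpace ℝ (Fin n))).indicator fun x => g ‖x‖

/-- The function `x ↦ g'(|x|) x_j / |x|`, the `j`-th partial derivative of `x ↦ g(|x|)`. -/
noncomputable def radialPartial (g' : ℝ → ℂ) (j : Fin n) (x : EuclideanSpace ℝ (Fin n)) : ℂ :=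
  g' ‖x‖ * ((x j / ‖x‖ : ℝ) : ℂ)

theorem radialKernel_of_ne {g : ℝ → ℂ} {x : EuclideanSpace ℝ (Fin n)} (hx : x ≠ 0) :
    radialKernel n g x = g ‖x‖ :=
  indicator_of_mem (by simpa using hx) _

theorem continuousOn_comp_norm {g : ℝ → ℂ} (hg : ContinuousOn g (Ioi 0)) :
    ContinuousOn (fun x : EuclideanSpace ℝ (Fin n) => g ‖x‖) {0}ᶜ :=
  hg.comp continuous_norm.continuousOn fun x hx => norm_pos_iff.2 (by simpa using hx)

theorem measurable_radialKernel {g : ℝ → ℂ} (hg : ContinuousOn g (Ioi 0)) :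
    Measurable (radialKernel n g) := by
  refine ContinuousOn.measurable_of_countable_compl (s := {0}ᶜ) ?_ (by simp)
  exact (continuousOn_comp_norm hg).congr fun x hx => radialKernel_of_ne (by simpa using hx)

theorem measurable_radialPartial {g' : ℝ → ℂ} (hg : ContinuousOn g' (Ioi 0)) (j : Fin n) :
    Measurable (radialPartial g' j) := by
  refine ContinuousOn.measurable_of_countable_compl (s := {0}ᶜ) ?_ (by simp)
  refine (continuousOn_comp_norm hg).mul (continuous_ofReal.comp_continuousOn ?_)
  refine ContinuousOn.div (by fun_prop) continuous_norm.continuousOn fun x hx => ?_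
  simpa using hx

theorem abs_coord_div_le_one {x : EuclideanSpace ℝ (Fin n)} {s : ℝ} (hs : ‖x‖ ≤ s) (j : Fin n) :
    |x j / s| ≤ 1 := by
  have h0 : 0 ≤ s := (norm_nonneg _).trans hs
  rw [abs_div, abs_of_nonneg h0]
  exact div_le_one_of_le₀ (((Real.norm_eq_abs _).symm.le.trans (PiLp.norm_apply_le x j)).trans hs) h0

theorem norm_radialPartial_le {g' : ℝ → ℂ} {m : ℝ → ℝ} (hg : ∀ r, 0 < r → ‖g' r‖ ≤ m r)
    (h0 : 0 ≤ m 0) (j : Fin n) (x : EuclideanSpace ℝ (Fin n)) :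
    ‖radialPartial g' j x‖ ≤ m ‖x‖ := by
  rcases eq_or_ne x 0 with rfl | hx
  · simpa [radialPartial] using h0
  · rw [radialPartial, norm_mul, norm_real, Real.norm_eq_abs]
    exact (mul_le_of_le_one_right (norm_nonneg _) (abs_coord_div_le_one le_rfl j)).trans
      (hg _ (norm_pos_iff.2 hx))

theorem norm_radialKernel_le {g : ℝ → ℂ} {m : ℝ → ℝ} (hg : ∀ r, 0 < r → ‖g r‖ ≤ m r)
    (h0 : 0 ≤ m 0) (x : EuclideanSpace ℝ (Fin n)) : ‖radialKernel n g x‖ ≤ m ‖x‖ := by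
  rcases eq_or_ne x 0 with rfl | hx
  · simpa [radialKernel] using h0
  · rw [radialKernel_of_ne hx]
    exact hg _ (norm_pos_iff.2 hx)

theorem locallyIntegrable_rpow_norm (hn : 0 < n) :
    LocallyIntegrable fun x : EuclideanSpace ℝ (Fin n) => ‖x‖ ^ (-((n : ℝ) - 1)) := by
  rw [locallyIntegrable_iff]
  intro K hK
  obtain ⟨ε, hε⟩ := hK.isBounded.subset_closedBall 0
  refine IntegrableOn.mono_set ?_ hε
  refine (integrable_indicator_rpow_norm hn ε).integrableOn.congr_fun (fun x hx => ?_)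
    measurableSet_closedBall
  exact indicator_of_mem (mem_Iic.2 (mem_closedBall_zero_iff.1 hx))
    (fun r : ℝ => r ^ (-((n : ℝ) - 1)))

theorem hasFDerivAt_comp_sqrt {g g' : ℝ → ℂ} (hg : ∀ r, 0 < r → HasDerivAt g (g' r) r) {ε : ℝ}
    (hε : 0 < ε) (x : EuclideanSpace ℝ (Fin n)) :
    HasFDerivAt (fun x : EuclideanSpace ℝ (Fin n) => g (√(‖x‖ ^ 2 + ε)))
      ((((1 : ℝ →L[ℝ] ℝ).smulRight (g' (√(‖x‖ ^ 2 + ε)))).comp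
        ((1 / (2 * √(‖x‖ ^ 2 + ε))) • (2 • (innerSL ℝ x))))) x := by
  have hpos : 0 < ‖x‖ ^ 2 + ε := by positivity
  have h1 : HasFDerivAt (fun x : EuclideanSpace ℝ (Fin n) => ‖x‖ ^ 2 + ε) (2 • (innerSL ℝ x)) x :=
    (hasStrictFDerivAt_norm_sq x).hasFDerivAt.add_const ε
  have h2 := h1.sqrt hpos.ne'
  exact (hg _ (Real.sqrt_pos.2 hpos)).hasFDerivAt.comp x h2

/-- A radial function whose derivative has an integrable singularity at the origin has the
pointwise gradient as its weak gradient. -/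
theorem hasWeakPartial_radialKernel (hn : 0 < n) {g g' : ℝ → ℂ} {C : ℝ} (hC : 0 ≤ C)
    (hg : ∀ r, 0 < r → HasDerivAt g (g' r) r) (hg' : ContinuousOn g' (Ioi 0))
    (bg : ∀ r, 0 < r → ‖g r‖ ≤ C * (r ^ (-((n : ℝ) - 1)) + 1))
    (bg' : ∀ r, 0 < r → ‖g' r‖ ≤ C * (r ^ (-((n : ℝ) - 1)) + 1)) (j : Fin n) :
    HasWeakPartial j (radialKernel n g) (radialPartial g' j) := by
  have hgc : ContinuousOn g (Ioi 0) := fun r hr => (hg r hr).continuousAt.continuousWithinAt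
  have hn1 : (1 : ℝ) ≤ n := by exact_mod_cast hn
  set m : ℝ → ℝ := fun r => C * (r ^ (-((n : ℝ) - 1)) + 1) with hm
  have hm0 : 0 ≤ m 0 := by simp only [hm]; positivity
  have hmi : LocallyIntegrable fun x : EuclideanSpace ℝ (Fin n) => m ‖x‖ :=
    ((locallyIntegrable_rpow_norm hn).add (locallyIntegrable_const 1)).smul C
  have hmono : ∀ {r s : ℝ}, 0 < r → r ≤ s → m s ≤ m r := fun {r s} hr hrs => by
    simp only [hm]
    have := Real.rpow_le_rpow_of_nonpos hr hrs (z := -((n : ℝ) - 1)) (by linarith)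
    gcongr
  have hl1 : LocallyIntegrable (radialKernel n g) :=
    hmi.mono (measurable_radialKernel hgc).aestronglyMeasurable (Eventually.of_forall fun x =>
      (norm_radialKernel_le bg hm0 x).trans (le_abs_self _))
  have hl2 : LocallyIntegrable (radialPartial g' j) :=
    hmi.mono (measurable_radialPartial hg' j).aestronglyMeasurable (Eventually.of_forall fun x =>
      (norm_radialPartial_le bg' hm0 j x).trans (le_abs_self _))
  refine ⟨hl1, hl2, fun φ h1 h2 => ?_⟩
  have hdc : HasCompactSupport fun x => fderiv ℝ φ x (EuclideanSpace.single j 1) :=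
    h2.fderiv_apply ℝ _
  have hdC : Continuous fun x => fderiv ℝ φ x (EuclideanSpace.single j 1) :=
    (h1.continuous_fderiv (by simp)).clm_apply continuous_const
  set e : ℕ → ℝ := fun i => 1 / ((i : ℝ) + 1) with he
  have he0 : ∀ i, 0 < e i := fun i => by simp only [he]; positivity
  have hel : Tendsto e atTop (𝓝 0) := tendsto_one_div_add_atTop_nhds_zero_nat
  -- A smooth positive radius, so g ∘ s can be integrated by parts classically. Since s ≥ |x| and
  -- the majorant `m` is decreasing, `m ‖x‖` dominates uniformly in i.
  set s : ℕ → EuclideanSpace ℝ (Fin n) → ℝ := fun i x => √(‖x‖ ^ 2 + e i) with hs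
  have hs0 : ∀ i x, 0 < s i x := fun i x => Real.sqrt_pos.2 (by have := he0 i; positivity)
  have hsx : ∀ i x, ‖x‖ ≤ s i x := fun i x =>
    Real.le_sqrt_of_sq_le (by linarith [he0 i])
  have hsc : ∀ i, Continuous (s i) := fun i => by fun_prop
  have hsl : ∀ x, Tendsto (fun i => s i x) atTop (𝓝 ‖x‖) := fun x => by
    have h := (Real.continuous_sqrt.tendsto _).comp (hel.const_add (‖x‖ ^ 2))
    rwa [add_zero, Real.sqrt_sq (norm_nonneg x)] at h
  have hKd : ∀ i, Differentiable ℝ fun x => g (s i x) := fun i x =>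
    (hasFDerivAt_comp_sqrt hg (he0 i) x).differentiableAt
  have hfd : ∀ i x, fderiv ℝ (fun x => g (s i x)) x (EuclideanSpace.single j 1)
      = g' (s i x) * ((x j / s i x : ℝ) : ℂ) := fun i x => by
    rw [(hasFDerivAt_comp_sqrt hg (he0 i) x).fderiv]
    have := (hs0 i x).ne'
    simp only [ContinuousLinearMap.comp_apply, smul_apply, innerSL_apply_apply,
      EuclideanSpace.inner_single_right, ContinuousLinearMap.smulRight_apply,
      one_apply_eq_self]
    rw [real_smul, mul_comm]
    congr 2
    simp only [hs, one_mul, conj_trivial, smul_eq_mul, nsmul_eq_mul] at this ⊢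
    push_cast
    field_simp
  have hc1 : ∀ i, Continuous fun x => g (s i x) := fun i => (hKd i).continuous
  have hc2 : ∀ i, Continuous fun x => g' (s i x) * ((x j / s i x : ℝ) : ℂ) := fun i => by
    refine (hg'.comp_continuous (hsc i) (hs0 i)).mul (continuous_ofReal.comp ?_)
    exact Continuous.div (by fun_prop) (hsc i) fun x => (hs0 i x).ne'
  have ibp : ∀ i, ∫ x, fderiv ℝ φ x (EuclideanSpace.single j 1) • g (s i x)
      = -∫ x, φ x • (g' (s i x) * ((x j / s i x : ℝ) : ℂ)) := fun i => by
    have := integral_smul_fderiv_eq_neg_fderiv_smul_of_integrable (μ := volume) (𝕜 := ℝ) (f := φ)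
      (g := fun x => g (s i x)) (v := EuclideanSpace.single j 1)
      (integrable_test_smul hdC hdc (hc1 i).locallyIntegrable)
      (by simp only [hfd]
          exact integrable_test_smul h1.continuous h2 (hc2 i).locallyIntegrable)
      (integrable_test_smul h1.continuous h2 (hc1 i).locallyIntegrable)
      (fun x _ => (h1.differentiable (by simp)) x) (fun x _ => hKd i x)
    simp only [hfd] at this
    rw [this, neg_neg]
  have hne : ∀ᵐ x : EuclideanSpace ℝ (Fin n), x ≠ 0 := by
    have : Nonempty (Fin n) := ⟨⟨0, hn⟩⟩
    exact Measure.ae_ne volume 0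
  have lim1 : Tendsto (fun i => ∫ x, fderiv ℝ φ x (EuclideanSpace.single j 1) • g (s i x)) atTop
      (𝓝 (∫ x, fderiv ℝ φ x (EuclideanSpace.single j 1) • radialKernel n g x)) := by
    refine tendsto_integral_of_dominated_convergence
      (fun x => ‖fderiv ℝ φ x (EuclideanSpace.single j 1)‖ * m ‖x‖)
      (fun i => (hdC.smul (hc1 i)).aestronglyMeasurable)
      (hmi.integrable_smul_left_of_hasCompactSupport hdC.norm hdc.norm) (fun i => ?_) ?_
    · filter_upwards [hne] with x hx
      rw [norm_smul]
      gcongr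
      exact (bg _ (hs0 i x)).trans (hmono (norm_pos_iff.2 hx) (hsx i x))
    · filter_upwards [hne] with x hx
      rw [radialKernel_of_ne hx]
      exact (((hg _ (norm_pos_iff.2 hx)).continuousAt.tendsto).comp (hsl x)).const_smul _
  have lim2 : Tendsto (fun i => ∫ x, φ x • (g' (s i x) * ((x j / s i x : ℝ) : ℂ))) atTop
      (𝓝 (∫ x, φ x • radialPartial g' j x)) := by
    refine tendsto_integral_of_dominated_convergence (fun x => ‖φ x‖ * m ‖x‖)
      (fun i => (h1.continuous.smul (hc2 i)).aestronglyMeasurable)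
      (hmi.integrable_smul_left_of_hasCompactSupport h1.continuous.norm h2.norm) (fun i => ?_) ?_
    · filter_upwards [hne] with x hx
      rw [norm_smul, norm_mul, norm_real, Real.norm_eq_abs (x j / s i x)]
      gcongr
      refine (mul_le_of_le_one_right (norm_nonneg _) (abs_coord_div_le_one (hsx i x) j)).trans ?_
      exact (bg' _ (hs0 i x)).trans (hmono (norm_pos_iff.2 hx) (hsx i x))
    · filter_upwards [hne] with x hx
      have hx0 := norm_pos_iff.2 hx
      refine Tendsto.const_smul (Tendsto.mul ?_ ?_) _
      · exact ((hg'.continuousAt (Ioi_mem_nhds hx0)).tendsto).comp (hsl x)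
      · exact (continuous_ofReal.tendsto _).comp (tendsto_const_nhds.div (hsl x) hx0.ne')
  refine tendsto_nhds_unique lim1 ?_
  simp only [ibp]
  exact lim2.neg

/-- On compact sets the Lebesgue measure is bounded by the weighted one. -/
theorem exists_restrict_le_smul_weightedVolume (σ : ℝ) {K : Set (EuclideanSpace ℝ (Fin n))}
    (hK : IsCompact K) : ∃ c : ℝ≥0, volume.restrict K ≤ c • weightedVolume n σ := by
  have hc : Continuous fun x : EuclideanSpace ℝ (Fin n) => (1 + ‖x‖ ^ 2) ^ (-σ) :=
    Continuous.rpow_const (by fun_prop) fun x => Or.inl (by positivity)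
  obtain ⟨M, hM⟩ := hK.exists_bound_of_continuousOn hc.continuousOn
  refine ⟨M.toNNReal, Measure.le_iff.2 fun s hs => ?_⟩
  rw [Measure.restrict_apply hs, Measure.smul_apply, weightedVolume, withDensity_apply _ hs,
    ENNReal.smul_def, smul_eq_mul, ← lintegral_const_mul' _ _ ENNReal.coe_ne_top,
    ← setLIntegral_one]
  have hle : volume.restrict (s ∩ K) ≤ volume.restrict s :=
    Measure.restrict_mono inter_subset_left le_rfl
  refine le_trans (setLIntegral_mono' (hs.inter hK.measurableSet) fun x hx => ?_)
    (lintegral_mono' hle le_rfl)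
  rw [← ENNReal.ofReal_coe_nnreal, ← ENNReal.ofReal_mul (by positivity), ← ENNReal.ofReal_one]
  refine ENNReal.ofReal_le_ofReal ?_
  have h1 : (1 + ‖x‖ ^ 2) ^ (-σ) ≤ (M.toNNReal : ℝ) :=
    (le_abs_self _).trans ((hM x hx.2).trans (Real.le_coe_toNNReal M))
  have h2 : (1 + ‖x‖ ^ 2) ^ (-σ) * (1 + ‖x‖ ^ 2) ^ σ = 1 := by
    rw [← Real.rpow_add (by positivity)]
    simp
  exact h2.symm.le.trans (mul_le_mul_of_nonneg_right h1 (by positivity))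

theorem memLocalLp_of_memLp_weightedVolume {F : Type} [NormedAddCommGroup F] {σ : ℝ}
    {f : EuclideanSpace ℝ (Fin n) → F} {p : ℝ≥0∞} (hf : MemLp f p (weightedVolume n σ)) :
    MemLocalLp f p := fun K hK => by
  obtain ⟨c, hc⟩ := exists_restrict_le_smul_weightedVolume σ hK
  exact hf.of_measure_le_smul ENNReal.coe_ne_top hc

/-- The hypothesis for Fubini in `HasWeakPartial.convolution`: on the compact support of χ the
weight is harmless, and Cauchy–Schwarz pairs χ with the L² output of the kernel. -/
theorem IsL2Kernel.integrable_prod {δ : ℝ}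
    {k : EuclideanSpace ℝ (Fin n) → EuclideanSpace ℝ (Fin n) → ℂ} {D : ℝ≥0}
    (h : IsL2Kernel (weightedVolume n δ) volume k D) {χ : EuclideanSpace ℝ (Fin n) → ℝ}
    (hχ : Continuous χ) (hχc : HasCompactSupport χ)
    (ψ : Lp ℂ 2 (volume : Measure (EuclideanSpace ℝ (Fin n)))) :
    Integrable (fun p : EuclideanSpace ℝ (Fin n) × EuclideanSpace ℝ (Fin n) =>
      χ p.1 • (k p.1 p.2 * ψ p.2)) (volume.prod volume) := by
  have hψ : Measurable (ψ : EuclideanSpace ℝ (Fin n) → ℂ) := (Lp.stronglyMeasurable ψ).measurable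
  have hkm : Measurable fun p : EuclideanSpace ℝ (Fin n) × EuclideanSpace ℝ (Fin n) =>
      k p.1 p.2 * ψ p.2 := h.measurable.mul (hψ.comp measurable_snd)
  have hm : Measurable fun p : EuclideanSpace ℝ (Fin n) × EuclideanSpace ℝ (Fin n) =>
      χ p.1 • (k p.1 p.2 * ψ p.2) := (hχ.measurable.comp measurable_fst).smul hkm
  refine ⟨hm.aestronglyMeasurable, ?_⟩
  rw [HasFiniteIntegral, lintegral_prod _ hm.enorm.aemeasurable]
  have mF : Measurable fun x => ∫⁻ y, ‖k x y‖ₑ * ‖ψ y‖ₑ :=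
    Measurable.lintegral_prod_right' (f := fun p : EuclideanSpace ℝ (Fin n) ×
      EuclideanSpace ℝ (Fin n) => ‖k p.1 p.2‖ₑ * ‖ψ p.2‖ₑ)
      (h.measurable.enorm.mul (hψ.enorm.comp measurable_snd))
  obtain ⟨c, hc⟩ := exists_restrict_le_smul_weightedVolume δ hχc
  have e1 : ∀ x, ∫⁻ y, ‖χ x • (k x y * ψ y)‖ₑ = ‖χ x‖ₑ * ∫⁻ y, ‖k x y‖ₑ * ‖ψ y‖ₑ := fun x => by
    simp_rw [enorm_smul, enorm_mul]
    exact lintegral_const_mul' _ _ enorm_ne_top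
  simp_rw [e1]
  have e2 : ∫⁻ x, ‖χ x‖ₑ * ∫⁻ y, ‖k x y‖ₑ * ‖ψ y‖ₑ
      = ∫⁻ x in tsupport χ, ‖χ x‖ₑ * ∫⁻ y, ‖k x y‖ₑ * ‖ψ y‖ₑ := by
    rw [setLIntegral_eq_of_support_subset]
    intro x hx
    refine subset_tsupport χ fun h0 => hx ?_
    simp [h0]
  rw [e2]
  have h2 : ∫⁻ y, ‖ψ y‖ₑ ^ 2 < ⊤ := by
    rw [← eLpNorm_two_sq]
    exact ENNReal.pow_lt_top (Lp.eLpNorm_lt_top ψ)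
  have h3 := (h.lintegral_sq_le (fun y => ‖ψ y‖ₑ) hψ.enorm).trans_lt
    (ENNReal.mul_lt_top (by simp) h2)
  have h4 : ∫⁻ x in tsupport χ, (∫⁻ y, ‖k x y‖ₑ * ‖ψ y‖ₑ) ^ 2 < ⊤ := by
    refine lt_of_le_of_lt (lintegral_mono' hc le_rfl) ?_
    rw [lintegral_smul_measure]
    exact ENNReal.mul_lt_top ENNReal.coe_lt_top h3
  have h5 : ∫⁻ x in tsupport χ, ‖χ x‖ₑ ^ 2 < ⊤ := by
    rw [← eLpNorm_two_sq]
    exact ENNReal.pow_lt_top ((hχ.memLp_of_hasCompactSupport hχc).restrict _).2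
  have h6 := (lintegral_mul_sq_le (ν := volume.restrict (tsupport χ)) (fun x => ‖χ x‖ₑ)
    (fun x => ∫⁻ y, ‖k x y‖ₑ * ‖ψ y‖ₑ) hχ.measurable.enorm.aemeasurable mF.aemeasurable).trans_lt
    (ENNReal.mul_lt_top h5 h4)
  by_contra hcon
  rw [not_lt, top_le_iff] at hcon
  simp [hcon] at h6

/-- A weak derivative of the kernel is a weak derivative of the convolution. -/
theorem HasWeakPartial.convolution {δ σ : ℝ} {K dK : EuclideanSpace ℝ (Fin n) → ℂ} {j : Fin n}
    (hK : HasWeakPartial j K dK) {D D' : ℝ≥0}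
    (h : IsL2Kernel (weightedVolume n σ) volume (weightedKernel K δ) D)
    (h' : IsL2Kernel (weightedVolume n σ) volume (weightedKernel dK δ) D')
    (ψ : Lp ℂ 2 (volume : Measure (EuclideanSpace ℝ (Fin n)))) :
    HasWeakPartial j (h.toCLM ψ) (h'.toCLM ψ) := by
  have hac := volume_ac_weightedVolume n σ
  refine ⟨(memLocalLp_of_memLp_weightedVolume (Lp.memLp _)).locallyIntegrable one_le_two,
    (memLocalLp_of_memLp_weightedVolume (Lp.memLp _)).locallyIntegrable one_le_two,
    fun φ h1 h2 => ?_⟩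
  have hdc : HasCompactSupport fun x => fderiv ℝ φ x (EuclideanSpace.single j 1) :=
    h2.fderiv_apply ℝ _
  have hdC : Continuous fun x => fderiv ℝ φ x (EuclideanSpace.single j 1) :=
    (h1.continuous_fderiv (by simp)).clm_apply continuous_const
  -- After Fubini and the translation x = z + y the inner integral tests the kernel alone against a
  -- translate of χ. The weight depends only on y and stays outside.
  have key : ∀ {k : EuclideanSpace ℝ (Fin n) → ℂ} {E : ℝ≥0}
      (hk : IsL2Kernel (weightedVolume n σ) volume (weightedKernel k δ) E)
      {χ : EuclideanSpace ℝ (Fin n) → ℝ}, Continuous χ → HasCompactSupport χ →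
      ∫ x, χ x • hk.toCLM ψ x = ∫ y, (((1 + ‖y‖ ^ 2) ^ (-(δ / 2)) : ℝ) * ψ y)
        * ∫ z, χ (z + y) • k z := fun {k E} hk {χ} hχ hχc => by
    have e1 : ∫ x, χ x • hk.toCLM ψ x = ∫ x, ∫ y, χ x • (weightedKernel k δ x y * ψ y) := by
      refine integral_congr_ae ?_
      filter_upwards [hac.ae_le (hk.coeFn_toCLM ψ)] with x hx
      rw [hx, ← integral_smul]
    rw [e1, integral_integral_swap (hk.integrable_prod hχ hχc ψ)]
    refine integral_congr_ae (Eventually.of_forall fun y => ?_)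
    simp only
    rw [← integral_const_mul, ← integral_add_right_eq_self _ y]
    refine integral_congr_ae (Eventually.of_forall fun x => ?_)
    simp only [weightedKernel, add_sub_cancel_right, real_smul]
    ring
  rw [key h hdC hdc, key h' h1.continuous h2, ← integral_neg]
  refine integral_congr_ae (Eventually.of_forall fun y => ?_)
  simp only
  have ht := hK.2.2 (fun z => φ (z + y)) (h1.comp (contDiff_id.add contDiff_const))
    (h2.comp_homeomorph (Homeomorph.addRight y))
  simp only [fderiv_comp_add_right] at ht
  rw [ht]
  ring

end GreenGradient

/-! ### The outgoing resolvent as a compact operator into the weighted Sobolev space. -/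

section GreenOperator

open scoped NNReal Topology
open Filter Set

variable {n : ℕ}

/-- This functional is the inner product of the weighted space with (1+|x|²)^{-σ} χ, the factor that
undoes the density of the measure. -/
theorem continuous_integral_test_smul {σ : ℝ} {χ : EuclideanSpace ℝ (Fin n) → ℝ}
    (hχ : Continuous χ) (hχc : HasCompactSupport χ) :
    Continuous fun f : Lp ℂ 2 (weightedVolume n σ) => ∫ x, χ x • f x := by
  have hc : Continuous fun x : EuclideanSpace ℝ (Fin n) =>
      (((1 + ‖x‖ ^ 2) ^ (-σ) * χ x : ℝ) : ℂ) :=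
    continuous_ofReal.comp ((Continuous.rpow_const (by fun_prop)
      fun x => Or.inl (by positivity)).mul hχ)
  have hcs : HasCompactSupport fun x : EuclideanSpace ℝ (Fin n) =>
      (((1 + ‖x‖ ^ 2) ^ (-σ) * χ x : ℝ) : ℂ) := by
    refine hχc.mono fun x hx h0 => hx ?_
    simp [h0]
  have hloc : IsLocallyFiniteMeasure (weightedVolume n σ) :=
    IsLocallyFiniteMeasure.withDensity_ofReal (Continuous.rpow_const (by fun_prop)
      fun x => Or.inl (by positivity))
  have hm : MemLp (fun x : EuclideanSpace ℝ (Fin n) => (((1 + ‖x‖ ^ 2) ^ (-σ) * χ x : ℝ) : ℂ)) 2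
      (weightedVolume n σ) := hc.memLp_of_hasCompactSupport hcs
  have e : (fun f : Lp ℂ 2 (weightedVolume n σ) => ∫ x, χ x • f x)
      = fun f => inner ℂ (hm.toLp _) f := by
    funext f
    rw [L2.inner_def]
    have e1 : ∫ x, inner ℂ (hm.toLp _ x) (f x) ∂weightedVolume n σ
        = ∫ x, ((1 + ‖x‖ ^ 2) ^ (-σ) * χ x : ℝ) • f x ∂weightedVolume n σ := by
      refine integral_congr_ae ?_
      filter_upwards [hm.coeFn_toLp] with x hx
      rw [hx]
      simp [mul_comm]
    have e2 : ∀ g : EuclideanSpace ℝ (Fin n) → ℂ, ∫ x, g x ∂weightedVolume n σ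
        = ∫ x, (ENNReal.ofReal ((1 + ‖x‖ ^ 2) ^ σ)).toReal • g x :=
      integral_withDensity_eq_integral_toReal_smul (measurable_bracket σ).ennreal_ofReal (by simp)
    rw [e1, e2]
    refine integral_congr_ae (Eventually.of_forall fun x => ?_)
    have h0 : (0 : ℝ) < 1 + ‖x‖ ^ 2 := by positivity
    simp only
    rw [ENNReal.toReal_ofReal (by positivity), smul_smul, ← mul_assoc, ← Real.rpow_add h0]
    simp
  rw [e]
  exact continuous_const.inner continuous_id

/-- Local integrability is automatic in the weighted L² spaces, so membership is an intersection of
equations between continuous functionals. Closedness lets a compact operator be restricted to this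
codomain. -/
theorem isClosed_weightedH1 (n : ℕ) (σ : ℝ) :
    IsClosed (WeightedH1 n σ : Set (WithLp 2 (Lp ℂ 2 (weightedVolume n σ) ×
      Lp (EuclideanSpace ℂ (Fin n)) 2 (weightedVolume n σ)))) := by
  have hac := volume_ac_weightedVolume n σ
  have e : (WeightedH1 n σ : Set (WithLp 2 (Lp ℂ 2 (weightedVolume n σ) ×
      Lp (EuclideanSpace ℂ (Fin n)) 2 (weightedVolume n σ))))
      = ⋂ (j : Fin n) (φ : EuclideanSpace ℝ (Fin n) → ℝ) (_ : ContDiff ℝ ∞ φ)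
        (_ : HasCompactSupport φ), {f | ∫ x, fderiv ℝ φ x (EuclideanSpace.single j 1) • f.fst x
          = -∫ x, φ x • (EuclideanSpace.proj (𝕜 := ℂ) j).compLpL 2 (weightedVolume n σ) f.snd x} := by
    ext f
    have hj : ∀ j : Fin n, (EuclideanSpace.proj (𝕜 := ℂ) j).compLpL 2 (weightedVolume n σ) f.snd
        =ᵐ[volume] fun x => f.snd x j := fun j =>
      hac.ae_le (ContinuousLinearMap.coeFn_compLpL _ f.snd)
    have hi : ∀ (j : Fin n) (φ : EuclideanSpace ℝ (Fin n) → ℝ),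
        ∫ x, φ x • (EuclideanSpace.proj (𝕜 := ℂ) j).compLpL 2 (weightedVolume n σ) f.snd x
          = ∫ x, φ x • f.snd x j := fun j φ => by
      refine integral_congr_ae ?_
      filter_upwards [hj j] with x hx
      rw [hx]
    simp only [mem_iInter, mem_ofPred_eq, hi]
    refine ⟨fun h j φ h1 h2 => (h j).2.2 φ h1 h2, fun h j => ⟨?_, ?_, h j⟩⟩
    · exact (memLocalLp_of_memLp_weightedVolume (Lp.memLp f.fst)).locallyIntegrable one_le_two
    · exact ((memLocalLp_of_memLp_weightedVolume (Lp.memLp _)).locallyIntegrable one_le_two).congr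
        (hj j)
  rw [e]
  refine isClosed_iInter fun j => isClosed_iInter fun φ => isClosed_iInter fun h1 =>
    isClosed_iInter fun h2 => isClosed_eq ?_ ?_
  · exact (continuous_integral_test_smul ((h1.continuous_fderiv (by simp)).clm_apply
      continuous_const) (h2.fderiv_apply ℝ _)).comp (WithLp.fstL 2 ℂ _ _).continuous
  · exact ((continuous_integral_test_smul h1.continuous h2).comp
      (((EuclideanSpace.proj (𝕜 := ℂ) j).compLpL 2 (weightedVolume n σ)).continuous.comp
        (WithLp.sndL 2 ℂ _ _).continuous)).neg

theorem isCompactOperator_finset_sum {E F ι : Type*} [NormedAddCommGroup E] [NormedSpace ℂ E]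
    [NormedAddCommGroup F] [NormedSpace ℂ F] (s : Finset ι) {T : ι → E →L[ℂ] F}
    (hT : ∀ i, IsCompactOperator (T i)) : IsCompactOperator (∑ i ∈ s, T i : E →L[ℂ] F) := by
  classical
  induction s using Finset.induction_on with
  | empty => simpa using isCompactOperator_zero
  | insert i s hi ih =>
    rw [Finset.sum_insert hi]
    exact (hT i).add ih

theorem IsCompactOperator.prod_clm {E F G : Type*} [NormedAddCommGroup E] [NormedSpace ℂ E]
    [NormedAddCommGroup F] [NormedSpace ℂ F] [NormedAddCommGroup G] [NormedSpace ℂ G]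
    {S : E →L[ℂ] F} {T : E →L[ℂ] G} (hS : IsCompactOperator S) (hT : IsCompactOperator T) :
    IsCompactOperator (S.prod T) := by
  have e : (⇑(S.prod T)) = (ContinuousLinearMap.inl ℂ F G ∘ S)
      + (ContinuousLinearMap.inr ℂ F G ∘ T) := by
    funext x
    simp
  rw [e]
  exact (hS.clm_comp (ContinuousLinearMap.inl ℂ F G)).add
    (hT.clm_comp (ContinuousLinearMap.inr ℂ F G))

theorem coeFn_sum_compLpL_single {σ : ℝ} (f : Fin n → Lp ℂ 2 (weightedVolume n σ)) :
    ∀ᵐ x, ∀ i, (∑ j, (ContinuousLinearMap.toSpanSingleton ℂ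
      (EuclideanSpace.single j (1 : ℂ))).compLpL 2 (weightedVolume n σ) (f j) :
        Lp (EuclideanSpace ℂ (Fin n)) 2 (weightedVolume n σ)) x i = f i x := by
  have hac := volume_ac_weightedVolume n σ
  have h1 : ∀ᵐ x ∂weightedVolume n σ, ∀ j, ((ContinuousLinearMap.toSpanSingleton ℂ
      (EuclideanSpace.single j (1 : ℂ))).compLpL 2 (weightedVolume n σ) (f j)) x
        = f j x • EuclideanSpace.single j (1 : ℂ) :=
    ae_all_iff.2 fun j => ContinuousLinearMap.coeFn_compLpL (ContinuousLinearMap.toSpanSingleton ℂ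
      (EuclideanSpace.single j (1 : ℂ))) (f j)
  filter_upwards [hac.ae_le h1, hac.ae_le (Lp.coeFn_fun_finsetSum Finset.univ fun j =>
    (ContinuousLinearMap.toSpanSingleton ℂ (EuclideanSpace.single j (1 : ℂ))).compLpL 2
      (weightedVolume n σ) (f j))] with x hx hs i
  rw [hs]
  simp [hx, Pi.single_apply]

/-- Convolution with the outgoing fundamental solution is compact from `L²_δ` to `H¹_{-δ}` if
`δ > 1`. The function in `L²_δ` is represented by its product with `⟨y⟩^δ`. -/
theorem exists_greenOperator (hn : n = 2 ∨ n = 3) {k : ℝ} (hk : k ≠ 0) {δ : ℝ} (hδ : 1 < δ) :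
    ∃ T : Lp ℂ 2 (volume : Measure (EuclideanSpace ℝ (Fin n))) →L[ℂ] WeightedH1 n (-δ),
      IsCompactOperator T ∧ ∀ ψ, ∀ᵐ x : EuclideanSpace ℝ (Fin n),
        Integrable (fun y => outgoingGreen n k ‖x - y‖
          * ((((1 + ‖y‖ ^ 2) ^ (-(δ / 2)) : ℝ) : ℂ) * ψ y)) ∧
        h1Fun (T ψ) x = ∫ y, outgoingGreen n k ‖x - y‖
          * ((((1 + ‖y‖ ^ 2) ^ (-(δ / 2)) : ℝ) : ℂ) * ψ y) := by
  have hn0 : 0 < n := by rcases hn with rfl | rfl <;> norm_num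
  have hn1 : (2 : ℝ) ≤ n := by rcases hn with rfl | rfl <;> norm_num
  obtain ⟨g', C, hC, hg, hg', bg, bg'⟩ := exists_deriv_outgoingGreen hn hk
  set g := outgoingGreen n k with hgdef
  have hgc : ContinuousOn g (Ioi 0) := fun r hr => (hg r hr).continuousAt.continuousWithinAt
  have hle : ∀ r : ℝ, 0 < r → r ^ (-(((n : ℝ) - 1) / 2)) ≤ r ^ (-((n : ℝ) - 1)) + 1 := fun r hr => by
    rcases le_total r 1 with h | h
    · have := Real.rpow_le_rpow_of_exponent_ge hr h
        (show -((n : ℝ) - 1) ≤ -(((n : ℝ) - 1) / 2) by linarith)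
      linarith
    · have := Real.rpow_le_one_of_one_le_of_nonpos h
        (show -(((n : ℝ) - 1) / 2) ≤ 0 by linarith)
      have h2 : 0 ≤ r ^ (-((n : ℝ) - 1)) := by positivity
      linarith
  have hm0 : 0 ≤ C * ((0 : ℝ) ^ (-((n : ℝ) - 1)) + (0 : ℝ) ^ (-(((n : ℝ) - 1) / 2))) := by
    positivity
  have bg1 : ∀ r, 0 < r → ‖g r‖ ≤ C * (r ^ (-((n : ℝ) - 1)) + r ^ (-(((n : ℝ) - 1) / 2))) :=
    fun r hr => (bg r hr).trans (mul_le_mul_of_nonneg_left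
      (le_add_of_nonneg_left (by positivity)) hC)
  have hW : ∀ j, HasWeakPartial j (radialKernel n g) (radialPartial g' j) :=
    hasWeakPartial_radialKernel hn0 (C := 2 * C) (by positivity) hg hg'
      (fun r hr => (bg r hr).trans (by nlinarith [hle r hr, Real.rpow_pos_of_pos hr (-((n : ℝ) - 1))]))
      (fun r hr => (bg' r hr).trans (by nlinarith [hle r hr]))
  obtain ⟨D, h0, c0⟩ := exists_isCompactOperator_weightedKernel hn hδ
    (measurable_radialKernel hgc) hC (norm_radialKernel_le bg1 hm0)
  choose D' h' c' using fun j => exists_isCompactOperator_weightedKernel hn hδ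
    (measurable_radialPartial hg' j) hC (norm_radialPartial_le bg' hm0 j)
  let G : Lp ℂ 2 (volume : Measure (EuclideanSpace ℝ (Fin n))) →L[ℂ]
      Lp (EuclideanSpace ℂ (Fin n)) 2 (weightedVolume n (-δ)) :=
    ∑ j, ((ContinuousLinearMap.toSpanSingleton ℂ (EuclideanSpace.single j (1 : ℂ))).compLpL 2
      (weightedVolume n (-δ))).comp (h' j).toCLM
  have cG : IsCompactOperator G := isCompactOperator_finset_sum _ fun j =>
    (c' j).clm_comp ((ContinuousLinearMap.toSpanSingleton ℂ
      (EuclideanSpace.single j (1 : ℂ))).compLpL 2 (weightedVolume n (-δ)))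
  let P : Lp ℂ 2 (volume : Measure (EuclideanSpace ℝ (Fin n))) →L[ℂ]
      WithLp 2 (Lp ℂ 2 (weightedVolume n (-δ)) ×
        Lp (EuclideanSpace ℂ (Fin n)) 2 (weightedVolume n (-δ))) :=
    (WithLp.prodContinuousLinearEquiv 2 ℂ (Lp ℂ 2 (weightedVolume n (-δ)))
      (Lp (EuclideanSpace ℂ (Fin n)) 2 (weightedVolume n (-δ)))).symm.toContinuousLinearMap.comp
        (h0.toCLM.prod G)
  have cP : IsCompactOperator P := (c0.prod_clm cG).clm_comp
    (WithLp.prodContinuousLinearEquiv 2 ℂ (Lp ℂ 2 (weightedVolume n (-δ)))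
      (Lp (EuclideanSpace ℂ (Fin n)) 2 (weightedVolume n (-δ)))).symm.toContinuousLinearMap
  have hP : ∀ ψ, P ψ ∈ WeightedH1 n (-δ) := fun ψ j => by
    refine ((hW j).convolution h0 (h' j) ψ).congr (ae_eq_refl _) ?_
    have e : (P ψ).snd = ∑ j, (ContinuousLinearMap.toSpanSingleton ℂ
        (EuclideanSpace.single j (1 : ℂ))).compLpL 2 (weightedVolume n (-δ)) ((h' j).toCLM ψ) := by
      simp [P, G]
    rw [e]
    filter_upwards [coeFn_sum_compLpL_single fun j => (h' j).toCLM ψ] with x hx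
    exact (hx j).symm
  refine ⟨P.codRestrict _ hP, cP.codRestrict hP (isClosed_weightedH1 n (-δ)), fun ψ => ?_⟩
  have hac := volume_ac_weightedVolume n (-δ)
  have : Nonempty (Fin n) := ⟨⟨0, hn0⟩⟩
  filter_upwards [hac.ae_le (h0.ae_integrable ψ), hac.ae_le (h0.coeFn_toCLM ψ)] with x hx1 hx2
  -- `radialKernel` is set to zero at the origin, so the two integrands may differ at y = x, a null
  -- set.
  have hne : ∀ᵐ y, weightedKernel (radialKernel n g) δ x y * ψ y
      = g ‖x - y‖ * ((((1 + ‖y‖ ^ 2) ^ (-(δ / 2)) : ℝ) : ℂ) * ψ y) := by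
    filter_upwards [Measure.ae_ne volume x] with y hy
    rw [weightedKernel, radialKernel_of_ne (sub_ne_zero.2 hy.symm), mul_assoc]
  refine ⟨hx1.congr hne, ?_⟩
  rw [← integral_congr_ae hne]
  exact hx2

end GreenOperator

/-! ### First order operators with decaying coefficients. -/

section PotentialOperator

open scoped NNReal Topology
open Filter Set

variable {n : ℕ}

theorem eLpNorm_bracket_mul_le (δ : ℝ) {g : EuclideanSpace ℝ (Fin n) → ℂ} (hg : Measurable g) :
    eLpNorm (fun x => (1 + ‖x‖ ^ 2) ^ (-(δ / 2)) * ‖g x‖) 2 volume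
      ≤ eLpNorm g 2 (weightedVolume n (-δ)) := by
  rw [← ENNReal.pow_le_pow_left_iff two_ne_zero, eLpNorm_two_sq, eLpNorm_two_sq,
    lintegral_weightedVolume _ (hg.enorm.pow_const 2)]
  refine lintegral_mono fun x => le_of_eq ?_
  have h0 : (0 : ℝ) < 1 + ‖x‖ ^ 2 := by positivity
  rw [enorm_mul, mul_pow, enorm_norm, Real.enorm_of_nonneg (by positivity),
    ← ENNReal.ofReal_pow (by positivity), ← Real.rpow_natCast, ← Real.rpow_mul h0.le]
  congr 3
  push_cast
  ring

/-- Multiplication by a function bounded by `C ⟨x⟩^{-2δ}` maps `L²_{-δ}` to `L²_δ`. -/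
theorem eLpNorm_bracket_mul_mul_le {δ : ℝ} {w g : EuclideanSpace ℝ (Fin n) → ℂ} {C : ℝ≥0}
    {S : Set (EuclideanSpace ℝ (Fin n))} (hg : Measurable g)
    (hw : ∀ᵐ x ∂volume.restrict S, ‖w x‖ ≤ C * (1 + ‖x‖ ^ 2) ^ (-δ)) :
    eLpNorm (fun x => (((1 + ‖x‖ ^ 2) ^ (δ / 2) : ℝ) : ℂ) * (w x * g x)) 2 (volume.restrict S)
      ≤ C * eLpNorm g 2 (weightedVolume n (-δ)) := by
  refine (eLpNorm_le_nnreal_smul_eLpNorm_of_ae_le_mul (c := C)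
    (g := fun x => (1 + ‖x‖ ^ 2) ^ (-(δ / 2)) * ‖g x‖) ?_ 2).trans ?_
  · filter_upwards [hw] with x hx
    have h0 : (0 : ℝ) < 1 + ‖x‖ ^ 2 := by positivity
    rw [← NNReal.coe_le_coe]
    push_cast
    rw [norm_mul, norm_mul, norm_mul, norm_real, Real.norm_of_nonneg (by positivity),
      Real.norm_of_nonneg (by positivity), norm_norm]
    have e : (1 + ‖x‖ ^ 2) ^ (-(δ / 2)) = (1 + ‖x‖ ^ 2) ^ (δ / 2) * (1 + ‖x‖ ^ 2) ^ (-δ) := by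
      rw [← Real.rpow_add h0]
      congr 1
      ring
    rw [e]
    calc (1 + ‖x‖ ^ 2) ^ (δ / 2) * (‖w x‖ * ‖g x‖)
        ≤ (1 + ‖x‖ ^ 2) ^ (δ / 2) * ((C * (1 + ‖x‖ ^ 2) ^ (-δ)) * ‖g x‖) := by gcongr
      _ = _ := by ring
  · rw [ENNReal.smul_def, smul_eq_mul]
    exact mul_le_mul_right ((eLpNorm_mono_measure _ Measure.restrict_le_self).trans
      (eLpNorm_bracket_mul_le δ hg)) _

theorem measurable_h1Fun {σ : ℝ} (f : WeightedH1 n σ) : Measurable (h1Fun f) :=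
  (Lp.stronglyMeasurable f.1.fst).measurable

theorem measurable_h1Grad {σ : ℝ} (f : WeightedH1 n σ) (j : Fin n) :
    Measurable fun x => h1Grad f x j :=
  (EuclideanSpace.proj (𝕜 := ℂ) j).continuous.measurable.comp
    (Lp.stronglyMeasurable f.1.snd).measurable

theorem eLpNorm_h1Fun_le {σ : ℝ} (f : WeightedH1 n σ) :
    eLpNorm (h1Fun f) 2 (weightedVolume n σ) ≤ ‖f‖ₑ := by
  have h := WithLp.norm_fst_le _ f.1
  rw [← enorm_le_iff_norm_le, Lp.enorm_def] at h
  exact h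

theorem eLpNorm_h1Grad_le {σ : ℝ} (f : WeightedH1 n σ) (j : Fin n) :
    eLpNorm (fun x => h1Grad f x j) 2 (weightedVolume n σ) ≤ ‖f‖ₑ := by
  have h := WithLp.norm_snd_le _ f.1
  rw [← enorm_le_iff_norm_le, Lp.enorm_def] at h
  exact (eLpNorm_mono fun x => PiLp.norm_apply_le _ j).trans h

theorem memLocalLp_h1Fun {σ : ℝ} (f : WeightedH1 n σ) : MemLocalLp (h1Fun f) 2 :=
  memLocalLp_of_memLp_weightedVolume (Lp.memLp f.1.fst)

theorem memLocalLp_h1Grad {σ : ℝ} (f : WeightedH1 n σ) (j : Fin n) :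
    MemLocalLp (fun x => h1Grad f x j) 2 :=
  memLocalLp_of_memLp_weightedVolume (σ := σ) ⟨(measurable_h1Grad f j).aestronglyMeasurable,
    (eLpNorm_h1Grad_le f j).trans_lt enorm_lt_top⟩

/-- Multiplication by an `L^p_loc` function that decays like `⟨x⟩^{-2δ}` maps `H¹_{-δ}` to
`L²_δ`. -/
theorem exists_eLpNorm_bracket_mul_h1Fun_le {p : ℝ≥0∞} (hnp : (n = 2 ∧ 2 < p) ∨ (n = 3 ∧ 3 ≤ p))
    {B : EuclideanSpace ℝ (Fin n) → ℂ} (hB : MemLocalLp B p) {δ R : ℝ} (hδ : 0 ≤ δ) {C : ℝ≥0}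
    (hBC : ∀ᵐ x, R ≤ ‖x‖ → ‖B x‖ ≤ C * (1 + ‖x‖ ^ 2) ^ (-δ)) :
    ∃ D : ℝ≥0, ∀ f : WeightedH1 n (-δ),
      eLpNorm (fun x => (((1 + ‖x‖ ^ 2) ^ (δ / 2) : ℝ) : ℂ) * (B x * h1Fun f x)) 2 volume
        ≤ D * ‖f‖ₑ := by
  obtain ⟨A, hA⟩ := exists_eLpNorm_mul_le hnp hB R
  obtain ⟨c, hc⟩ := exists_restrict_le_smul_weightedVolume (n := n) (-δ)
    (isCompact_closedBall 0 (|R| + 2))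
  -- A factor `c` between measures becomes its square root between L² norms.
  have hc2 : ∀ g : EuclideanSpace ℝ (Fin n) → ℂ,
      eLpNorm g 2 (volume.restrict (Metric.closedBall 0 (|R| + 2)))
        ≤ (c ^ (2 : ℝ)⁻¹ : ℝ≥0) * eLpNorm g 2 (weightedVolume n (-δ)) := fun g => by
    refine (eLpNorm_mono_measure g hc).trans (le_of_eq ?_)
    rw [eLpNorm_smul_measure_of_ne_top' (by norm_num)]
    simp [ENNReal.smul_def]
  set M : ℝ≥0 := ((1 + R ^ 2) ^ (δ / 2)).toNNReal with hM
  set b : ℝ≥0 := c ^ (2 : ℝ)⁻¹ with hb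
  -- `C` serves outside the ball. Inside, `M` bounds the weight, `A` is the multiplication constant,
  -- and `b` converts the norms of f and of its n partial derivatives to the weighted space.
  refine ⟨C + M * (A * (b + n * b)), fun f => ?_⟩
  set F : EuclideanSpace ℝ (Fin n) → ℂ :=
    fun x => (((1 + ‖x‖ ^ 2) ^ (δ / 2) : ℝ) : ℂ) * (B x * h1Fun f x) with hF
  set S : Set (EuclideanSpace ℝ (Fin n)) := Metric.closedBall 0 R with hS
  have hSm : MeasurableSet S := measurableSet_closedBall
  have mF : AEStronglyMeasurable F :=
    (measurable_ofReal.comp (measurable_bracket _)).aestronglyMeasurable.mul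
      (hB.aestronglyMeasurable.mul (measurable_h1Fun f).aestronglyMeasurable)
  have hout : eLpNorm F 2 (volume.restrict Sᶜ) ≤ C * ‖f‖ₑ := by
    refine (eLpNorm_bracket_mul_mul_le (measurable_h1Fun f) ?_).trans
      (mul_le_mul_right (eLpNorm_h1Fun_le f) _)
    filter_upwards [ae_restrict_of_ae hBC, ae_restrict_mem hSm.compl] with x hx hxS
    refine hx ?_
    rw [hS, mem_compl_iff, mem_closedBall_zero_iff, not_le] at hxS
    exact hxS.le
  have hin : eLpNorm F 2 (volume.restrict S) ≤ M * (A * (b + n * b)) * ‖f‖ₑ := by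
    have h1 : eLpNorm F 2 (volume.restrict S)
        ≤ M • eLpNorm (fun x => B x * h1Fun f x) 2 (volume.restrict S) := by
      refine eLpNorm_le_nnreal_smul_eLpNorm_of_ae_le_mul ?_ 2
      filter_upwards [ae_restrict_mem hSm] with x hx
      rw [hS, mem_closedBall_zero_iff] at hx
      rw [← NNReal.coe_le_coe]
      push_cast
      rw [hM, Real.coe_toNNReal _ (by positivity), hF]
      simp only
      rw [norm_mul, norm_real, Real.norm_of_nonneg (by positivity)]
      gcongr
    have h2 := hA (h1Fun f) (fun j x => h1Grad f x j) f.2 (memLocalLp_h1Fun f) (memLocalLp_h1Grad f)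
    have h3 : eLpNorm (h1Fun f) 2 (volume.restrict (Metric.closedBall 0 (|R| + 2))) ≤ b * ‖f‖ₑ :=
      (hc2 _).trans (mul_le_mul_right (eLpNorm_h1Fun_le f) _)
    have h4 : ∑ j, eLpNorm (fun x => h1Grad f x j) 2
        (volume.restrict (Metric.closedBall 0 (|R| + 2))) ≤ n * (b * ‖f‖ₑ) := by
      refine (Finset.sum_le_card_nsmul _ _ (b * ‖f‖ₑ) fun j _ => (hc2 _).trans
        (mul_le_mul_right (eLpNorm_h1Grad_le f j) _)).trans (le_of_eq ?_)
      simp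
    refine h1.trans ?_
    rw [ENNReal.smul_def, smul_eq_mul]
    calc (M : ℝ≥0∞) * eLpNorm (fun x => B x * h1Fun f x) 2 (volume.restrict S)
        ≤ M * (A * (b * ‖f‖ₑ + n * (b * ‖f‖ₑ))) := by
          gcongr
          exact h2.trans (by gcongr)
      _ = _ := by ring
  have hsum : eLpNorm F 2 volume
      ≤ eLpNorm F 2 (volume.restrict Sᶜ) + eLpNorm F 2 (volume.restrict S) := by
    have e : F = Sᶜ.indicator F + S.indicator F := by
      rw [add_comm, indicator_self_add_compl]
    conv_lhs => rw [e]
    refine (eLpNorm_add_le (mF.indicator hSm.compl) (mF.indicator hSm) (by norm_num)).trans ?_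
    rw [eLpNorm_indicator_eq_eLpNorm_restrict hSm.compl, eLpNorm_indicator_eq_eLpNorm_restrict hSm]
  refine hsum.trans ((add_le_add hout hin).trans (le_of_eq ?_))
  push_cast
  ring

/-- A pointwise almost everywhere linear operation with an `L²` bound is a bounded operator. -/
theorem exists_clm_of_eLpNorm_le {H X : Type*} [NormedAddCommGroup H] [NormedSpace ℂ H]
    [MeasurableSpace X] {μ : Measure X} {A : H → X → ℂ} (hm : ∀ f, AEStronglyMeasurable (A f) μ)
    (hadd : ∀ f g, A (f + g) =ᵐ[μ] A f + A g) (hsmul : ∀ (c : ℂ) f, A (c • f) =ᵐ[μ] c • A f)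
    {C : ℝ≥0} (hb : ∀ f, eLpNorm (A f) 2 μ ≤ C * ‖f‖ₑ) :
    ∃ M : H →L[ℂ] Lp ℂ 2 μ, ∀ f, M f =ᵐ[μ] A f := by
  have hA : ∀ f, MemLp (A f) 2 μ := fun f =>
    ⟨hm f, (hb f).trans_lt (ENNReal.mul_lt_top ENNReal.coe_lt_top enorm_lt_top)⟩
  refine ⟨LinearMap.mkContinuous
    { toFun := fun f => (hA f).toLp _
      map_add' := fun f g => by
        rw [← MemLp.toLp_add]
        exact MemLp.toLp_congr _ _ (hadd f g)
      map_smul' := fun c f => by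
        rw [RingHom.id_apply, ← MemLp.toLp_const_smul]
        exact MemLp.toLp_congr _ _ (hsmul c f) } C fun f => ?_, fun f => (hA f).coeFn_toLp⟩
  simp only [LinearMap.coe_mk, AddHom.coe_mk, Lp.norm_toLp]
  have := ENNReal.toReal_mono (ENNReal.mul_ne_top (by simp) enorm_ne_top) (hb f)
  simpa using this

/-- A first order differential operator with decaying coefficients is bounded from `H¹_{-δ}` to
`L²_δ`. -/
theorem exists_firstOrderOperator {p : ℝ≥0∞} (hnp : (n = 2 ∧ 2 < p) ∨ (n = 3 ∧ 3 ≤ p))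
    {B : EuclideanSpace ℝ (Fin n) → ℂ} (hB : MemLocalLp B p) {δ R : ℝ} (hδ : 0 ≤ δ) {C : ℝ≥0}
    (hBC : ∀ᵐ x, R ≤ ‖x‖ → ‖B x‖ ≤ C * (1 + ‖x‖ ^ 2) ^ (-δ))
    {w : Fin n → EuclideanSpace ℝ (Fin n) → ℂ} (hwm : ∀ j, AEStronglyMeasurable (w j))
    {C' : ℝ≥0} (hw : ∀ j, ∀ᵐ x, ‖w j x‖ ≤ C' * (1 + ‖x‖ ^ 2) ^ (-δ)) :
    ∃ M : WeightedH1 n (-δ) →L[ℂ] Lp ℂ 2 (volume : Measure (EuclideanSpace ℝ (Fin n))),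
      ∀ f, M f =ᵐ[volume] fun x => (((1 + ‖x‖ ^ 2) ^ (δ / 2) : ℝ) : ℂ)
        * ((∑ j, w j x * h1Grad f x j) + B x * h1Fun f x) := by
  obtain ⟨D, hD⟩ := exists_eLpNorm_bracket_mul_h1Fun_le hnp hB hδ hBC
  have hac := volume_ac_weightedVolume n (-δ)
  have mbr : AEStronglyMeasurable (fun x : EuclideanSpace ℝ (Fin n) =>
      (((1 + ‖x‖ ^ 2) ^ (δ / 2) : ℝ) : ℂ)) :=
    (measurable_ofReal.comp (measurable_bracket _)).aestronglyMeasurable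
  have m1 : ∀ f : WeightedH1 n (-δ), ∀ j, AEStronglyMeasurable fun x =>
      (((1 + ‖x‖ ^ 2) ^ (δ / 2) : ℝ) : ℂ) * (w j x * h1Grad f x j) := fun f j =>
    mbr.mul ((hwm j).mul (measurable_h1Grad f j).aestronglyMeasurable)
  have m2 : ∀ f : WeightedH1 n (-δ), AEStronglyMeasurable fun x =>
      (((1 + ‖x‖ ^ 2) ^ (δ / 2) : ℝ) : ℂ) * (B x * h1Fun f x) := fun f =>
    mbr.mul (hB.aestronglyMeasurable.mul (measurable_h1Fun f).aestronglyMeasurable)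
  have m3 : ∀ f : WeightedH1 n (-δ), AEStronglyMeasurable fun x =>
      ∑ j, (((1 + ‖x‖ ^ 2) ^ (δ / 2) : ℝ) : ℂ) * (w j x * h1Grad f x j) := fun f =>
    Finset.aestronglyMeasurable_fun_sum _ fun j _ => m1 f j
  have e : ∀ f : WeightedH1 n (-δ), (fun x => (((1 + ‖x‖ ^ 2) ^ (δ / 2) : ℝ) : ℂ)
        * ((∑ j, w j x * h1Grad f x j) + B x * h1Fun f x))
      = (fun x => ∑ j, (((1 + ‖x‖ ^ 2) ^ (δ / 2) : ℝ) : ℂ) * (w j x * h1Grad f x j))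
        + fun x => (((1 + ‖x‖ ^ 2) ^ (δ / 2) : ℝ) : ℂ) * (B x * h1Fun f x) := fun f => by
    funext x
    rw [Pi.add_apply, mul_add, Finset.mul_sum]
  refine exists_clm_of_eLpNorm_le (A := fun f x => (((1 + ‖x‖ ^ 2) ^ (δ / 2) : ℝ) : ℂ)
        * ((∑ j, w j x * h1Grad f x j) + B x * h1Fun f x)) (C := n * C' + D)
    (fun f => ?_) (fun f g => ?_) (fun c f => ?_) fun f => ?_
  · rw [e]
    exact (m3 f).add (m2 f)
  · filter_upwards [hac.ae_le (Lp.coeFn_add f.1.fst g.1.fst),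
      hac.ae_le (Lp.coeFn_add f.1.snd g.1.snd)] with x h1 h2
    have h1' : h1Fun (f + g) x = h1Fun f x + h1Fun g x := h1
    have h2' : h1Grad (f + g) x = h1Grad f x + h1Grad g x := h2
    simp only [h1', h2', Pi.add_apply, PiLp.add_apply, mul_add, Finset.sum_add_distrib]
    ring
  · filter_upwards [hac.ae_le (Lp.coeFn_smul c f.1.fst),
      hac.ae_le (Lp.coeFn_smul c f.1.snd)] with x h1 h2
    have h1' : h1Fun (c • f) x = c * h1Fun f x := h1
    have h2' : h1Grad (c • f) x = c • h1Grad f x := h2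
    simp only [h1', h2', Pi.smul_apply, PiLp.smul_apply, smul_eq_mul]
    simp only [mul_add, Finset.mul_sum]
    congr 1
    · exact Finset.sum_congr rfl fun j _ => by ring
    · ring
  · rw [e]
    refine (eLpNorm_add_le (m3 f) (m2 f) (by norm_num)).trans ?_
    refine (add_le_add ((eLpNorm_fun_sum_le (by norm_num) (m1 f)).trans
      (Finset.sum_le_card_nsmul _ _ (C' * ‖f‖ₑ) fun j _ => ?_)) (hD f)).trans (le_of_eq ?_)
    · rw [← Measure.restrict_univ (μ := volume)]
      refine (eLpNorm_bracket_mul_mul_le (measurable_h1Grad f j) ?_).trans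
        (mul_le_mul_right (eLpNorm_h1Grad_le f j) _)
      rw [Measure.restrict_univ]
      exact hw j
    · simp only [Finset.card_univ, Fintype.card_fin, nsmul_eq_mul]
      push_cast
      ring

end PotentialOperator

/-! ### Coefficients of the source term and the factorization of L_k. -/

section LippmannSchwinger

open scoped NNReal Topology
open Filter Set

variable {n : ℕ}

theorem MemWeightedLp.memLocalLp {F : Type} [NormedAddCommGroup F] [NormedSpace ℝ F]
    {f : EuclideanSpace ℝ (Fin n) → F} {p : ℝ≥0∞} {σ : ℝ} (h : MemWeightedLp f p σ) :
    MemLocalLp f p := fun K hK => by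
  have hc : Continuous fun x : EuclideanSpace ℝ (Fin n) => (1 + ‖x‖ ^ 2) ^ (-(σ / 2)) :=
    Continuous.rpow_const (by fun_prop) fun x => Or.inl (by positivity)
  obtain ⟨M, hM⟩ := hK.exists_bound_of_continuousOn hc.continuousOn
  have e : ∀ x, (1 + ‖x‖ ^ 2) ^ (-(σ / 2)) • ((1 + ‖x‖ ^ 2) ^ (σ / 2) : ℝ) • f x = f x := fun x => by
    rw [smul_smul, ← Real.rpow_add (by positivity)]
    simp
  have hf : AEStronglyMeasurable f (volume.restrict K) :=
    (hc.aestronglyMeasurable.smul (h.restrict K).1).congr (Eventually.of_forall e)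
  refine (h.restrict K).of_le_mul (c := M) hf ?_
  filter_upwards [ae_restrict_mem hK.measurableSet] with x hx
  conv_lhs => rw [← e x]
  rw [norm_smul]
  exact mul_le_mul_of_nonneg_right (hM x hx) (norm_nonneg _)

theorem div_rpow_le_bracket {c r δ : ℝ} (hc : 0 ≤ c) (hδ : 0 ≤ δ) (hr : 1 ≤ r) :
    c / r ^ (2 * δ) ≤ c * 2 ^ δ * (1 + r ^ 2) ^ (-δ) := by
  have h0 : (0 : ℝ) < 1 + r ^ 2 := by positivity
  have hr0 : 0 ≤ r := by linarith
  have h1 : (1 + r ^ 2) ^ δ ≤ 2 ^ δ * r ^ (2 * δ) := by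
    rw [Real.rpow_mul hr0, ← Real.mul_rpow (by norm_num) (by positivity), Real.rpow_ofNat]
    exact Real.rpow_le_rpow h0.le (by nlinarith) hδ
  rw [Real.rpow_neg h0.le, ← div_eq_mul_inv, div_le_div_iff₀ (by positivity) (by positivity),
    mul_assoc]
  gcongr

/-- A locally bounded function that is `O(|x|^{-2δ})` at infinity is `O(⟨x⟩^{-2δ})`. -/
theorem exists_bracket_bound {F : Type} [NormedAddCommGroup F] {f : EuclideanSpace ℝ (Fin n) → F}
    (hf : MemLocalLp f ⊤) {δ c R : ℝ} (hδ : 0 ≤ δ) (hc : 0 ≤ c)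
    (h : ∀ᵐ x, R ≤ ‖x‖ → ‖f x‖ ≤ c * (1 + ‖x‖ ^ 2) ^ (-δ)) :
    ∃ C : ℝ≥0, ∀ᵐ x, ‖f x‖ ≤ C * (1 + ‖x‖ ^ 2) ^ (-δ) := by
  obtain ⟨M, hM0, hM⟩ : ∃ M : ℝ, 0 ≤ M ∧
      ∀ᵐ x ∂volume.restrict (Metric.closedBall 0 R), ‖f x‖ ≤ M := by
    have h1 := hf _ (isCompact_closedBall 0 R)
    refine ⟨(eLpNorm f ⊤ (volume.restrict (Metric.closedBall 0 R))).toReal,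
      ENNReal.toReal_nonneg, ?_⟩
    filter_upwards [ae_le_eLpNormEssSup (f := f)] with x hx
    rw [← toReal_enorm]
    exact ENNReal.toReal_mono h1.2.ne hx
  refine ⟨(M * (1 + R ^ 2) ^ δ + c).toNNReal, ?_⟩
  rw [Real.coe_toNNReal _ (by positivity)]
  filter_upwards [h, ae_imp_of_ae_restrict hM] with x h1 h2
  have hb : 0 < (1 + ‖x‖ ^ 2) ^ (-δ) := by positivity
  rcases le_total R ‖x‖ with hx | hx
  · refine (h1 hx).trans ?_
    gcongr
    exact le_add_of_nonneg_left (by positivity)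
  · refine (h2 (mem_closedBall_zero_iff.2 hx)).trans ?_
    have h3 : 1 ≤ (1 + R ^ 2) ^ δ * (1 + ‖x‖ ^ 2) ^ (-δ) := by
      calc (1 : ℝ) = (1 + ‖x‖ ^ 2) ^ δ * (1 + ‖x‖ ^ 2) ^ (-δ) := by
            rw [← Real.rpow_add (by positivity)]
            simp
        _ ≤ _ := by gcongr
    nlinarith [mul_nonneg hc hb.le, mul_le_mul_of_nonneg_left h3 hM0]

/-- The Leibniz rule summed over j; its explicit divergence is what turns the source into a first
order operator. -/
theorem hasWeakDivergence_vectorTimes {W : EuclideanSpace ℝ (Fin n) → EuclideanSpace ℝ (Fin n)}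
    {dW : Fin n → EuclideanSpace ℝ (Fin n) → ℝ}
    (hW : ∀ j, HasWeakPartial j (fun x => W x j) (dW j)) {M : ℝ} (hM : ∀ᵐ x, ‖W x‖ ≤ M)
    (hdW : ∀ j, MemLocalLp (dW j) 2) {f : EuclideanSpace ℝ (Fin n) → ℂ}
    {g : Fin n → EuclideanSpace ℝ (Fin n) → ℂ} (hf : ∀ j, HasWeakPartial j f (g j))
    (hf2 : MemLocalLp f 2) (hg2 : ∀ j, MemLocalLp (g j) 2) :
    HasWeakDivergence (vectorTimes W f)
      (fun x => ∑ j, ((dW j x : ℂ) * f x + (W x j : ℂ) * g j x)) := by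
  have h : ∀ j, HasWeakPartial j (fun x => (W x j : ℂ) * f x)
      (fun x => (dW j x : ℂ) * f x + (W x j : ℂ) * g j x) := fun j =>
    (hW j).mul (hM.mono fun x hx => (PiLp.norm_apply_le (W x) j).trans hx) (hdW j) (hf j) hf2
      (hg2 j)
  have e : vectorTimes W f = fun x => ∑ j, ((W x j : ℂ) * f x) • EuclideanSpace.single j (1 : ℂ) := by
    funext x
    ext i
    simp [vectorTimes, Pi.single_apply]
  refine ⟨?_, locallyIntegrable_finsetSum _ fun j _ => (h j).2.1, fun φ h1 h2 => ?_⟩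
  · rw [e]
    refine locallyIntegrable_finsetSum _ fun j _ => ?_
    have hj := (h j).1
    rw [locallyIntegrable_iff] at hj ⊢
    exact fun K hK => (hj K hK).smul_const _
  · have c1 : ∀ j : Fin n, Continuous fun x => fderiv ℝ φ x (EuclideanSpace.single j 1) := fun j =>
      (h1.continuous_fderiv (by simp)).clm_apply continuous_const
    have e' : ∀ x j, vectorTimes W f x j = (W x j : ℂ) * f x := fun _ _ => rfl
    simp only [Finset.smul_sum, e']
    rw [integral_finsetSum _ fun j _ => integrable_test_smul (c1 j) (h2.fderiv_apply ℝ _) (h j).1,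
      integral_finsetSum _ fun j _ => integrable_test_smul h1.continuous h2 (h j).2.1,
      ← Finset.sum_neg_distrib]
    exact Finset.sum_congr rfl fun j _ => (h j).2.2 φ h1 h2

theorem MemLocalLp.coord {ι : Type} [Fintype ι] {f : EuclideanSpace ℝ (Fin n) → EuclideanSpace ℝ ι}
    {p : ℝ≥0∞} (h : MemLocalLp f p) (i : ι) : MemLocalLp (fun x => f x i) p := fun K hK =>
  (h K hK).of_le ((EuclideanSpace.proj (𝕜 := ℝ) i).continuous.comp_aestronglyMeasurable (h K hK).1)
    (Eventually.of_forall fun _ => PiLp.norm_apply_le _ i)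

/-- The coefficient `i ∇·W - |W|² - V` of `f` in `i ∇·(W f) + i W·∇f - (|W|² + V) f`. -/
noncomputable def zerothOrderCoefficient (W : EuclideanSpace ℝ (Fin n) → EuclideanSpace ℝ (Fin n))
    (DW : EuclideanSpace ℝ (Fin n) → EuclideanSpace ℝ (Fin n × Fin n))
    (V : EuclideanSpace ℝ (Fin n) → ℝ) (x : EuclideanSpace ℝ (Fin n)) : ℂ :=
  I * (∑ j, (DW x (j, j) : ℂ)) - ((‖W x‖ ^ 2 + V x : ℝ) : ℂ)

variable {W : EuclideanSpace ℝ (Fin n) → EuclideanSpace ℝ (Fin n)}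
  {DW : EuclideanSpace ℝ (Fin n) → EuclideanSpace ℝ (Fin n × Fin n)}
  {V : EuclideanSpace ℝ (Fin n) → ℝ}

theorem memLocalLp_zerothOrderCoefficient {A : ℝ≥0} {p : ℝ≥0∞} (hW : MemLocalLp W ⊤)
    (hWM : ∀ᵐ x, ‖W x‖ ≤ A) (hDW : MemLocalLp DW p) (hV : MemLocalLp V p) :
    MemLocalLp (zerothOrderCoefficient W DW V) p := fun K hK => by
  have : IsFiniteMeasure (volume.restrict K) := ⟨by simpa using hK.measure_lt_top⟩
  have hw2 : MemLp (fun x => ‖W x‖ ^ 2) p (volume.restrict K) := by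
    refine MemLp.of_bound ((hW K hK).1.norm.pow 2) ((A : ℝ) ^ 2) ?_
    filter_upwards [ae_restrict_of_ae hWM] with x hx
    rw [norm_pow, norm_norm]
    gcongr
  have h1 : MemLp (fun x => ∑ j, (DW x (j, j) : ℂ)) p (volume.restrict K) :=
    memLp_finsetSum _ fun j _ => ((hDW.coord (j, j)) K hK).ofReal
  have h2 : MemLp (fun x => ((‖W x‖ ^ 2 + V x : ℝ) : ℂ)) p (volume.restrict K) :=
    (hw2.add (hV K hK)).ofReal
  exact (h1.const_mul I).sub h2

/-- In |W|² one factor is merely bounded by `A`; the decay of the other suffices. -/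
theorem norm_zerothOrderCoefficient_le {A : ℝ≥0} {c d R : ℝ} (hc : 0 ≤ c)
    (hdec : ∀ᵐ x, R ≤ ‖x‖ → |V x| ≤ c * (1 + ‖x‖ ^ 2) ^ (-d) ∧
      ‖W x‖ ≤ c * (1 + ‖x‖ ^ 2) ^ (-d) ∧ ‖DW x‖ ≤ c * (1 + ‖x‖ ^ 2) ^ (-d))
    (hWM : ∀ᵐ x, ‖W x‖ ≤ A) :
    ∀ᵐ x, R ≤ ‖x‖ → ‖zerothOrderCoefficient W DW V x‖
      ≤ (n * c + (A * c + c)).toNNReal * (1 + ‖x‖ ^ 2) ^ (-d) := by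
  filter_upwards [hdec, hWM] with x hx hM hR
  obtain ⟨h1, h2, h3⟩ := hx hR
  rw [Real.coe_toNNReal _ (by positivity), zerothOrderCoefficient]
  refine (norm_sub_le _ _).trans ?_
  rw [add_mul]
  refine add_le_add ?_ ?_
  · rw [norm_mul, norm_I, one_mul]
    refine (norm_sum_le _ _).trans ((Finset.sum_le_card_nsmul _ _ (c * (1 + ‖x‖ ^ 2) ^ (-d))
      fun j _ => ?_).trans (le_of_eq ?_))
    · rw [norm_real]
      exact (PiLp.norm_apply_le (DW x) (j, j)).trans h3
    · simp [mul_assoc]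
  · rw [norm_real, Real.norm_eq_abs, add_mul]
    refine (abs_add_le _ _).trans (add_le_add ?_ h1)
    rw [abs_of_nonneg (by positivity), sq, mul_assoc]
    exact mul_le_mul hM h2 (norm_nonneg _) A.2

end LippmannSchwinger

theorem lemma2p2 (n : ℕ) (p : ℝ≥0∞) (hnp : (n = 2 ∧ 2 < p) ∨ (n = 3 ∧ 3 ≤ p))
    (δ μ : ℝ) (hδ : ((n : ℝ) + 1) / 2 - n * (p⁻¹).toReal < δ) (hμ : 2 < μ)
    (W : EuclideanSpace ℝ (Fin n) → EuclideanSpace ℝ (Fin n))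
    (DW : EuclideanSpace ℝ (Fin n) → EuclideanSpace ℝ (Fin n × Fin n))
    (V : EuclideanSpace ℝ (Fin n) → ℝ)
    (hDW : ∀ j l : Fin n, HasWeakPartial j (fun x => W x l) (fun x => DW x (j, l)))
    (hW : MemWeightedLp W ⊤ δ) (hDWp : MemWeightedLp DW p δ) (hV : MemLocalLp V p)
    (hdecay : ∃ c R : ℝ, ∀ᵐ x : EuclideanSpace ℝ (Fin n), R ≤ ‖x‖ →
      |V x| ≤ c / ‖x‖ ^ μ ∧ ‖W x‖ ≤ c / ‖x‖ ^ μ ∧ ‖DW x‖ ≤ c / ‖x‖ ^ μ) :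
    ∃ δ₀ : ℝ, 1 / 2 < δ₀ ∧ ∀ k : ℝ, k ≠ 0 →
      ∃ L : WeightedH1 n (-δ₀) →L[ℂ] WeightedH1 n (-δ₀),
        IsCompactOperator L ∧ ∀ f : WeightedH1 n (-δ₀), IsLippmannSchwingerImage k W V f (L f) := by
  have hn : n = 2 ∨ n = 3 := hnp.imp And.left And.left
  have hp2 : (2 : ℝ≥0∞) ≤ p := by
    rcases hnp with ⟨_, h⟩ | ⟨_, h⟩
    · exact h.le
    · exact le_trans (by norm_num) h
  -- The decay is split evenly: multiplication by O(⟨x⟩^{-2d}) moves L²_{-d} to L²_d, and μ > 2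
  -- means d > 1, as the compactness of the resolvent requires.
  obtain ⟨d, rfl⟩ : ∃ d, μ = 2 * d := ⟨μ / 2, by ring⟩
  have hd1 : 1 < d := by linarith
  have hd0 : 0 ≤ d := by linarith
  obtain ⟨c, R, hcR⟩ := hdecay
  -- The given constant may be negative, hence |c|. The factor 2^d comes from 1 + |x|² ≤ 2|x|² for
  -- |x| ≥ 1, which is why the radius becomes `max R 1`.
  set c' : ℝ := |c| * 2 ^ d with hc'
  have hc0 : 0 ≤ c' := by positivity
  have hdec : ∀ᵐ x : EuclideanSpace ℝ (Fin n), max R 1 ≤ ‖x‖ →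
      |V x| ≤ c' * (1 + ‖x‖ ^ 2) ^ (-d) ∧ ‖W x‖ ≤ c' * (1 + ‖x‖ ^ 2) ^ (-d) ∧
        ‖DW x‖ ≤ c' * (1 + ‖x‖ ^ 2) ^ (-d) := by
    filter_upwards [hcR] with x hx hR
    obtain ⟨h1, h2, h3⟩ := hx ((le_max_left _ _).trans hR)
    have h4 : c / ‖x‖ ^ (2 * d) ≤ c' * (1 + ‖x‖ ^ 2) ^ (-d) :=
      (div_le_div_of_nonneg_right (le_abs_self c) (by positivity)).trans
        (div_rpow_le_bracket (abs_nonneg c) hd0 ((le_max_right _ _).trans hR))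
    exact ⟨h1.trans h4, h2.trans h4, h3.trans h4⟩
  have hWl := hW.memLocalLp
  have hDl := hDWp.memLocalLp
  obtain ⟨A, hA⟩ := exists_bracket_bound hWl hd0 hc0
    (hdec.mono fun x hx hR => (hx hR).2.1)
  have hWM : ∀ᵐ x, ‖W x‖ ≤ A := hA.mono fun x hx => hx.trans
    (mul_le_of_le_one_right A.2 (bracket_rpow_le_one x (by linarith)))
  have hB := memLocalLp_zerothOrderCoefficient hWl hWM hDl hV
  have hBC := norm_zerothOrderCoefficient_le hc0 hdec hWM
  -- The gradient coefficient is 2iW: one iW from expanding the divergence, one from the explicit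
  -- gradient term.
  obtain ⟨M, hM⟩ := exists_firstOrderOperator hnp hB hd0 hBC
    (w := fun j x => 2 * I * (W x j : ℂ)) (C' := 2 * A)
    (fun j => (continuous_ofReal.comp_aestronglyMeasurable
      (hWl.coord j).aestronglyMeasurable).const_mul _)
    (fun j => hA.mono fun x hx => by
      rw [norm_mul, norm_mul, norm_I, norm_real, mul_one, Complex.norm_ofNat]
      push_cast
      rw [mul_assoc]
      gcongr
      exact (PiLp.norm_apply_le (W x) j).trans hx)
  -- Both the weight `d` and the multiplication operator `M` are chosen before k; only the resolvent
  -- factor depends on it.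
  refine ⟨d, by linarith, fun k hk => ?_⟩
  obtain ⟨T, hT, hTψ⟩ := exists_greenOperator hn hk hd1
  refine ⟨T.comp M, hT.comp_clm M, fun f => ⟨_, hasWeakDivergence_vectorTimes (fun j => hDW j j) hWM
    (fun j => (hDl.coord (j, j)).mono_exponent hp2) f.2 (memLocalLp_h1Fun f)
    (memLocalLp_h1Grad f), ?_⟩⟩
  -- `M f` carries the factor ⟨y⟩^d that puts the source in plain L²; the weight inside the
  -- resolvent kernel removes it again.
  have hq : ∀ᵐ y, (((1 + ‖y‖ ^ 2) ^ (-(d / 2)) : ℝ) : ℂ) * M f y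
      = I * (∑ j, ((DW y (j, j) : ℂ) * h1Fun f y + (W y j : ℂ) * h1Grad f y j))
        + I * ∑ j, (W y j : ℂ) * h1Grad f y j - ((‖W y‖ ^ 2 + V y : ℝ) : ℂ) * h1Fun f y := by
    filter_upwards [hM f] with y hy
    have h0 : (0 : ℝ) < 1 + ‖y‖ ^ 2 := by positivity
    rw [hy, ← mul_assoc, ← ofReal_mul, ← Real.rpow_add h0, neg_add_cancel, Real.rpow_zero,
      ofReal_one, one_mul, zerothOrderCoefficient]
    simp only [mul_assoc, ← Finset.mul_sum, Finset.sum_add_distrib, ← Finset.sum_mul]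
    ring
  filter_upwards [hTψ (M f)] with x hx
  have hq' : ∀ᵐ y, outgoingGreen n k ‖x - y‖ * ((((1 + ‖y‖ ^ 2) ^ (-(d / 2)) : ℝ) : ℂ) * M f y)
      = outgoingGreen n k ‖x - y‖
        * (I * (∑ j, ((DW y (j, j) : ℂ) * h1Fun f y + (W y j : ℂ) * h1Grad f y j))
        + I * ∑ j, (W y j : ℂ) * h1Grad f y j - ((‖W y‖ ^ 2 + V y : ℝ) : ℂ) * h1Fun f y) :=
    hq.mono fun y hy => by rw [hy]
  exact ⟨hx.1.congr hq', hx.2.trans (integral_congr_ae hq')⟩
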